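/- Let $\tau,\bar\tau\in\mathbb C$ with $\operatorname{Im}\tau>0>\operatorname{Im}\bar\tau$ (the physical case is that $\bar\tau$ is the complex conjugate of $\tau$; this is not required). Let $\Sigma=\mathbb R^2/\mathbb Z^2$ with real coordinates $(x,y)$, put $z=x+\tau y$, $\bar z=x+\bar\tau y$, let $\partial=\partial_z$, $\bar\partial=\partial_{\bar z}$ be the dual derivations, and let $dz\,d\bar z=(\bar\tau-\tau)\,dx\,dy$. A potential is a smooth doubly periodic function $u:\Sigma\to\mathbb C$. A Bloch solution for $u$ with multipliers $(\alpha,\beta)\in(\mathbb C^\times)^2$ is a smooth solution of $\partial\bar\partial\psi=u\psi$ on the plane with $\psi(x+1,y)=\alpha\psi(x,y)$ and $\psi(x,y+1)=\beta\psi(x,y)$. Fix integers $m,n\ge 0$ and twists $(a_j,b_j)\in(\mathbb C^\times)^2$, $1\le j\le m+n$, with $a_j^2=b_j^2=1$ for $j>m$. Let $\mathcal U_{a,b}$ be the set of potentials $u$ that possess, for every $j$, nonzero Bloch solutions with multipliers $(a_j,b_j)$ and with multipliers $(a_j^{-1},b_j^{-1})$. The tangent space $T_u\mathcal U_{a,b}$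 at $u\in\mathcal U_{a,b}$ is the (Zariski) one: a smooth doubly periodic $\delta u$ belongs to it if $u+\varepsilon\,\delta u$ satisfies the defining conditions of $\mathcal U_{a,b}$ modulo $\varepsilon^2$, that is, if for each of the multipliers $(\alpha,\beta)=(a_j^{\pm1},b_j^{\pm1})$ there are a Bloch solution $\psi\ne0$ for $u$ and a smooth function $\delta\psi$, both with multipliers $(\alpha,\beta)$, such that $(\partial\bar\partial-u)\delta\psi=\delta u\,\psi$. A smooth family in $\mathcal U_{a,b}$ through $u$ is a function $u_t(x,y)$, smooth in $(t,x,y)$ for $|t|<\varepsilon$ with some $\varepsilon>0$, such that $u_0=u$ and $u_t\in\mathcal U_{a,b}$ for all $t$; its velocity is $\partial_tu_t|_{t=0}$. Let $u\in\mathcal U_{a,b}$, and assume that for every $j$ the space of Bloch solutions for $u$ with multipliers $(a_j,b_j)$ is one-dimensional. Let $\psi_j$ and $\psi_j^\sigma$ be nonzero Bloch solutions for $u$ with multipliers $(a_j,b_j)$ and $(a_j^{-1},b_j^{-1})$. Then: 1. A smooth doubly periodic $\delta u$ lies in $T_u\mathcal U_{a,b}$ if and only if $\int_\Sigma\delta u\,\psi_j\psi_j^\sigma\,dz\,d\bar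 z=0$ for every $j$. 2. The velocity of every smooth family in $\mathcal U_{a,b}$ through $u$ lies in $T_u\mathcal U_{a,b}$. If the functions $\psi_j\psi_j^\sigma$, $1\le j\le m+n$, are linearly independent, then a smooth doubly periodic $\delta u$ is the velocity of such a family if and only if $\int_\Sigma\delta u\,\psi_j\psi_j^\sigma\,dz\,d\bar z=0$ for every $j$. 3. The differential of $\langle u\rangle=\int_\Sigma u\,dz\,d\bar z$ vanishes on $T_u\mathcal U_{a,b}$ if and only if $u$ is the potential of a solution of the twisted complexified $O(2m+n)$ sigma model, that is, if and only if there are smooth functions $f_j$, $f_j^\sigma$ ($1\le j\le m$) and $\chi_i$ ($1\le i\le n$) on the plane, where $f_j$, $f_j^\sigma$, $\chi_i$ have multipliers $(a_j,b_j)$, $(a_j^{-1},b_j^{-1})$, $(a_{m+i},b_{m+i})$, which all satisfy the equation $\partial\bar\partial f=uf$, such that $$\sum_jf_j^\sigma f_j+\sum_i\chi_i^2=1,\qquad u=-\tfrac12\sum_j\left(\partial f_j^\sigma\,\bar\partial f_j+\bar\partial f_j^\sigma\,\partial f_j\right)-\sum_i\partial\chi_i\,\bar\partial\chi_i .$$ 4.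 If $u$ is the potential of such a solution, then $\frac{d}{dt}\big|_{t=0}\langle u_t\rangle=0$ for every smooth family $u_t$ in $\mathcal U_{a,b}$ through $u$; if the functions $\psi_j\psi_j^\sigma$ are linearly independent, the converse also holds. -/

import Mathlib

open Set MeasureTheory
open scoped ContDiff Topology

noncomputable section

namespace TorusSigma

/-! Functions on the torus `ℝ² / ℤ²` are functions of the real coordinates `(x, y)`; the complex
coordinates are `z = x + τ y` and `z̄ = x + τ' y`, where `τ'` plays the role of `τ̄`. -/

/-- The derivative `∂/∂x`. -/
def dX (f : ℝ × ℝ → ℂ) (p : ℝ × ℝ) : ℂ := fderiv ℝ f p (1, 0)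

/-- The derivative `∂/∂y`. -/
def dY (f : ℝ × ℝ → ℂ) (p : ℝ × ℝ) : ℂ := fderiv ℝ f p (0, 1)

/-- The derivative `∂ = ∂/∂z`, dual to `dz`: it sends `z` to `1` and `z̄` to `0`. -/
def dZ (τ τ' : ℂ) (f : ℝ × ℝ → ℂ) (p : ℝ × ℝ) : ℂ := (τ' * dX f p - dY f p) / (τ' - τ)

/-- The derivative `∂̄ = ∂/∂z̄`, dual to `dz̄`: it sends `z` to `0` and `z̄` to `1`. -/
def dZbar (τ τ' : ℂ) (f : ℝ × ℝ → ℂ) (p : ℝ × ℝ) : ℂ := (dY f p - τ * dX f p) / (τ' - τ)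

/-- The integral `∫_Σ f dz dz̄`, where `dz ∧ dz̄ = (τ' - τ) dx ∧ dy`. -/
def torusIntegral (τ τ' : ℂ) (f : ℝ × ℝ → ℂ) : ℂ :=
  (τ' - τ) * ∫ x in (0 : ℝ)..1, ∫ y in (0 : ℝ)..1, f (x, y)

/-- Smooth functions on the plane with Bloch multipliers `α` (along `z ↦ z + 1`) and
`β` (along `z ↦ z + τ`). -/
def twisted (α β : ℂˣ) : Submodule ℂ (ℝ × ℝ → ℂ) where
  carrier := {f | ContDiff ℝ ∞ f ∧ (∀ x y : ℝ, f (x + 1, y) = α * f (x, y)) ∧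
    ∀ x y : ℝ, f (x, y + 1) = β * f (x, y)}
  add_mem' := by
    rintro f g ⟨hf, hf1, hf2⟩ ⟨hg, hg1, hg2⟩
    refine ⟨hf.add hg, fun x y => ?_, fun x y => ?_⟩
    · simp only [Pi.add_apply, hf1, hg1, mul_add]
    · simp only [Pi.add_apply, hf2, hg2, mul_add]
  zero_mem' := ⟨contDiff_const, by simp, by simp⟩
  smul_mem' := by
    rintro c f ⟨hf, hf1, hf2⟩
    refine ⟨contDiff_const.smul hf, fun x y => ?_, fun x y => ?_⟩
    · simp only [Pi.smul_apply, smul_eq_mul, hf1]; ring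
    · simp only [Pi.smul_apply, smul_eq_mul, hf2]; ring

/-- The space of all potentials: smooth doubly periodic complex functions. -/
def potentials : Submodule ℂ (ℝ × ℝ → ℂ) := twisted 1 1

section Linearity

variable {τ τ' : ℂ} {f g : ℝ × ℝ → ℂ}

theorem dX_add (hf : Differentiable ℝ f) (hg : Differentiable ℝ g) : dX (f + g) = dX f + dX g := by
  funext p; simp [dX, fderiv_add (hf p) (hg p)]

theorem dY_add (hf : Differentiable ℝ f) (hg : Differentiable ℝ g) : dY (f + g) = dY f + dY g := by
  funext p; simp [dY, fderiv_add (hf p) (hg p)]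

theorem dX_smul (c : ℂ) (hf : Differentiable ℝ f) : dX (c • f) = c • dX f := by
  funext p; simp [dX, fderiv_const_smul (hf p) c]

theorem dY_smul (c : ℂ) (hf : Differentiable ℝ f) : dY (c • f) = c • dY f := by
  funext p; simp [dY, fderiv_const_smul (hf p) c]

theorem dZ_add (hf : Differentiable ℝ f) (hg : Differentiable ℝ g) :
    dZ τ τ' (f + g) = dZ τ τ' f + dZ τ τ' g := by
  funext p; simp only [dZ, dX_add hf hg, dY_add hf hg, Pi.add_apply]; ring

theorem dZbar_add (hf : Differentiable ℝ f) (hg : Differentiable ℝ g) :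
    dZbar τ τ' (f + g) = dZbar τ τ' f + dZbar τ τ' g := by
  funext p; simp only [dZbar, dX_add hf hg, dY_add hf hg, Pi.add_apply]; ring

theorem dZ_smul (c : ℂ) (hf : Differentiable ℝ f) : dZ τ τ' (c • f) = c • dZ τ τ' f := by
  funext p; simp only [dZ, dX_smul c hf, dY_smul c hf, Pi.smul_apply, smul_eq_mul]; ring

theorem dZbar_smul (c : ℂ) (hf : Differentiable ℝ f) :
    dZbar τ τ' (c • f) = c • dZbar τ τ' f := by
  funext p; simp only [dZbar, dX_smul c hf, dY_smul c hf, Pi.smul_apply, smul_eq_mul]; ring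

theorem differentiable_dZbar (hf : ContDiff ℝ ∞ f) : Differentiable ℝ (dZbar τ τ' f) := by
  have h : Differentiable ℝ (fderiv ℝ f) :=
    (hf.fderiv_right (m := 1) (by norm_cast)).differentiable (by simp)
  unfold dZbar dX dY
  fun_prop

end Linearity

/-- The space of Bloch solutions of `∂ ∂̄ ψ = u ψ` with multipliers `α`, `β`. -/
def bloch (τ τ' : ℂ) (u : ℝ × ℝ → ℂ) (α β : ℂˣ) : Submodule ℂ (ℝ × ℝ → ℂ) where
  carrier := {ψ | ψ ∈ twisted α β ∧ ∀ p, dZ τ τ' (dZbar τ τ' ψ) p = u p * ψ p}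
  add_mem' := by
    rintro f g ⟨hf, hf1⟩ ⟨hg, hg1⟩
    refine ⟨add_mem hf hg, fun p => ?_⟩
    rw [dZbar_add (hf.1.differentiable (by simp)) (hg.1.differentiable (by simp)),
      dZ_add (differentiable_dZbar hf.1) (differentiable_dZbar hg.1)]
    simp only [Pi.add_apply, hf1, hg1]; ring
  zero_mem' := by
    refine ⟨zero_mem _, fun p => ?_⟩
    have h : dZbar τ τ' (0 : ℝ × ℝ → ℂ) = 0 := by funext q; simp [dZbar, dX, dY]
    rw [h]; simp [dZ, dX, dY]
  smul_mem' := by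
    rintro c f ⟨hf, hf1⟩
    refine ⟨Submodule.smul_mem _ c hf, fun p => ?_⟩
    rw [dZbar_smul c (hf.1.differentiable (by simp)), dZ_smul c (differentiable_dZbar hf.1)]
    simp only [Pi.smul_apply, smul_eq_mul, hf1]; ring

/-- The Fermi curve of `u`: the multipliers of the nonzero Bloch solutions. -/
def fermiCurve (τ τ' : ℂ) (u : ℝ × ℝ → ℂ) : Set (ℂˣ × ℂˣ) :=
  {M | ∃ ψ ∈ bloch τ τ' u M.1 M.2, ψ ≠ 0}

/-- The locus `U_{a,b}`: potentials whose Fermi curve passes through all the twist points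
`(a_j, b_j)` and `(a_j⁻¹, b_j⁻¹)`. -/
def locus {J : Type*} (τ τ' : ℂ) (a b : J → ℂˣ) : Set (ℝ × ℝ → ℂ) :=
  {u | u ∈ potentials ∧
    ∀ j, (a j, b j) ∈ fermiCurve τ τ' u ∧ ((a j)⁻¹, (b j)⁻¹) ∈ fermiCurve τ τ' u}

/-- To first order in `ε` (that is, modulo `ε²`), the potential `u + ε v` has a nonzero Bloch
solution `ψ + ε φ` with the fixed multipliers `α`, `β`. -/
def StaysOnFermiCurve (τ τ' : ℂ) (u v : ℝ × ℝ → ℂ) (α β : ℂˣ) : Prop :=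
  ∃ ψ ∈ bloch τ τ' u α β, ψ ≠ 0 ∧
    ∃ φ ∈ twisted α β, ∀ p, dZ τ τ' (dZbar τ τ' φ) p = u p * φ p + v p * ψ p

/-- The (Zariski) tangent space to `U_{a,b}` at `u`: the variations `v` for which `u + ε v`
satisfies the defining conditions of `U_{a,b}` to first order in `ε`. -/
def tangent {J : Type*} (τ τ' : ℂ) (a b : J → ℂˣ) (u : ℝ × ℝ → ℂ) : Set (ℝ × ℝ → ℂ) :=
  {v | v ∈ potentials ∧
    ∀ j, StaysOnFermiCurve τ τ' u v (a j) (b j) ∧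
      StaysOnFermiCurve τ τ' u v (a j)⁻¹ (b j)⁻¹}

/-- `γ` is a smooth one-parameter family of potentials in `U_{a,b}`, defined for `t` near `0`,
with `γ 0 = u`. -/
def IsFamilyThrough {J : Type*} (τ τ' : ℂ) (a b : J → ℂˣ) (u : ℝ × ℝ → ℂ)
    (γ : ℝ → ℝ × ℝ → ℂ) : Prop :=
  γ 0 = u ∧ ∃ ε : ℝ, 0 < ε ∧
    ContDiffOn ℝ ∞ (fun q : ℝ × (ℝ × ℝ) => γ q.1 q.2) (Ioo (-ε) ε ×ˢ univ) ∧
    ∀ t ∈ Ioo (-ε) ε, γ t ∈ locus τ τ' a b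

/-- The variation `v` is the velocity at `u` of a smooth one-parameter family in `U_{a,b}`. -/
def IsVelocity {J : Type*} (τ τ' : ℂ) (a b : J → ℂˣ) (u v : ℝ × ℝ → ℂ) : Prop :=
  ∃ γ : ℝ → ℝ × ℝ → ℂ, IsFamilyThrough τ τ' a b u γ ∧
    ∀ p, HasDerivAt (fun t => γ t p) (v p) 0

/-- The differential of `⟨u⟩ = ∫_Σ u dz dz̄` vanishes on the tangent space to `U_{a,b}` at `u`. -/
def IsCritical {J : Type*} (τ τ' : ℂ) (a b : J → ℂˣ) (u : ℝ × ℝ → ℂ) : Prop :=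
  ∀ v ∈ tangent τ τ' a b u, torusIntegral τ τ' v = 0

/-- The functional `⟨u⟩` is stationary at `u` along every smooth one-parameter family
in `U_{a,b}` through `u`. -/
def IsStationary {J : Type*} (τ τ' : ℂ) (a b : J → ℂˣ) (u : ℝ × ℝ → ℂ) : Prop :=
  ∀ γ : ℝ → ℝ × ℝ → ℂ, IsFamilyThrough τ τ' a b u γ →
    HasDerivAt (fun t => torusIntegral τ τ' (γ t)) 0 0

/-- The fields `ψ`, `ψσ`, `χ` solve the equations of motion of the complexified
`O(2m + n)` sigma model with twisted boundary conditions, with Lagrange multiplier `u`. -/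
structure IsSigmaModelSolution {m n : ℕ} (τ τ' : ℂ) (a b : Fin m ⊕ Fin n → ℂˣ)
    (u : ℝ × ℝ → ℂ) (ψ ψσ : Fin m → ℝ × ℝ → ℂ) (χ : Fin n → ℝ × ℝ → ℂ) : Prop where
  twist_ψ : ∀ j, ψ j ∈ twisted (a (.inl j)) (b (.inl j))
  twist_ψσ : ∀ j, ψσ j ∈ twisted (a (.inl j))⁻¹ (b (.inl j))⁻¹
  twist_χ : ∀ i, χ i ∈ twisted (a (.inr i)) (b (.inr i))
  eq_ψ : ∀ j p, dZ τ τ' (dZbar τ τ' (ψ j)) p = u p * ψ j p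
  eq_ψσ : ∀ j p, dZ τ τ' (dZbar τ τ' (ψσ j)) p = u p * ψσ j p
  eq_χ : ∀ i p, dZ τ τ' (dZbar τ τ' (χ i)) p = u p * χ i p
  constraint : ∀ p, ∑ j, ψσ j p * ψ j p + ∑ i, χ i p ^ 2 = 1
  multiplier : ∀ p, u p =
    -(1 / 2) * ∑ j, (dZ τ τ' (ψσ j) p * dZbar τ τ' (ψ j) p
      + dZbar τ τ' (ψσ j) p * dZ τ τ' (ψ j) p)
    - ∑ i, dZ τ τ' (χ i) p * dZbar τ τ' (χ i) p

end TorusSigma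

end

noncomputable section

namespace TorusSigma

section

/-! ### Integration over the unit square -/

/-! The theorem rests on Fredholm theory for `H = ∂∂̄ - u` on smooth functions with fixed
multipliers. The bilinear pairing `∫ f g` puts the multipliers `(α, β)` in duality with `(α⁻¹,
β⁻¹)`; it is nondegenerate, and `H` is its own transpose (`sqInt_schr_mul`). As `τ` and `τ'` are not
real, `∂∂̄` is elliptic and the Fredholm alternative holds. If `ψ` spans the kernel of `H`, then
`ψσ` spans the kernel for the dual multipliers (`bloch_dual_span`), and `H f = h` is solvable
exactly when `∫ h ψσ = 0` (`exists_schr_eq`). Taking `h = δu ψ` gives the tangent space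
(`staysOnFermiCurve_iff`).

The analysis takes place on Fourier coefficients, regarded as bounded sequences on `ℤ × ℤ`: `∂∂̄`
multiplies by a quadratic symbol, a potential convolves with a rapidly decreasing sequence, and the
resolvent of `∂∂̄` at a regular value is compact. The kernel of `H` is removed by bordering: the
rank one term `f ↦ f̂(k₀) r`, with `ψ̂(k₀) ≠ 0` and `∫ r ψσ = 1`, makes the operator invertible
(`bordered_injective`, `RegularValue.isUnit_bordered`), and its solutions are smooth for smooth data
(`RegularValue.exists_ftL_eq`).

For a family `u_t`, nothing is known about how its Bloch solutions depend on `t`. Invertibility of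
the bordered operator nevertheless gives a bound for `∫ (u_t - u) ψ ψσ` of second order in `u_t - u`
(`exists_norm_sqInt_sub_le`), so velocities are orthogonal to `ψ ψσ`. Conversely, near `u` in a
finite-dimensional family of potentials, the vanishing of one analytic function with differential
`δu ↦ ∫ δu ψ ψσ` suffices for a Bloch solution to persist (`exists_local_equation`). If the products
`ψ_j ψσ_j` are independent, the inverse function theorem integrates every orthogonal `δu` to a
family (`isVelocity_of_orthogonal`).

Finally, `∫ δu` vanishes on the common kernel of the functionals `∫ δu ψ_j ψσ_j` if and only if `1 =
∑ c_j ψ_j ψσ_j` (`forall_sqInt_eq_zero_iff`). Absorbing the `c_j` into the fields turns this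
relation into the sigma model constraint, and applying `∂∂̄` to the constraint yields the formula
for `u` (`exists_isSigmaModelSolution_iff`, `multiplier_eq`). -/

/-- The integral over the unit square. -/
def sqInt (f : ℝ × ℝ → ℂ) : ℂ := ∫ x in (0 : ℝ)..1, ∫ y in (0 : ℝ)..1, f (x, y)

/-- Lebesgue measure on the unit square. -/
def sqMeasure : Measure (ℝ × ℝ) :=
  (volume.restrict (Ioc (0 : ℝ) 1)).prod (volume.restrict (Ioc (0 : ℝ) 1))

theorem sqMeasure_eq : sqMeasure = volume.restrict (Ioc (0 : ℝ) 1 ×ˢ Ioc (0 : ℝ) 1) :=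
  Measure.prod_restrict _ _

instance : IsFiniteMeasure sqMeasure := by
  unfold sqMeasure; infer_instance

theorem ae_sqMeasure : ∀ᵐ p ∂sqMeasure, p ∈ Icc ((0 : ℝ), (0 : ℝ)) (1, 1) := by
  rw [sqMeasure_eq]
  filter_upwards [ae_restrict_mem (measurableSet_Ioc.prod measurableSet_Ioc)] with p hp
  exact ⟨⟨hp.1.1.le, hp.2.1.le⟩, ⟨hp.1.2, hp.2.2⟩⟩

theorem integrable_sqMeasure {f : ℝ × ℝ → ℂ} (hf : Continuous f) : Integrable f sqMeasure := by
  obtain ⟨C, hC⟩ := (isCompact_Icc (a := ((0 : ℝ), (0 : ℝ))) (b := (1, 1))).exists_bound_of_continuousOn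
    hf.continuousOn
  refine Integrable.of_bound hf.aestronglyMeasurable C ?_
  filter_upwards [ae_sqMeasure] with p hp using hC p hp

theorem sqInt_eq_integral {f : ℝ × ℝ → ℂ} (hf : Continuous f) :
    sqInt f = ∫ p, f p ∂sqMeasure := by
  rw [sqMeasure, integral_prod _ (integrable_sqMeasure hf), sqInt]
  simp only [intervalIntegral.integral_of_le zero_le_one]

theorem sqInt_add {f g : ℝ × ℝ → ℂ} (hf : Continuous f) (hg : Continuous g) :
    sqInt (fun p => f p + g p) = sqInt f + sqInt g := by
  rw [sqInt_eq_integral hf, sqInt_eq_integral hg, sqInt_eq_integral (by fun_prop : Continuous fun p => f p + g p),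
    integral_add (integrable_sqMeasure hf) (integrable_sqMeasure hg)]

theorem sqInt_sub {f g : ℝ × ℝ → ℂ} (hf : Continuous f) (hg : Continuous g) :
    sqInt (fun p => f p - g p) = sqInt f - sqInt g := by
  rw [sqInt_eq_integral hf, sqInt_eq_integral hg, sqInt_eq_integral (by fun_prop : Continuous fun p => f p - g p),
    integral_sub (integrable_sqMeasure hf) (integrable_sqMeasure hg)]

theorem sqInt_const_mul (c : ℂ) (f : ℝ × ℝ → ℂ) :
    sqInt (fun p => c * f p) = c * sqInt f := by
  simp [sqInt]

theorem sqInt_sum {ι : Type*} (s : Finset ι) {f : ι → ℝ × ℝ → ℂ}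
    (hf : ∀ i ∈ s, Continuous (f i)) :
    sqInt (fun p => ∑ i ∈ s, f i p) = ∑ i ∈ s, sqInt (f i) := by
  rw [sqInt_eq_integral (continuous_finsetSum _ hf),
    integral_finsetSum _ fun i hi => integrable_sqMeasure (hf i hi)]
  exact Finset.sum_congr rfl fun i hi => (sqInt_eq_integral (hf i hi)).symm

theorem norm_sqInt_le {f : ℝ × ℝ → ℂ} {C : ℝ}
    (hC : ∀ p ∈ Icc ((0 : ℝ), (0 : ℝ)) (1, 1), ‖f p‖ ≤ C) : ‖sqInt f‖ ≤ C := by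
  have h : ∀ x ∈ Ioc (0 : ℝ) 1, ‖∫ y in (0 : ℝ)..1, f (x, y)‖ ≤ C := fun x hx => by
    have := intervalIntegral.norm_integral_le_of_norm_le_const (a := 0) (b := 1) (C := C)
      (f := fun y => f (x, y)) fun y hy => by
        rw [uIoc_of_le zero_le_one] at hy
        exact hC _ ⟨⟨hx.1.le, hy.1.le⟩, ⟨hx.2, hy.2⟩⟩
    simpa using this
  have := intervalIntegral.norm_integral_le_of_norm_le_const (a := 0) (b := 1) (C := C)
      (f := fun x => ∫ y in (0 : ℝ)..1, f (x, y)) fun x hx => by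
        rw [uIoc_of_le zero_le_one] at hx
        exact h x hx
  simpa [sqInt] using this

theorem hasSum_sqInt {ι : Type*} [Countable ι] {F : ι → ℝ × ℝ → ℂ} {f : ℝ × ℝ → ℂ} {b : ι → ℝ}
    (hF : ∀ i, Continuous (F i)) (hf : Continuous f) (hb : Summable b)
    (hFb : ∀ i, ∀ p ∈ Icc ((0 : ℝ), (0 : ℝ)) (1, 1), ‖F i p‖ ≤ b i)
    (hsum : ∀ p, HasSum (fun i => F i p) (f p)) :
    HasSum (fun i => sqInt (F i)) (sqInt f) := by
  rw [sqInt_eq_integral hf]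
  simp only [fun i => sqInt_eq_integral (hF i)]
  refine hasSum_integral_of_dominated_convergence (fun i _ => b i)
    (fun i => (hF i).aestronglyMeasurable) (fun i => ?_) (.of_forall fun _ => hb)
    (integrable_const _) (.of_forall hsum)
  filter_upwards [ae_sqMeasure] with p hp using hFb i p hp

/-! ### Exponentials and twisted functions -/

/-- The exponential, as a unit. -/
def expU (z : ℂ) : ℂˣ := Units.mk0 (Complex.exp z) (Complex.exp_ne_zero z)

@[simp] theorem coe_expU (z : ℂ) : (expU z : ℂ) = Complex.exp z := rfl

theorem exists_expU (α : ℂˣ) : ∃ μ, expU μ = α :=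
  ⟨Complex.log α, Units.ext (Complex.exp_log α.ne_zero)⟩

theorem expU_add (z w : ℂ) : expU (z + w) = expU z * expU w :=
  Units.ext (Complex.exp_add z w)

@[simp] theorem expU_zero : expU 0 = 1 := Units.ext Complex.exp_zero

theorem expU_neg (z : ℂ) : expU (-z) = (expU z)⁻¹ := by
  rw [eq_inv_iff_mul_eq_one, ← expU_add]; simp

/-- The exponential `exp (X x + Y y)`. -/
def ex (X Y : ℂ) (p : ℝ × ℝ) : ℂ := Complex.exp (X * p.1 + Y * p.2)

theorem contDiff_ex (X Y : ℂ) {n : WithTop ℕ∞} : ContDiff ℝ n (ex X Y) := by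
  have h1 : ContDiff ℝ n fun p : ℝ × ℝ => (p.1 : ℂ) := Complex.ofRealCLM.contDiff.comp contDiff_fst
  have h2 : ContDiff ℝ n fun p : ℝ × ℝ => (p.2 : ℂ) := Complex.ofRealCLM.contDiff.comp contDiff_snd
  exact ((contDiff_const.mul h1).add (contDiff_const.mul h2)).cexp

@[fun_prop]
theorem continuous_ex (X Y : ℂ) : Continuous (ex X Y) := (contDiff_ex X Y (n := 0)).continuous

theorem ex_mul_ex (X Y X' Y' : ℂ) (p : ℝ × ℝ) :
    ex X Y p * ex X' Y' p = ex (X + X') (Y + Y') p := by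
  rw [ex, ex, ex, ← Complex.exp_add]; ring_nf

@[simp] theorem ex_zero (p : ℝ × ℝ) : ex 0 0 p = 1 := by simp [ex]

theorem ex_ne_zero (X Y : ℂ) (p : ℝ × ℝ) : ex X Y p ≠ 0 := Complex.exp_ne_zero _

theorem hasFDerivAt_ex (X Y : ℂ) (p : ℝ × ℝ) :
    HasFDerivAt (ex X Y) (ex X Y p • (X • Complex.ofRealCLM.comp (ContinuousLinearMap.fst ℝ ℝ ℝ) +
      Y • Complex.ofRealCLM.comp (ContinuousLinearMap.snd ℝ ℝ ℝ))) p := by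
  have h1 : HasFDerivAt (fun p : ℝ × ℝ => (p.1 : ℂ))
    (Complex.ofRealCLM.comp (ContinuousLinearMap.fst ℝ ℝ ℝ)) p :=
      (Complex.ofRealCLM.comp (ContinuousLinearMap.fst ℝ ℝ ℝ)).hasFDerivAt
  have h2 : HasFDerivAt (fun p : ℝ × ℝ => (p.2 : ℂ))
    (Complex.ofRealCLM.comp (ContinuousLinearMap.snd ℝ ℝ ℝ)) p :=
      (Complex.ofRealCLM.comp (ContinuousLinearMap.snd ℝ ℝ ℝ)).hasFDerivAt
  exact ((h1.const_mul X).add (h2.const_mul Y)).cexp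

theorem dX_ex (X Y : ℂ) (p : ℝ × ℝ) : dX (ex X Y) p = X * ex X Y p := by
  rw [dX, (hasFDerivAt_ex X Y p).fderiv]; simp [mul_comm]

theorem dY_ex (X Y : ℂ) (p : ℝ × ℝ) : dY (ex X Y) p = Y * ex X Y p := by
  rw [dY, (hasFDerivAt_ex X Y p).fderiv]; simp [mul_comm]

theorem ex_mem_twisted (X Y : ℂ) : ex X Y ∈ twisted (expU X) (expU Y) := by
  refine ⟨contDiff_ex X Y, fun x y => ?_, fun x y => ?_⟩ <;>
  · simp only [ex, coe_expU, ← Complex.exp_add]; push_cast; ring_nf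

/-- The frequencies `μ + 2πik`. -/
def freq (μ : ℂ) (k : ℤ) : ℂ := μ + 2 * Real.pi * Complex.I * k

theorem expU_freq (μ : ℂ) (k : ℤ) : expU (freq μ k) = expU μ := by
  ext
  rw [coe_expU, freq, show μ + 2 * Real.pi * Complex.I * k = μ + k * (2 * Real.pi * Complex.I) by ring,
    Complex.exp_add, Complex.exp_int_mul_two_pi_mul_I, mul_one, coe_expU]

theorem expU_neg_freq (μ : ℂ) (k : ℤ) : expU (-freq μ k) = (expU μ)⁻¹ := by
  rw [expU_neg, expU_freq]

theorem freq_neg (μ : ℂ) (k : ℤ) : freq (-μ) (-k) = -freq μ k := by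
  simp [freq]; ring

/-- The shift by `2πik` is imaginary, so bounds on the unit square are uniform in the frequency. -/
theorem norm_ex_freq (μ ν : ℂ) (k l : ℤ) (p : ℝ × ℝ) :
    ‖ex (freq μ k) (freq ν l) p‖ = ‖ex μ ν p‖ := by
  simp [ex, Complex.norm_exp, freq]

theorem mul_mem_twisted {α β α' β' : ℂˣ} {f g : ℝ × ℝ → ℂ} (hf : f ∈ twisted α β)
    (hg : g ∈ twisted α' β') : f * g ∈ twisted (α * α') (β * β') := by
  obtain ⟨hf, hf1, hf2⟩ := hf
  obtain ⟨hg, hg1, hg2⟩ := hg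
  refine ⟨hf.mul hg, fun x y => ?_, fun x y => ?_⟩
  · simp only [Pi.mul_apply, hf1, hg1, Units.val_mul]; ring
  · simp only [Pi.mul_apply, hf2, hg2, Units.val_mul]; ring

theorem potential_mul_mem_twisted {α β : ℂˣ} {u f : ℝ × ℝ → ℂ} (hu : u ∈ potentials)
    (hf : f ∈ twisted α β) : u * f ∈ twisted α β := by
  simpa using mul_mem_twisted hu hf

theorem mul_inv_mem_potentials {α β : ℂˣ} {f g : ℝ × ℝ → ℂ} (hf : f ∈ twisted α β)
    (hg : g ∈ twisted α⁻¹ β⁻¹) : f * g ∈ potentials := by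
  simpa [potentials] using mul_mem_twisted hf hg

theorem continuous_of_mem_twisted {α β : ℂˣ} {f : ℝ × ℝ → ℂ} (hf : f ∈ twisted α β) :
    Continuous f := hf.1.continuous

theorem differentiable_of_mem_twisted {α β : ℂˣ} {f : ℝ × ℝ → ℂ} (hf : f ∈ twisted α β) :
    Differentiable ℝ f := hf.1.differentiable (by simp)

theorem contDiff_fderiv_apply {f : ℝ × ℝ → ℂ} (hf : ContDiff ℝ ∞ f) (v : ℝ × ℝ) :
    ContDiff ℝ ∞ fun p => fderiv ℝ f p v :=
  (hf.fderiv_right (m := ∞) (by norm_cast)).clm_apply contDiff_const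

theorem fderiv_apply_mem_twisted {α β : ℂˣ} {f : ℝ × ℝ → ℂ} (hf : f ∈ twisted α β) (v : ℝ × ℝ) :
    (fun p => fderiv ℝ f p v) ∈ twisted α β := by
  have hd := differentiable_of_mem_twisted hf
  have key : ∀ (c : ℂ) (w : ℝ × ℝ), (∀ p, f (p + w) = c * f p) →
      ∀ p, fderiv ℝ f (p + w) v = c * fderiv ℝ f p v := fun c w h p => by
    have h1 : fderiv ℝ (fun q => f (q + w)) p = fderiv ℝ f (p + w) := fderiv_comp_add_right w
    rw [← h1, funext h, fderiv_const_mul (hd p)]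
    simp
  refine ⟨contDiff_fderiv_apply hf.1 v, fun x y => ?_, fun x y => ?_⟩
  · have := key α (1, 0) (fun p => by
      have := hf.2.1 p.1 p.2
      rwa [show p + (1, 0) = (p.1 + 1, p.2) by ext <;> simp]) (x, y)
    simpa using this
  · have := key β (0, 1) (fun p => by
      have := hf.2.2 p.1 p.2
      rwa [show p + (0, 1) = (p.1, p.2 + 1) by ext <;> simp]) (x, y)
    simpa using this

theorem dX_mem_twisted {α β : ℂˣ} {f : ℝ × ℝ → ℂ} (hf : f ∈ twisted α β) :
    dX f ∈ twisted α β := fderiv_apply_mem_twisted hf _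

theorem dY_mem_twisted {α β : ℂˣ} {f : ℝ × ℝ → ℂ} (hf : f ∈ twisted α β) :
    dY f ∈ twisted α β := fderiv_apply_mem_twisted hf _

theorem dX_mul {f g : ℝ × ℝ → ℂ} (hf : Differentiable ℝ f) (hg : Differentiable ℝ g) (p : ℝ × ℝ) :
    dX (f * g) p = dX f p * g p + f p * dX g p := by
  simp only [dX, fderiv_mul (hf p) (hg p)]; simp; ring

theorem dY_mul {f g : ℝ × ℝ → ℂ} (hf : Differentiable ℝ f) (hg : Differentiable ℝ g) (p : ℝ × ℝ) :
    dY (f * g) p = dY f p * g p + f p * dY g p := by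
  simp only [dY, fderiv_mul (hf p) (hg p)]; simp; ring

section Complex

variable {τ τ' : ℂ}

theorem dZ_eq (f : ℝ × ℝ → ℂ) :
    dZ τ τ' f = (τ' / (τ' - τ)) • dX f + (-1 / (τ' - τ)) • dY f := by
  funext p; simp only [dZ, Pi.add_apply, Pi.smul_apply, smul_eq_mul]; ring

theorem dZbar_eq (f : ℝ × ℝ → ℂ) :
    dZbar τ τ' f = (-τ / (τ' - τ)) • dX f + (1 / (τ' - τ)) • dY f := by
  funext p; simp only [dZbar, Pi.add_apply, Pi.smul_apply, smul_eq_mul]; ring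

theorem dZ_mem_twisted {α β : ℂˣ} {f : ℝ × ℝ → ℂ} (hf : f ∈ twisted α β) :
    dZ τ τ' f ∈ twisted α β := by
  rw [dZ_eq]
  exact add_mem (Submodule.smul_mem _ _ (dX_mem_twisted hf))
    (Submodule.smul_mem _ _ (dY_mem_twisted hf))

theorem dZbar_mem_twisted {α β : ℂˣ} {f : ℝ × ℝ → ℂ} (hf : f ∈ twisted α β) :
    dZbar τ τ' f ∈ twisted α β := by
  rw [dZbar_eq]
  exact add_mem (Submodule.smul_mem _ _ (dX_mem_twisted hf))
    (Submodule.smul_mem _ _ (dY_mem_twisted hf))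

theorem dZ_mul {f g : ℝ × ℝ → ℂ} (hf : Differentiable ℝ f) (hg : Differentiable ℝ g) (p : ℝ × ℝ) :
    dZ τ τ' (f * g) p = dZ τ τ' f p * g p + f p * dZ τ τ' g p := by
  simp only [dZ, dX_mul hf hg, dY_mul hf hg]; ring

theorem dZbar_mul {f g : ℝ × ℝ → ℂ} (hf : Differentiable ℝ f) (hg : Differentiable ℝ g)
    (p : ℝ × ℝ) :
    dZbar τ τ' (f * g) p = dZbar τ τ' f p * g p + f p * dZbar τ τ' g p := by
  simp only [dZbar, dX_mul hf hg, dY_mul hf hg]; ring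

end Complex

theorem sqInt_dY {f : ℝ × ℝ → ℂ} (hf : f ∈ potentials) : sqInt (dY f) = 0 := by
  have hd := differentiable_of_mem_twisted hf
  have h : ∀ x : ℝ, ∫ y in (0 : ℝ)..1, dY f (x, y) = 0 := fun x => by
    have h1 : ∀ y ∈ uIcc (0 : ℝ) 1, HasDerivAt (fun y => f (x, y)) (dY f (x, y)) y := fun y _ => by
      exact (hd (x, y)).hasFDerivAt.comp_hasDerivAt y
        ((hasDerivAt_const y x).prodMk (hasDerivAt_id' y))
    rw [intervalIntegral.integral_eq_sub_of_hasDerivAt h1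
      (((continuous_of_mem_twisted (dY_mem_twisted hf)).comp
        (Continuous.prodMk_right x)).intervalIntegrable _ _)]
    have := hf.2.2 x 0
    simp at this
    simp [this]
  simp [sqInt, h]

theorem sqInt_dX {f : ℝ × ℝ → ℂ} (hf : f ∈ potentials) : sqInt (dX f) = 0 := by
  have hd := differentiable_of_mem_twisted hf
  have hc := continuous_of_mem_twisted (dX_mem_twisted hf)
  have h : ∀ y : ℝ, ∫ x in (0 : ℝ)..1, dX f (x, y) = 0 := fun y => by
    have h1 : ∀ x ∈ uIcc (0 : ℝ) 1, HasDerivAt (fun x => f (x, y)) (dX f (x, y)) x := fun x _ => by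
      exact (hd (x, y)).hasFDerivAt.comp_hasDerivAt x
        ((hasDerivAt_id' x).prodMk (hasDerivAt_const x y))
    rw [intervalIntegral.integral_eq_sub_of_hasDerivAt h1
      ((hc.comp (Continuous.prodMk_left y)).intervalIntegrable _ _)]
    have := hf.2.1 0 y
    simp at this
    simp [this]
  rw [sqInt, intervalIntegral_intervalIntegral_swap]
  · simp [h]
  · rw [uIoc_of_le zero_le_one]
    have := integrable_sqMeasure hc
    rwa [sqMeasure_eq] at this

end

section

/-! ### Fourier coefficients of twisted functions -/

/-- The Fourier coefficients of a function with multipliers `exp μ`, `exp ν`. -/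
def ft (μ ν : ℂ) (f : ℝ × ℝ → ℂ) (k : ℤ × ℤ) : ℂ :=
  sqInt fun p => f p * ex (-freq μ k.1) (-freq ν k.2) p

variable {μ ν μ' ν' : ℂ}

theorem ft_add {f g : ℝ × ℝ → ℂ} (hf : Continuous f) (hg : Continuous g) (k : ℤ × ℤ) :
    ft μ ν (f + g) k = ft μ ν f k + ft μ ν g k := by
  rw [ft, ft, ft, ← sqInt_add (f := fun p => f p * ex (-freq μ k.1) (-freq ν k.2) p)
    (g := fun p => g p * ex (-freq μ k.1) (-freq ν k.2) p) (by fun_prop) (by fun_prop)]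
  simp [add_mul]

theorem ft_sub {f g : ℝ × ℝ → ℂ} (hf : Continuous f) (hg : Continuous g) (k : ℤ × ℤ) :
    ft μ ν (f - g) k = ft μ ν f k - ft μ ν g k := by
  rw [ft, ft, ft, ← sqInt_sub (f := fun p => f p * ex (-freq μ k.1) (-freq ν k.2) p)
    (g := fun p => g p * ex (-freq μ k.1) (-freq ν k.2) p) (by fun_prop) (by fun_prop)]
  simp [sub_mul]

theorem ft_smul (c : ℂ) (f : ℝ × ℝ → ℂ) (k : ℤ × ℤ) :
    ft μ ν (c • f) k = c * ft μ ν f k := by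
  rw [ft, ft, ← sqInt_const_mul]
  simp [mul_assoc]

theorem mul_ex_mem_potentials {f : ℝ × ℝ → ℂ} (hf : f ∈ twisted (expU μ) (expU ν)) (k : ℤ × ℤ) :
    f * ex (-freq μ k.1) (-freq ν k.2) ∈ potentials := by
  refine mul_inv_mem_potentials hf ?_
  rw [← expU_neg_freq μ k.1, ← expU_neg_freq ν k.2]
  exact ex_mem_twisted _ _

/-- Integration by parts: the dual exponential cancels the multipliers of `f`, so the product is
periodic and its derivative integrates to zero. -/
theorem ft_dX {f : ℝ × ℝ → ℂ} (hf : f ∈ twisted (expU μ) (expU ν)) (k : ℤ × ℤ) :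
    ft μ ν (dX f) k = freq μ k.1 * ft μ ν f k := by
  have h := sqInt_dX (mul_ex_mem_potentials hf k)
  have h2 : dX (f * ex (-freq μ k.1) (-freq ν k.2)) =
      fun p => dX f p * ex (-freq μ k.1) (-freq ν k.2) p -
        freq μ k.1 * (f p * ex (-freq μ k.1) (-freq ν k.2) p) := by
    funext p
    rw [dX_mul (differentiable_of_mem_twisted hf)
      ((contDiff_ex _ _ (n := 1)).differentiable (by simp)), dX_ex]
    ring
  have hc := continuous_of_mem_twisted hf
  have hc' := continuous_of_mem_twisted (dX_mem_twisted hf)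
  rw [h2, sqInt_sub (f := fun p => dX f p * ex (-freq μ k.1) (-freq ν k.2) p)
    (g := fun p => freq μ k.1 * (f p * ex (-freq μ k.1) (-freq ν k.2) p)) (by fun_prop) (by fun_prop),
    sqInt_const_mul, sub_eq_zero] at h
  exact h

theorem ft_dY {f : ℝ × ℝ → ℂ} (hf : f ∈ twisted (expU μ) (expU ν)) (k : ℤ × ℤ) :
    ft μ ν (dY f) k = freq ν k.2 * ft μ ν f k := by
  have h := sqInt_dY (mul_ex_mem_potentials hf k)
  have h2 : dY (f * ex (-freq μ k.1) (-freq ν k.2)) =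
      fun p => dY f p * ex (-freq μ k.1) (-freq ν k.2) p -
        freq ν k.2 * (f p * ex (-freq μ k.1) (-freq ν k.2) p) := by
    funext p
    rw [dY_mul (differentiable_of_mem_twisted hf)
      ((contDiff_ex _ _ (n := 1)).differentiable (by simp)), dY_ex]
    ring
  have hc := continuous_of_mem_twisted hf
  have hc' := continuous_of_mem_twisted (dY_mem_twisted hf)
  rw [h2, sqInt_sub (f := fun p => dY f p * ex (-freq μ k.1) (-freq ν k.2) p)
    (g := fun p => freq ν k.2 * (f p * ex (-freq μ k.1) (-freq ν k.2) p)) (by fun_prop) (by fun_prop),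
    sqInt_const_mul, sub_eq_zero] at h
  exact h

/-- The symbol of `∂ ∂̄`. -/
def sym (τ τ' X Y : ℂ) : ℂ := (τ' * X - Y) / (τ' - τ) * ((Y - τ * X) / (τ' - τ))

theorem ft_dZ {τ τ' : ℂ} {f : ℝ × ℝ → ℂ} (hf : f ∈ twisted (expU μ) (expU ν)) (k : ℤ × ℤ) :
    ft μ ν (dZ τ τ' f) k = (τ' * freq μ k.1 - freq ν k.2) / (τ' - τ) * ft μ ν f k := by
  rw [dZ_eq, ft_add ((continuous_of_mem_twisted (dX_mem_twisted hf)).const_smul _)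
    ((continuous_of_mem_twisted (dY_mem_twisted hf)).const_smul _), ft_smul, ft_smul, ft_dX hf,
    ft_dY hf]
  ring

theorem ft_dZbar {τ τ' : ℂ} {f : ℝ × ℝ → ℂ} (hf : f ∈ twisted (expU μ) (expU ν)) (k : ℤ × ℤ) :
    ft μ ν (dZbar τ τ' f) k = (freq ν k.2 - τ * freq μ k.1) / (τ' - τ) * ft μ ν f k := by
  rw [dZbar_eq, ft_add ((continuous_of_mem_twisted (dX_mem_twisted hf)).const_smul _)
    ((continuous_of_mem_twisted (dY_mem_twisted hf)).const_smul _), ft_smul, ft_smul, ft_dX hf,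
    ft_dY hf]
  ring

theorem ft_dZ_dZbar {τ τ' : ℂ} {f : ℝ × ℝ → ℂ} (hf : f ∈ twisted (expU μ) (expU ν)) (k : ℤ × ℤ) :
    ft μ ν (dZ τ τ' (dZbar τ τ' f)) k = sym τ τ' (freq μ k.1) (freq ν k.2) * ft μ ν f k := by
  rw [ft_dZ (dZbar_mem_twisted hf), ft_dZbar hf, sym, mul_assoc]

/-- The weight `1 + |2πk|²` on the lattice of frequencies. -/
def wt (k : ℤ × ℤ) : ℝ := 1 + (2 * Real.pi * k.1) ^ 2 + (2 * Real.pi * k.2) ^ 2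

theorem one_le_wt (k : ℤ × ℤ) : 1 ≤ wt k := by
  have := sq_nonneg (2 * Real.pi * k.1)
  have := sq_nonneg (2 * Real.pi * k.2)
  unfold wt; linarith

theorem wt_pos (k : ℤ × ℤ) : 0 < wt k := one_pos.trans_le (one_le_wt k)

/-- A Peetre type inequality; it lets powers of the weight pass through convolutions in
`conv_decay`. -/
theorem wt_add_le (k l : ℤ × ℤ) : wt (k + l) ≤ 2 * (wt k * wt l) := by
  simp only [wt, Prod.fst_add, Prod.snd_add, Int.cast_add]
  generalize (2 * Real.pi) = c
  have h1 := sq_nonneg (c * k.1 - c * l.1)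
  have h2 := sq_nonneg (c * k.2 - c * l.2)
  have h3 : 0 ≤ ((c * k.1) ^ 2 + (c * k.2) ^ 2) * ((c * l.1) ^ 2 + (c * l.2) ^ 2) := by positivity
  nlinarith

theorem summable_wt : Summable fun k : ℤ × ℤ => (wt k ^ 2)⁻¹ := by
  have h1 : Summable fun k : ℤ => (1 + (k : ℝ) ^ 2)⁻¹ := by
    have h : Summable fun k : ℤ => 1 / (k : ℝ) ^ 2 :=
      Real.summable_one_div_int_pow.mpr one_lt_two
    refine h.of_norm_bounded_eventually ?_
    have : ∀ᶠ k : ℤ in Filter.cofinite, k ≠ 0 := (Set.finite_singleton 0).compl_mem_cofinite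
    filter_upwards [this] with k hk
    have hk' : (0 : ℝ) < (k : ℝ) ^ 2 := by positivity
    rw [Real.norm_of_nonneg (by positivity), one_div]
    exact inv_anti₀ hk' (by linarith)
  refine Summable.of_nonneg_of_le (fun k => by positivity) (fun k => ?_)
    (h1.mul_of_nonneg h1 (fun _ => by positivity) (fun _ => by positivity))
  rw [← mul_inv]
  refine inv_anti₀ (by positivity) ?_
  have hpi : 1 ≤ 2 * Real.pi := by linarith [Real.pi_gt_three]
  have h3 : ∀ x : ℝ, x ^ 2 ≤ (2 * Real.pi * x) ^ 2 := fun x => by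
    rw [mul_pow]
    exact le_mul_of_one_le_left (sq_nonneg x) (one_le_pow₀ hpi)
  have hA : 1 + (k.1 : ℝ) ^ 2 ≤ wt k := by
    unfold wt; linarith [h3 k.1, sq_nonneg (2 * Real.pi * k.2)]
  have hB : 1 + (k.2 : ℝ) ^ 2 ≤ wt k := by
    unfold wt; linarith [h3 k.2, sq_nonneg (2 * Real.pi * k.1)]
  rw [sq (wt k)]
  exact mul_le_mul hA hB (by positivity) (wt_pos k).le

/-- Rapidly decreasing functions on the lattice. -/
def Rapid (c : ℤ × ℤ → ℂ) : Prop := ∀ n : ℕ, ∃ C : ℝ, ∀ k, wt k ^ n * ‖c k‖ ≤ C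

theorem Rapid.bounded {c : ℤ × ℤ → ℂ} (hc : Rapid c) : ∃ C : ℝ, ∀ k, ‖c k‖ ≤ C := by
  simpa using hc 0

theorem Rapid.summable_pow {c : ℤ × ℤ → ℂ} (hc : Rapid c) (n : ℕ) :
    Summable fun k => wt k ^ n * ‖c k‖ := by
  obtain ⟨C, hC⟩ := hc (n + 2)
  refine Summable.of_nonneg_of_le (fun k => mul_nonneg (pow_nonneg (wt_pos k).le _) (norm_nonneg _))
    (fun k => ?_) (summable_wt.mul_left C)
  rw [← div_eq_mul_inv, le_div_iff₀ (pow_pos (wt_pos k) 2)]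
  calc wt k ^ n * ‖c k‖ * wt k ^ 2 = wt k ^ (n + 2) * ‖c k‖ := by ring
    _ ≤ C := hC k

theorem Rapid.summable_norm {c : ℤ × ℤ → ℂ} (hc : Rapid c) : Summable fun k => ‖c k‖ := by
  simpa using hc.summable_pow 0

theorem Rapid.mul_of_norm_le {c d : ℤ × ℤ → ℂ} (hc : Rapid c) (C : ℝ) (m : ℕ)
    (hd : ∀ k, ‖d k‖ ≤ C * wt k ^ m) : Rapid fun k => d k * c k := fun n => by
  obtain ⟨C', hC'⟩ := hc (m + n)
  have hC0 : 0 ≤ C := by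
    have := (norm_nonneg _).trans (hd 0)
    exact nonneg_of_mul_nonneg_left this (pow_pos (wt_pos 0) m)
  refine ⟨C * C', fun k => ?_⟩
  rw [norm_mul]
  calc wt k ^ n * (‖d k‖ * ‖c k‖) ≤ wt k ^ n * (C * wt k ^ m * ‖c k‖) := by
        have := wt_pos k
        gcongr
        exact hd k
    _ = C * (wt k ^ (m + n) * ‖c k‖) := by ring
    _ ≤ C * C' := by gcongr; exact hC' k

/-- The elliptic operator with symbol `wt`. -/
def wtOp (μ ν : ℂ) (f : ℝ × ℝ → ℂ) : ℝ × ℝ → ℂ :=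
  f - (dX (dX f - μ • f) - μ • (dX f - μ • f)) - (dY (dY f - ν • f) - ν • (dY f - ν • f))

theorem wtOp_mem_twisted {α β : ℂˣ} {f : ℝ × ℝ → ℂ} (hf : f ∈ twisted α β) :
    wtOp μ ν f ∈ twisted α β := by
  have h1 := sub_mem (dX_mem_twisted hf) (Submodule.smul_mem _ μ hf)
  have h2 := sub_mem (dY_mem_twisted hf) (Submodule.smul_mem _ ν hf)
  exact sub_mem (sub_mem hf (sub_mem (dX_mem_twisted h1) (Submodule.smul_mem _ _ h1)))
    (sub_mem (dY_mem_twisted h2) (Submodule.smul_mem _ _ h2))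

theorem ft_wtOp {f : ℝ × ℝ → ℂ} (hf : f ∈ twisted (expU μ) (expU ν)) (k : ℤ × ℤ) :
    ft μ ν (wtOp μ ν f) k = wt k * ft μ ν f k := by
  have hs : ∀ {g h : ℝ × ℝ → ℂ}, g ∈ twisted (expU μ) (expU ν) → h ∈ twisted (expU μ) (expU ν) →
      ft μ ν (g - h) k = ft μ ν g k - ft μ ν h k := fun hg hh =>
    ft_sub (continuous_of_mem_twisted hg) (continuous_of_mem_twisted hh) k
  have m1 := Submodule.smul_mem _ μ hf
  have m2 := Submodule.smul_mem _ ν hf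
  have h1 := sub_mem (dX_mem_twisted hf) m1
  have h2 := sub_mem (dY_mem_twisted hf) m2
  have n1 := Submodule.smul_mem _ μ h1
  have n2 := Submodule.smul_mem _ ν h2
  have l1 := sub_mem (dX_mem_twisted h1) n1
  have l2 := sub_mem (dY_mem_twisted h2) n2
  rw [wtOp, hs (sub_mem hf l1) l2, hs hf l1, hs (dX_mem_twisted h1) n1,
    hs (dY_mem_twisted h2) n2, ft_smul, ft_smul, ft_dX h1, ft_dY h2, hs (dX_mem_twisted hf) m1,
    hs (dY_mem_twisted hf) m2, ft_smul, ft_smul, ft_dX hf, ft_dY hf]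
  simp only [freq, wt]
  push_cast
  linear_combination (-(2 * Real.pi * k.1) ^ 2 - (2 * Real.pi * k.2) ^ 2 : ℂ) * ft μ ν f k *
    Complex.I_sq

/-- A bound for the exponentials on the unit square. -/
theorem exists_norm_ft_le (μ ν : ℂ) : ∃ K : ℝ, 0 ≤ K ∧ ∀ (f : ℝ × ℝ → ℂ) (C : ℝ),
    (∀ p ∈ Icc ((0 : ℝ), (0 : ℝ)) (1, 1), ‖f p‖ ≤ C) → ∀ k, ‖ft μ ν f k‖ ≤ C * K := by
  obtain ⟨K, hK⟩ := (isCompact_Icc (a := ((0 : ℝ), (0 : ℝ))) (b := (1, 1))).exists_bound_of_continuousOn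
    (continuous_ex (-μ) (-ν)).continuousOn
  have hK0 : 0 ≤ K := (norm_nonneg _).trans (hK (0, 0) (by simp))
  refine ⟨K, hK0, fun f C hf k => norm_sqInt_le fun p hp => ?_⟩
  rw [norm_mul, ← freq_neg, ← freq_neg, norm_ex_freq]
  exact mul_le_mul (hf p hp) (hK p hp) (norm_nonneg _) ((norm_nonneg _).trans (hf p hp))

/-- Each application of `wtOp` stays among twisted functions and multiplies the coefficients by
`wt`, so boundedness of all coefficients upgrades to decay of every order. -/
theorem rapid_ft {f : ℝ × ℝ → ℂ} (hf : f ∈ twisted (expU μ) (expU ν)) : Rapid (ft μ ν f) := by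
  obtain ⟨K, -, hK⟩ := exists_norm_ft_le μ ν
  intro n
  induction n generalizing f with
  | zero =>
    obtain ⟨C, hC⟩ := (isCompact_Icc (a := ((0 : ℝ), (0 : ℝ)))
      (b := (1, 1))).exists_bound_of_continuousOn (continuous_of_mem_twisted hf).continuousOn
    exact ⟨C * K, fun k => by simpa using hK f C hC k⟩
  | succ n ih =>
    obtain ⟨C, hC⟩ := ih (wtOp_mem_twisted (μ := μ) (ν := ν) hf)
    refine ⟨C, fun k => ?_⟩
    have := hC k
    rw [ft_wtOp hf, norm_mul, Complex.norm_real, Real.norm_of_nonneg (wt_pos k).le] at this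
    rwa [pow_succ, mul_assoc]

/-- Vanishing coefficients are trivially summable, so the Fourier series converges to `g` pointwise,
and its sum is zero. -/
theorem periodic_eq_zero_of_fourier {g : ℝ → ℂ} (hg : Continuous g) (hp : ∀ x, g (x + 1) = g x)
    (h : ∀ k : ℤ, ∫ x in (0 : ℝ)..1, g x * Complex.exp (-(2 * Real.pi * Complex.I * k) * x) = 0) :
    g = 0 := by
  have hper : Function.Periodic g 1 := hp
  let F : C(AddCircle (1 : ℝ), ℂ) := ⟨hper.lift, continuous_coinduced_dom.mpr hg⟩
  have hF : ∀ x : ℝ, F x = g x := fun x => hper.lift_coe x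
  have hc : fourierCoeff F = 0 := by
    funext k
    rw [fourierCoeff_eq_intervalIntegral _ _ 0]
    simp only [hF, fourier_coe_apply, smul_eq_mul]
    have := h k
    simp only [mul_comm (g _)] at this
    simp only [zero_add, Pi.zero_apply]
    convert smul_zero _ using 2
    rw [← this]
    congr 1
    funext x
    congr 2
    push_cast; ring
  funext x
  have hs := has_pointwise_sum_fourier_series_of_summable (f := F) (by rw [hc]; exact summable_zero)
    (x : AddCircle (1 : ℝ))
  simp only [hc, Pi.zero_apply, zero_smul, hF] at hs
  simpa using hs.unique hasSum_zero

theorem eq_zero_of_ft_eq_zero {f : ℝ × ℝ → ℂ} (hf : f ∈ twisted (expU μ) (expU ν))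
    (h : ∀ k, ft μ ν f k = 0) : f = 0 := by
  obtain ⟨g, hg⟩ : ∃ g, g = f * ex (-μ) (-ν) := ⟨_, rfl⟩
  have hgp : g ∈ potentials := by
    have := mul_ex_mem_potentials hf 0
    simpa [freq, hg] using this
  have hgc := continuous_of_mem_twisted hgp
  have hgx : ∀ x y, g (x + 1, y) = g (x, y) := fun x y => by simpa using hgp.2.1 x y
  have hgy : ∀ x y, g (x, y + 1) = g (x, y) := fun x y => by simpa using hgp.2.2 x y
  -- With the twist removed, one-variable uniqueness applies twice: in `x` to each partial Fourier
  -- coefficient in `y`, then in `y` for each fixed `x`.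
  have h0 : ∀ l : ℤ, (fun x : ℝ =>
      ∫ y in (0 : ℝ)..1, g (x, y) * Complex.exp (-(2 * Real.pi * Complex.I * l) * y)) = 0 := by
    intro l
    refine periodic_eq_zero_of_fourier ?_ (fun x => by simp only [hgx]) fun k => ?_
    · exact intervalIntegral.continuous_parametric_intervalIntegral_of_continuous'
        (by fun_prop) _ _
    · rw [← h (k, l), ft, sqInt]
      congr 1
      funext x
      rw [← intervalIntegral.integral_mul_const]
      congr 1
      funext y
      rw [hg, Pi.mul_apply, mul_assoc, mul_assoc, ex, ex, ← Complex.exp_add, ← Complex.exp_add]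
      congr 2
      simp only [freq]
      ring
  have hg0 : ∀ x, (fun y => g (x, y)) = 0 := fun x =>
    periodic_eq_zero_of_fourier (hgc.comp (Continuous.prodMk_right x)) (hgy x)
      fun l => congrFun (h0 l) x
  funext p
  have := congrFun (hg0 p.1) p.2
  simp only [hg, Pi.mul_apply, Pi.zero_apply, mul_eq_zero] at this
  exact this.resolve_right (ex_ne_zero _ _ _)

end

section

/-! ### Fourier series -/

variable {μ ν μ' ν' : ℂ}

theorem norm_ex_freq_zero (k : ℤ × ℤ) (p : ℝ × ℝ) : ‖ex (freq 0 k.1) (freq 0 k.2) p‖ = 1 := by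
  rw [norm_ex_freq]; simp

/-- The Fourier series with coefficients `c`. -/
def fourierSeries (c : ℤ × ℤ → ℂ) (p : ℝ × ℝ) : ℂ :=
  ∑' k, c k * ex (freq 0 k.1) (freq 0 k.2) p

theorem hasSum_fourierSeries {c : ℤ × ℤ → ℂ} (hc : Rapid c) (p : ℝ × ℝ) :
    HasSum (fun k => c k * ex (freq 0 k.1) (freq 0 k.2) p) (fourierSeries c p) := by
  refine Summable.hasSum (Summable.of_norm ?_)
  simpa [norm_ex_freq_zero] using hc.summable_norm

theorem norm_freq_le_wt (k : ℤ × ℤ) : ‖freq 0 k.1‖ ≤ 1 * wt k ^ 1 ∧ ‖freq 0 k.2‖ ≤ 1 * wt k ^ 1 := by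
  have h : ∀ x : ℝ, |x| ≤ 1 + x ^ 2 := fun x => by
    rw [abs_le]; constructor <;> nlinarith [sq_nonneg (x - 1), sq_nonneg (x + 1)]
  have h1 : ∀ j : ℤ, ‖freq 0 j‖ = |2 * Real.pi * j| := fun j => by
    simp [freq, abs_mul, abs_of_pos Real.pi_pos]
  rw [h1, h1, one_mul, pow_one, wt]
  constructor
  · linarith [h (2 * Real.pi * k.1), sq_nonneg (2 * Real.pi * k.2)]
  · linarith [h (2 * Real.pi * k.2), sq_nonneg (2 * Real.pi * k.1)]

/-- The differential of a Fourier mode. -/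
def modeDeriv (c d : ℂ) : ℝ × ℝ →L[ℝ] ℂ :=
  c • Complex.ofRealCLM.comp (ContinuousLinearMap.fst ℝ ℝ ℝ) +
    d • Complex.ofRealCLM.comp (ContinuousLinearMap.snd ℝ ℝ ℝ)

@[simp] theorem modeDeriv_apply (c d : ℂ) (p : ℝ × ℝ) : modeDeriv c d p = c * p.1 + d * p.2 := by
  simp [modeDeriv]

theorem hasFDerivAt_mode (c X Y : ℂ) (p : ℝ × ℝ) :
    HasFDerivAt (fun q => c * ex X Y q) (modeDeriv (X * c * ex X Y p) (Y * c * ex X Y p)) p := by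
  refine ((hasFDerivAt_ex X Y p).const_mul c).congr_fderiv ?_
  ext <;> simp <;> ring

theorem norm_modeDeriv_le (c d : ℂ) : ‖modeDeriv c d‖ ≤ ‖c‖ + ‖d‖ := by
  refine ContinuousLinearMap.opNorm_le_bound _ (by positivity) fun p => ?_
  rw [modeDeriv_apply, add_mul]
  refine (norm_add_le _ _).trans ?_
  rw [norm_mul, norm_mul, Complex.norm_real, Complex.norm_real]
  gcongr
  · exact norm_fst_le p
  · exact norm_snd_le p

theorem hasSum_modeDeriv {ι : Type*} {c d : ι → ℂ} {C D : ℂ} (hc : HasSum c C) (hd : HasSum d D) :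
    HasSum (fun i => modeDeriv (c i) (d i)) (modeDeriv C D) :=
  (hc.smul_const (Complex.ofRealCLM.comp (ContinuousLinearMap.fst ℝ ℝ ℝ))).add
    (hd.smul_const (Complex.ofRealCLM.comp (ContinuousLinearMap.snd ℝ ℝ ℝ)))

theorem hasFDerivAt_fourierSeries {c : ℤ × ℤ → ℂ} (hc : Rapid c) (p : ℝ × ℝ) :
    HasFDerivAt (fourierSeries c)
      (modeDeriv (fourierSeries (fun k => freq 0 k.1 * c k) p)
        (fourierSeries (fun k => freq 0 k.2 * c k) p)) p := by
  have hX : Rapid fun k => freq 0 k.1 * c k :=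
    hc.mul_of_norm_le 1 1 fun k => (norm_freq_le_wt k).1
  have hY : Rapid fun k => freq 0 k.2 * c k :=
    hc.mul_of_norm_le 1 1 fun k => (norm_freq_le_wt k).2
  rw [← (hasSum_modeDeriv (hasSum_fourierSeries hX p) (hasSum_fourierSeries hY p)).tsum_eq]
  refine hasFDerivAt_tsum (hX.summable_norm.add hY.summable_norm)
    (fun k q => hasFDerivAt_mode (c k) (freq 0 k.1) (freq 0 k.2) q) (fun k q => ?_)
    (hasSum_fourierSeries hc p).summable p
  refine (norm_modeDeriv_le _ _).trans (le_of_eq ?_)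
  simp only [norm_mul, norm_ex_freq_zero, mul_one]

/-- The partial derivatives are again Fourier series with rapidly decreasing coefficients, so the
induction runs over all such `c` at once. -/
theorem contDiff_fourierSeries {c : ℤ × ℤ → ℂ} (hc : Rapid c) : ContDiff ℝ ∞ (fourierSeries c) := by
  rw [contDiff_infty]
  intro n
  induction n generalizing c with
  | zero =>
    exact contDiff_zero.mpr (continuous_iff_continuousAt.mpr fun p =>
      (hasFDerivAt_fourierSeries hc p).continuousAt)
  | succ n ih =>
    have hX : Rapid fun k => freq 0 k.1 * c k :=
      hc.mul_of_norm_le 1 1 fun k => (norm_freq_le_wt k).1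
    have hY : Rapid fun k => freq 0 k.2 * c k :=
      hc.mul_of_norm_le 1 1 fun k => (norm_freq_le_wt k).2
    push_cast
    rw [contDiff_succ_iff_fderiv]
    refine ⟨fun p => (hasFDerivAt_fourierSeries hc p).differentiableAt, by simp, ?_⟩
    rw [funext fun p => (hasFDerivAt_fourierSeries hc p).fderiv]
    exact ((ih hX).smul (contDiff_const (c := Complex.ofRealCLM.comp (ContinuousLinearMap.fst ℝ ℝ ℝ)))).add
      ((ih hY).smul (contDiff_const (c := Complex.ofRealCLM.comp (ContinuousLinearMap.snd ℝ ℝ ℝ))))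

theorem fourierSeries_mem_potentials {c : ℤ × ℤ → ℂ} (hc : Rapid c) :
    fourierSeries c ∈ potentials := by
  have h : ∀ k : ℤ × ℤ, ex (freq 0 k.1) (freq 0 k.2) ∈ potentials := fun k => by
    have := ex_mem_twisted (freq 0 k.1) (freq 0 k.2)
    rwa [expU_freq, expU_freq, expU_zero] at this
  refine ⟨contDiff_fourierSeries hc, fun x y => ?_, fun x y => ?_⟩
  · simp only [fourierSeries, (h _).2.1, Units.val_one, one_mul]
  · simp only [fourierSeries, (h _).2.2, Units.val_one, one_mul]

theorem sqInt_ex_freq (k : ℤ × ℤ) :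
    sqInt (ex (freq 0 k.1) (freq 0 k.2)) = if k = 0 then 1 else 0 := by
  have h : ∀ j : ℤ, ∫ x in (0 : ℝ)..1, Complex.exp (freq 0 j * x) = if j = 0 then 1 else 0 := by
    intro j
    split_ifs with hj
    · simp [hj, freq]
    · have h0 : freq 0 j ≠ 0 := by simp [freq, hj, Real.pi_ne_zero]
      have h1 : Complex.exp (freq 0 j) = 1 := by
        have := congrArg Units.val (expU_freq 0 j)
        simpa using this
      rw [integral_exp_mul_complex h0]
      simp [h1]
  have h2 : ∀ x y : ℝ, ex (freq 0 k.1) (freq 0 k.2) (x, y) =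
      Complex.exp (freq 0 k.1 * x) * Complex.exp (freq 0 k.2 * y) := fun x y => by
    rw [ex, Complex.exp_add]
  simp only [sqInt, h2, intervalIntegral.integral_const_mul, intervalIntegral.integral_mul_const, h]
  rcases k with ⟨a, b⟩
  by_cases ha : a = 0 <;> by_cases hb : b = 0 <;> simp [ha, hb, Prod.ext_iff]

/-- The function is the periodic series times the exponential carrying the twist; orthogonality of
the modes recovers the coefficients. This is how sequences found by functional analysis become
smooth functions. -/
theorem exists_ft_eq {c : ℤ × ℤ → ℂ} (hc : Rapid c) (μ ν : ℂ) :
    ∃ f ∈ twisted (expU μ) (expU ν), ft μ ν f = c ∧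
      ∀ p, HasSum (fun k => c k * ex (freq μ k.1) (freq ν k.2) p) (f p) := by
  have hS := fourierSeries_mem_potentials hc
  have hmem := potential_mul_mem_twisted hS (ex_mem_twisted μ ν)
  have hsum : ∀ p, HasSum (fun k => c k * ex (freq μ k.1) (freq ν k.2) p)
      ((fourierSeries c * ex μ ν) p) := fun p => by
    have e : ∀ k : ℤ × ℤ, c k * ex (freq μ k.1) (freq ν k.2) p =
        c k * ex (freq 0 k.1) (freq 0 k.2) p * ex μ ν p := fun k => by
      rw [mul_assoc, ex_mul_ex]
      simp [freq, add_comm]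
    rw [funext e]
    exact (hasSum_fourierSeries hc p).mul_right (ex μ ν p)
  refine ⟨_, hmem, ?_, hsum⟩
  funext l
  have hF : ∀ k : ℤ × ℤ, (fun p => c k * ex (freq μ k.1) (freq ν k.2) p *
      ex (-freq μ l.1) (-freq ν l.2) p) = fun p => c k * ex (freq 0 (k - l).1) (freq 0 (k - l).2) p := by
    intro k
    funext p
    rw [mul_assoc, ex_mul_ex]
    congr 2 <;> simp [freq] <;> ring
  have h := hasSum_sqInt (F := fun k p => c k * ex (freq μ k.1) (freq ν k.2) p *
      ex (-freq μ l.1) (-freq ν l.2) p)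
    (f := fun p => (fourierSeries c * ex μ ν) p * ex (-freq μ l.1) (-freq ν l.2) p)
    (fun k => by fun_prop) ((continuous_of_mem_twisted hmem).mul (continuous_ex _ _))
    hc.summable_norm (fun k p _ => by
      rw [congrFun (hF k) p, norm_mul, norm_ex_freq_zero, mul_one])
    fun p => (hsum p).mul_right _
  refine h.unique ?_
  simp only [hF, sqInt_const_mul]
  have := hasSum_ite_eq l (c l)
  refine this.congr_fun fun k => ?_
  rw [sqInt_ex_freq]
  by_cases hk : k = l <;> simp [hk, sub_eq_zero]

theorem hasSum_ft {f : ℝ × ℝ → ℂ} (hf : f ∈ twisted (expU μ) (expU ν)) (p : ℝ × ℝ) :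
    HasSum (fun k => ft μ ν f k * ex (freq μ k.1) (freq ν k.2) p) (f p) := by
  obtain ⟨g, hg, hgf, hsum⟩ := exists_ft_eq (rapid_ft hf) μ ν
  have : f - g = 0 := eq_zero_of_ft_eq_zero (sub_mem hf hg) fun k => by
    rw [ft_sub (continuous_of_mem_twisted hf) (continuous_of_mem_twisted hg), hgf, sub_self]
  rw [sub_eq_zero.mp this]
  rw [sub_eq_zero.mp this] at hsum
  exact hsum p

theorem eq_of_ft_eq {f g : ℝ × ℝ → ℂ} (hf : f ∈ twisted (expU μ) (expU ν))
    (hg : g ∈ twisted (expU μ) (expU ν)) (h : ∀ k, ft μ ν f k = ft μ ν g k) : f = g :=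
  sub_eq_zero.mp <| eq_zero_of_ft_eq_zero (sub_mem hf hg) fun k => by
    rw [ft_sub (continuous_of_mem_twisted hf) (continuous_of_mem_twisted hg), h, sub_self]

/-- Fourier coefficients of a product. -/
theorem hasSum_ft_mul {f g : ℝ × ℝ → ℂ} (hf : f ∈ twisted (expU μ) (expU ν)) (hg : Continuous g)
    (k : ℤ × ℤ) :
    HasSum (fun l => ft μ ν f l * ft μ' ν' g (k - l)) (ft (μ + μ') (ν + ν') (f * g) k) := by
  obtain ⟨C, hC⟩ := (isCompact_Icc (a := ((0 : ℝ), (0 : ℝ))) (b := (1, 1))).exists_bound_of_continuousOn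
    ((continuous_ex μ ν).mul (hg.mul (continuous_ex (-freq (μ + μ') k.1) (-freq (ν + ν') k.2)))).continuousOn
  have hfc := continuous_of_mem_twisted hf
  have h := hasSum_sqInt (F := fun l p => ft μ ν f l * ex (freq μ l.1) (freq ν l.2) p *
      (g p * ex (-freq (μ + μ') k.1) (-freq (ν + ν') k.2) p))
    (f := fun p => f p * (g p * ex (-freq (μ + μ') k.1) (-freq (ν + ν') k.2) p))
    (b := fun l => ‖ft μ ν f l‖ * C)
    (fun l => by fun_prop) (by fun_prop) ((rapid_ft hf).summable_norm.mul_right C)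
    (fun l p hp => by
      have := hC p hp
      simp only [norm_mul, Pi.mul_apply] at this
      rw [norm_mul, norm_mul, norm_ex_freq, mul_assoc, norm_mul]
      gcongr)
    fun p => (hasSum_ft hf p).mul_right _
  have e : ∀ l, ft μ ν f l * ft μ' ν' g (k - l) = sqInt fun p =>
      ft μ ν f l * ex (freq μ l.1) (freq ν l.2) p *
        (g p * ex (-freq (μ + μ') k.1) (-freq (ν + ν') k.2) p) := fun l => by
    rw [ft.eq_def μ' ν', ← sqInt_const_mul]
    congr 1
    funext p
    rw [mul_assoc, mul_left_comm (ex _ _ p), ex_mul_ex]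
    congr 3 <;> simp [freq] <;> ring
  rw [funext e, ft]
  simp only [Pi.mul_apply, mul_assoc] at h ⊢
  exact h

end

section

/-! ### Ellipticity of the symbol -/

-- Ellipticity of a first order factor: as `σ` is not real, the imaginary part of `σ k₁ - k₂`
-- controls `k₁`, and then the whole expression controls `k₂`. The contribution of `μ` and `ν` is of
-- lower order.
open Asymptotics Filter in
theorem norm_isBigO_linear {σ : ℂ} (hσ : σ.im ≠ 0) (μ ν : ℂ) :
    (fun k : ℤ × ℤ => ‖k‖) =O[cofinite] fun k => σ * freq μ k.1 - freq ν k.2 := by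
  have hN : Tendsto (fun k : ℤ × ℤ => ‖k‖) cofinite atTop := by
    rw [← cocompact_eq_cofinite]; exact tendsto_norm_cocompact_atTop
  have h1 : (fun k : ℤ × ℤ => ‖k‖) =O[cofinite]
      fun k => 2 * Real.pi * Complex.I * (σ * k.1 - k.2) := by
    refine IsBigO.of_bound (|σ.im|⁻¹ + (1 + ‖σ‖ * |σ.im|⁻¹)) (.of_forall fun k => ?_)
    have hpos : 0 < |σ.im| := abs_pos.mpr hσ
    have hle : ‖σ * k.1 - k.2‖ ≤ ‖2 * Real.pi * Complex.I * (σ * k.1 - k.2)‖ := by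
      rw [norm_mul]
      refine le_mul_of_one_le_left (norm_nonneg _) ?_
      simp [abs_of_pos Real.pi_pos]
      linarith [Real.pi_gt_three]
    have hk1 : ‖k.1‖ ≤ |σ.im|⁻¹ * ‖σ * k.1 - k.2‖ := by
      rw [inv_mul_eq_div, le_div_iff₀ hpos, Int.norm_eq_abs, ← abs_mul]
      have := Complex.abs_im_le_norm (σ * k.1 - k.2)
      simpa [mul_comm] using this
    have hk2 : ‖k.2‖ ≤ (1 + ‖σ‖ * |σ.im|⁻¹) * ‖σ * k.1 - k.2‖ := by
      have h2 : ‖(k.2 : ℂ)‖ ≤ ‖σ * k.1‖ + ‖σ * k.1 - k.2‖ := by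
        have := norm_sub_le (σ * (k.1 : ℂ)) (σ * k.1 - k.2)
        simpa using this
      rw [norm_mul, Complex.norm_intCast, Complex.norm_intCast] at h2
      rw [Int.norm_eq_abs] at hk1 ⊢
      have := mul_le_mul_of_nonneg_left hk1 (norm_nonneg σ)
      linarith
    rw [norm_norm, Prod.norm_def]
    have h0 := norm_nonneg (σ * (k.1 : ℂ) - k.2)
    have hc : 0 ≤ |σ.im|⁻¹ := by positivity
    have hd : 0 ≤ ‖σ‖ * |σ.im|⁻¹ := by positivity
    have hC : 0 ≤ |σ.im|⁻¹ + (1 + ‖σ‖ * |σ.im|⁻¹) := by positivity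
    refine le_trans ?_ (mul_le_mul_of_nonneg_left hle hC)
    rw [add_mul]
    refine max_le (hk1.trans ?_) (hk2.trans ?_)
    · have : 0 ≤ (1 + ‖σ‖ * |σ.im|⁻¹) * ‖σ * k.1 - k.2‖ := by positivity
      linarith
    · have : 0 ≤ |σ.im|⁻¹ * ‖σ * k.1 - k.2‖ := by positivity
      linarith
  have h2 : (fun _ : ℤ × ℤ => σ * μ - ν) =o[cofinite] fun k : ℤ × ℤ => ‖k‖ :=
    isLittleO_const_left.mpr (.inr (by simpa [Function.comp_def] using hN))
  refine h1.trans ((h2.trans_isBigO h1).right_isBigO_add.congr_right fun k => ?_)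
  simp only [freq]; ring

/-- A regular value of the symbol of `∂ ∂̄` on functions with multipliers `exp μ`, `exp ν`,
together with the decay of the resolvent. -/
structure RegularValue (τ τ' μ ν : ℂ) where
  val : ℂ
  ne : ∀ k : ℤ × ℤ, sym τ τ' (freq μ k.1) (freq ν k.2) - val ≠ 0
  decay : ∃ C : ℝ, ∀ k : ℤ × ℤ, wt k ≤ C * ‖sym τ τ' (freq μ k.1) (freq ν k.2) - val‖

-- The symbol takes countably many values, so some complex number is omitted. Both linear factors of
-- the symbol dominate `‖k‖`, so the shifted symbol dominates `‖k‖²`, hence `wt`, outside a finite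
-- set; as it never vanishes, the bound extends to all frequencies.
open Asymptotics Filter in
theorem nonempty_regularValue {τ τ' : ℂ} (hτ : 0 < τ.im) (hτ' : τ'.im < 0) (μ ν : ℂ) :
    Nonempty (RegularValue τ τ' μ ν) := by
  obtain ⟨lam, hlam⟩ : ∃ lam, lam ∉ range fun k : ℤ × ℤ => sym τ τ' (freq μ k.1) (freq ν k.2) := by
    by_contra! h
    exact not_countable_complex ((countable_range _).mono fun x _ => h x)
  have hne : ∀ k : ℤ × ℤ, sym τ τ' (freq μ k.1) (freq ν k.2) - lam ≠ 0 := fun k h =>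
    hlam ⟨k, sub_eq_zero.mp h⟩
  have hd : τ' - τ ≠ 0 := fun h => by
    have := congrArg Complex.im h
    simp at this
    linarith
  have hN : Tendsto (fun k : ℤ × ℤ => ‖k‖) cofinite atTop := by
    rw [← cocompact_eq_cofinite]; exact tendsto_norm_cocompact_atTop
  have h1 : (fun k : ℤ × ℤ => ‖k‖ * ‖k‖) =O[cofinite]
      fun k : ℤ × ℤ => sym τ τ' (freq μ k.1) (freq ν k.2) := by
    have h := (norm_isBigO_linear hτ'.ne μ ν).mul (norm_isBigO_linear hτ.ne' μ ν)
    refine h.trans (IsBigO.of_bound (‖(τ' - τ) * (τ' - τ)‖) (.of_forall fun k => le_of_eq ?_))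
    rw [← norm_mul, ← norm_neg, sym]
    congr 1
    field_simp
    ring
  have hNN : Tendsto (fun k : ℤ × ℤ => ‖k‖ * ‖k‖) cofinite atTop := hN.atTop_mul_atTop₀ hN
  have h2 : (fun _ : ℤ × ℤ => -lam) =o[cofinite] fun k : ℤ × ℤ => ‖k‖ * ‖k‖ :=
    isLittleO_const_left.mpr (.inr (by simpa [Function.comp_def] using hNN))
  have h3 : (fun k : ℤ × ℤ => ‖k‖ * ‖k‖) =O[cofinite]
      fun k : ℤ × ℤ => sym τ τ' (freq μ k.1) (freq ν k.2) - lam :=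
    h1.trans ((h2.trans_isBigO h1).right_isBigO_add.congr_right fun k => by ring)
  have h4 : wt =O[cofinite] fun k : ℤ × ℤ => ‖k‖ * ‖k‖ := by
    have hw : (fun _ : ℤ × ℤ => (1 : ℝ)) =O[cofinite] fun k : ℤ × ℤ => ‖k‖ * ‖k‖ :=
      IsLittleO.isBigO (isLittleO_const_left.mpr (.inr (by simpa [Function.comp_def] using hNN)))
    have hj : ∀ j : ℤ × ℤ → ℤ, (∀ k, ‖j k‖ ≤ ‖k‖) →
        (fun k => (2 * Real.pi * j k) ^ 2) =O[cofinite] fun k : ℤ × ℤ => ‖k‖ * ‖k‖ := fun j hj => by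
      refine IsBigO.of_bound ((2 * Real.pi) ^ 2) (.of_forall fun k => ?_)
      rw [Real.norm_of_nonneg (by positivity), Real.norm_of_nonneg (by positivity), mul_pow]
      gcongr
      rw [← sq, ← sq_abs]
      have := hj k
      rw [Int.norm_eq_abs] at this
      gcongr
    exact (hw.add (hj Prod.fst fun k => norm_fst_le k)).add (hj Prod.snd fun k => norm_snd_le k)
  obtain ⟨C, hC⟩ := (isBigO_cofinite_iff fun k h => absurd h (hne k)).mp (h4.trans h3)
  exact ⟨⟨lam, hne, C, fun k => by simpa [abs_of_pos (wt_pos k)] using hC k⟩⟩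

/-! ### Operators on bounded sequences of Fourier coefficients -/

/-- Bounded functions on the lattice of frequencies. -/
abbrev Seq := BoundedContinuousFunction (ℤ × ℤ) ℂ

/-- Evaluation at a frequency. -/
def evalAt (k : ℤ × ℤ) : Seq →L[ℂ] ℂ := BoundedContinuousFunction.evalCLM ℂ k

@[simp] theorem evalAt_apply (k : ℤ × ℤ) (x : Seq) : evalAt k x = x k := rfl

/-- Multiplication by a bounded sequence. -/
def diag (g : Seq) : Seq →L[ℂ] Seq := ContinuousLinearMap.mul ℂ Seq g

theorem isCompactOperator_smulRight (φ : Seq →L[ℂ] ℂ) (y : Seq) :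
    IsCompactOperator (φ.smulRight y) := by
  have h : IsCompactOperator (ContinuousLinearMap.toSpanSingleton ℂ y) :=
    isCompactOperator_of_locallyCompactSpace_rng _
  exact h.comp_clm φ

-- Truncations to finite sets of frequencies have finite rank and converge in operator norm, because
-- the remaining entries of `g` are uniformly small.
open Filter in
theorem isCompactOperator_diag (g : Seq) (hg : Tendsto g cofinite (𝓝 0)) :
    IsCompactOperator (diag g) := by
  classical
  let e (k : ℤ × ℤ) : Seq := BoundedContinuousFunction.ofNormedAddCommGroupDiscrete
    (Pi.single k (1 : ℂ)) 1 fun l => by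
      by_cases h : l = k
      · subst h; simp
      · simp [Pi.single_eq_of_ne h]
  let F (s : Finset (ℤ × ℤ)) : Seq →L[ℂ] Seq := ∑ k ∈ s, (evalAt k).smulRight (g k • e k)
  have hF : ∀ s, IsCompactOperator (F s) := fun s =>
    Submodule.sum_mem (compactOperator (RingHom.id ℂ) Seq Seq)
      (fun k _ => isCompactOperator_smulRight (evalAt k) (g k • e k))
  have hFa : ∀ s x l, F s x l = if l ∈ s then g l * x l else 0 := fun s x l => by
    have : F s x l = ∑ k ∈ s, x k * (g k * (Pi.single k (1 : ℂ) : ℤ × ℤ → ℂ) l) := by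
      simp only [F, sum_apply, BoundedContinuousFunction.coe_sum,
        Finset.sum_apply]
      rfl
    rw [this]
    simp [Pi.single_apply, mul_comm]
  refine isCompactOperator_of_tendsto (F := F) (l := atTop) ?_ (.of_forall hF)
  rw [Metric.tendsto_atTop]
  intro ε hε
  have hfin := (hg.eventually (Metric.ball_mem_nhds 0 (half_pos hε)))
  rw [eventually_cofinite] at hfin
  refine ⟨hfin.toFinset, fun s hs => ?_⟩
  rw [dist_eq_norm]
  refine lt_of_le_of_lt (ContinuousLinearMap.opNorm_le_bound _ (half_pos hε).le fun x => ?_)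
    (half_lt_self hε)
  refine (BoundedContinuousFunction.norm_le (by positivity)).mpr fun l => ?_
  have : (F s - diag g) x l = F s x l - g l * x l := rfl
  rw [this, hFa]
  split_ifs with hl
  · simp; positivity
  · have hl' : ‖g l‖ < ε / 2 := by
      by_contra h
      exact hl (hs (by simpa using h))
    rw [zero_sub, norm_neg, norm_mul]
    exact mul_le_mul hl'.le (x.norm_coe_le_norm l) (norm_nonneg _) (half_pos hε).le

theorem summable_conv {c : ℤ × ℤ → ℂ} (hc : Summable fun k => ‖c k‖) (x : Seq) (k : ℤ × ℤ) :
    Summable fun l => ‖c l * x (k - l)‖ := by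
  refine Summable.of_nonneg_of_le (fun _ => norm_nonneg _) (fun l => ?_) (hc.mul_right ‖x‖)
  rw [norm_mul]
  gcongr
  exact x.norm_coe_le_norm _

theorem norm_conv_le {c : ℤ × ℤ → ℂ} (hc : Summable fun k => ‖c k‖) (x : Seq) (k : ℤ × ℤ) :
    ‖∑' l, c l * x (k - l)‖ ≤ (∑' l, ‖c l‖) * ‖x‖ := by
  refine (norm_tsum_le_tsum_norm (summable_conv hc x k)).trans ?_
  rw [← tsum_mul_right]
  refine (summable_conv hc x k).tsum_le_tsum (fun l => ?_) (hc.mul_right ‖x‖)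
  rw [norm_mul]
  gcongr
  exact x.norm_coe_le_norm _

/-- Convolution with a summable sequence. -/
def conv (c : ℤ × ℤ → ℂ) (hc : Summable fun k => ‖c k‖) : Seq →L[ℂ] Seq :=
  LinearMap.mkContinuous
    { toFun := fun x => BoundedContinuousFunction.ofNormedAddCommGroupDiscrete
        (fun k => ∑' l, c l * x (k - l)) _ (norm_conv_le hc x)
      map_add' := fun x y => by
        ext k
        simp only [BoundedContinuousFunction.coe_ofNormedAddCommGroupDiscrete,
          BoundedContinuousFunction.coe_add, Pi.add_apply, mul_add]
        exact (summable_conv hc x k).of_norm.tsum_add (summable_conv hc y k).of_norm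
      map_smul' := fun a x => by
        ext k
        simp only [BoundedContinuousFunction.coe_ofNormedAddCommGroupDiscrete,
          BoundedContinuousFunction.coe_smul, RingHom.id_apply, smul_eq_mul, ← tsum_mul_left]
        exact tsum_congr fun l => by ring }
    (∑' l, ‖c l‖) fun x =>
      (BoundedContinuousFunction.norm_le
        (mul_nonneg (tsum_nonneg fun _ => norm_nonneg _) (norm_nonneg _))).mpr (norm_conv_le hc x)

theorem conv_apply {c : ℤ × ℤ → ℂ} (hc : Summable fun k => ‖c k‖) (x : Seq) (k : ℤ × ℤ) :
    conv c hc x k = ∑' l, c l * x (k - l) := rfl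

theorem norm_conv_op_le {c : ℤ × ℤ → ℂ} (hc : Summable fun k => ‖c k‖) :
    ‖conv c hc‖ ≤ ∑' l, ‖c l‖ :=
  LinearMap.mkContinuous_norm_le _ (tsum_nonneg fun _ => norm_nonneg _) _

theorem conv_decay {c : ℤ × ℤ → ℂ} (hc : Rapid c) (x : Seq) (n : ℕ) {C : ℝ}
    (hx : ∀ k, wt k ^ n * ‖x k‖ ≤ C) :
    ∃ C', ∀ k, wt k ^ n * ‖conv c hc.summable_norm x k‖ ≤ C' := by
  refine ⟨∑' l, 2 ^ n * C * (wt l ^ n * ‖c l‖), fun k => ?_⟩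
  rw [conv_apply]
  have hk : 0 ≤ wt k ^ n := pow_nonneg (wt_pos k).le n
  refine (mul_le_mul_of_nonneg_left
    (norm_tsum_le_tsum_norm (summable_conv hc.summable_norm x k)) hk).trans ?_
  rw [← tsum_mul_left]
  refine Summable.tsum_le_tsum (fun l => ?_) ((summable_conv hc.summable_norm x k).mul_left _)
    ((hc.summable_pow n).mul_left _)
  have h1 : wt k ^ n ≤ 2 ^ n * wt l ^ n * wt (k - l) ^ n := by
    rw [mul_assoc, ← mul_pow, ← mul_pow]
    refine pow_le_pow_left₀ (wt_pos k).le ?_ n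
    simpa using wt_add_le l (k - l)
  rw [norm_mul]
  calc wt k ^ n * (‖c l‖ * ‖x (k - l)‖)
      ≤ 2 ^ n * wt l ^ n * wt (k - l) ^ n * (‖c l‖ * ‖x (k - l)‖) := by gcongr
    _ = 2 ^ n * (wt l ^ n * ‖c l‖) * (wt (k - l) ^ n * ‖x (k - l)‖) := by ring
    _ ≤ 2 ^ n * (wt l ^ n * ‖c l‖) * C := by
        have := wt_pos l
        gcongr
        exact hx _
    _ = _ := by ring

end

section

/-! ### The bordered Schrödinger operator -/

variable {μ ν : ℂ} {τ τ' : ℂ}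

theorem mem_twisted_of_mem_potentials {w : ℝ × ℝ → ℂ} (hw : w ∈ potentials) :
    w ∈ twisted (expU 0) (expU 0) := by
  rwa [expU_zero]

/-- The sequence of Fourier coefficients, as a linear map. -/
def ftL (μ ν : ℂ) : twisted (expU μ) (expU ν) →ₗ[ℂ] Seq where
  toFun f := BoundedContinuousFunction.ofNormedAddCommGroupDiscrete (ft μ ν f) _
    (rapid_ft f.2).bounded.choose_spec
  map_add' f g := by
    ext k; exact ft_add (continuous_of_mem_twisted f.2) (continuous_of_mem_twisted g.2) k
  map_smul' c f := by
    ext k; exact ft_smul c f k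

@[simp] theorem ftL_apply (f : twisted (expU μ) (expU ν)) (k : ℤ × ℤ) :
    ftL μ ν f k = ft μ ν f k := rfl

theorem ftL_injective : Function.Injective (ftL μ ν) := fun f g h =>
  Subtype.ext (eq_of_ft_eq f.2 g.2 fun k => DFunLike.congr_fun h k)

/-- Multiplication by a potential, on Fourier coefficients. -/
def mulOp : potentials →ₗ[ℂ] Seq →L[ℂ] Seq where
  toFun w := conv (ft 0 0 w) (rapid_ft (mem_twisted_of_mem_potentials w.2)).summable_norm
  map_add' v w := by
    ext x k
    have hv := (rapid_ft (mem_twisted_of_mem_potentials v.2)).summable_norm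
    have hw := (rapid_ft (mem_twisted_of_mem_potentials w.2)).summable_norm
    change _ = conv _ hv x k + conv _ hw x k
    rw [conv_apply, conv_apply, conv_apply,
      ← (summable_conv hv x k).of_norm.tsum_add (summable_conv hw x k).of_norm]
    refine tsum_congr fun l => ?_
    rw [Submodule.coe_add, ft_add (continuous_of_mem_twisted v.2) (continuous_of_mem_twisted w.2),
      add_mul]
  map_smul' c w := by
    ext x k
    change _ = c * conv _ _ x k
    rw [conv_apply, conv_apply, ← tsum_mul_left]
    refine tsum_congr fun l => ?_
    rw [Submodule.coe_smul, ft_smul, mul_assoc]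

theorem norm_mulOp_le (w : potentials) : ‖mulOp w‖ ≤ ∑' l, ‖ft 0 0 w l‖ :=
  norm_conv_op_le (rapid_ft (mem_twisted_of_mem_potentials w.2)).summable_norm

theorem mulOp_ftL (w : potentials) (f : twisted (expU μ) (expU ν)) (k : ℤ × ℤ) :
    mulOp w (ftL μ ν f) k = ft μ ν (w * f) k := by
  have := hasSum_ft_mul (μ' := μ) (ν' := ν) (mem_twisted_of_mem_potentials w.2)
    (continuous_of_mem_twisted f.2) k
  rw [zero_add, zero_add] at this
  exact this.tsum_eq

/-- The Schrödinger operator `∂ ∂̄ - w`. -/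
def schr (τ τ' : ℂ) {α β : ℂˣ} (w : potentials) : twisted α β →ₗ[ℂ] twisted α β where
  toFun f := ⟨dZ τ τ' (dZbar τ τ' f) - w * f,
    sub_mem (dZ_mem_twisted (dZbar_mem_twisted f.2)) (potential_mul_mem_twisted w.2 f.2)⟩
  map_add' f g := by
    ext p
    simp only [Submodule.coe_add, dZbar_add (differentiable_of_mem_twisted f.2)
      (differentiable_of_mem_twisted g.2), dZ_add (differentiable_dZbar f.2.1)
      (differentiable_dZbar g.2.1), Pi.add_apply, Pi.sub_apply, Pi.mul_apply]
    ring
  map_smul' c f := by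
    ext p
    simp only [Submodule.coe_smul, dZbar_smul c (differentiable_of_mem_twisted f.2),
      dZ_smul c (differentiable_dZbar f.2.1), Pi.smul_apply, Pi.sub_apply, Pi.mul_apply,
      smul_eq_mul, RingHom.id_apply]
    ring

theorem schr_apply {α β : ℂˣ} (w : potentials) (f : twisted α β) (p : ℝ × ℝ) :
    (schr τ τ' w f : ℝ × ℝ → ℂ) p = dZ τ τ' (dZbar τ τ' f) p - w.1 p * f.1 p := rfl

theorem schr_eq_zero_iff {α β : ℂˣ} (w : potentials) (f : twisted α β) :
    schr τ τ' w f = 0 ↔ f.1 ∈ bloch τ τ' w α β := by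
  constructor
  · intro h
    refine ⟨f.2, fun p => sub_eq_zero.mp ?_⟩
    exact congrFun (congrArg Subtype.val h) p
  · intro h
    ext p
    exact sub_eq_zero.mpr (h.2 p)

theorem ft_schr (w : potentials) (f : twisted (expU μ) (expU ν)) (k : ℤ × ℤ) :
    ft μ ν (schr τ τ' w f) k =
      sym τ τ' (freq μ k.1) (freq ν k.2) * ft μ ν f k - ft μ ν (w * f) k := by
  rw [← ft_dZ_dZbar f.2, ← ft_sub (continuous_of_mem_twisted
    (dZ_mem_twisted (dZbar_mem_twisted f.2)))
    (continuous_of_mem_twisted (potential_mul_mem_twisted w.2 f.2))]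
  rfl

namespace RegularValue

variable (R : RegularValue τ τ' μ ν)

/-- The symbol of the resolvent. -/
def inv (k : ℤ × ℤ) : ℂ := (sym τ τ' (freq μ k.1) (freq ν k.2) - R.val)⁻¹

theorem inv_ne_zero (k : ℤ × ℤ) : R.inv k ≠ 0 := _root_.inv_ne_zero (R.ne k)

theorem exists_wt_mul_norm_inv_le : ∃ C : ℝ, ∀ k, wt k * ‖R.inv k‖ ≤ C := by
  obtain ⟨C, hC⟩ := R.decay
  refine ⟨C, fun k => ?_⟩
  rw [inv, norm_inv, ← div_eq_mul_inv, div_le_iff₀ (norm_pos_iff.mpr (R.ne k))]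
  exact hC k

theorem exists_norm_inv_le : ∃ C : ℝ, ∀ k, ‖R.inv k‖ ≤ C := by
  obtain ⟨C, hC⟩ := R.exists_wt_mul_norm_inv_le
  exact ⟨C, fun k => (le_mul_of_one_le_left (norm_nonneg _) (one_le_wt k)).trans (hC k)⟩

/-- The symbol of the resolvent as a bounded sequence. -/
def invSeq : Seq :=
  BoundedContinuousFunction.ofNormedAddCommGroupDiscrete R.inv _ R.exists_norm_inv_le.choose_spec

open Filter in
theorem tendsto_invSeq : Tendsto R.invSeq cofinite (𝓝 0) := by
  obtain ⟨C, hC⟩ := R.exists_wt_mul_norm_inv_le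
  have hw : Tendsto (fun k => C * (wt k ^ 2)⁻¹) cofinite (𝓝 0) := by
    simpa using summable_wt.tendsto_cofinite_zero.const_mul C
  have hw2 : Tendsto (fun k => (wt k ^ 2)⁻¹) cofinite (𝓝 0) := summable_wt.tendsto_cofinite_zero
  have hw3 : Tendsto (fun k => C * (wt k)⁻¹) cofinite (𝓝 0) := by
    have h := (Real.continuous_sqrt.tendsto 0).comp hw2
    have e : Real.sqrt ∘ (fun k => (wt k ^ 2)⁻¹) = fun k => (wt k)⁻¹ := by
      funext k
      simp [Real.sqrt_sq (wt_pos k).le]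
    rw [e, Real.sqrt_zero] at h
    simpa using h.const_mul C
  refine squeeze_zero_norm (fun k => ?_) hw3
  rw [← div_eq_mul_inv, le_div_iff₀ (wt_pos k), mul_comm]
  exact hC k

/-- The resolvent. -/
def res : Seq →L[ℂ] Seq := diag R.invSeq

@[simp] theorem res_apply (x : Seq) (k : ℤ × ℤ) : R.res x k = R.inv k * x k := rfl

theorem res_injective : Function.Injective R.res := fun x y h => by
  ext k
  exact mul_left_cancel₀ (R.inv_ne_zero k) (DFunLike.congr_fun h k)

/-- The operator `∂ ∂̄ - w`, composed with the resolvent and bordered by the rank one operator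
with values in the span of `r`. -/
def bordered (k₀ : ℤ × ℤ) (r : twisted (expU μ) (expU ν)) (w : potentials) : Seq →L[ℂ] Seq :=
  1 - R.res ∘L (mulOp w - R.val • 1) + (evalAt k₀).smulRight (R.res (ftL μ ν r))

theorem bordered_apply (k₀ : ℤ × ℤ) (r : twisted (expU μ) (expU ν)) (w : potentials) (x : Seq) :
    R.bordered k₀ r w x = x - R.res (mulOp w x - R.val • x) + x k₀ • R.res (ftL μ ν r) := rfl

/-- The regular value cancels, because the identity is the resolvent applied to the shifted symbol.
Thus the bounded operator encodes the bordered differential operator `f ↦ (∂∂̄ - w) f + f̂(k₀) r`.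
-/
theorem bordered_ftL (k₀ : ℤ × ℤ) (r : twisted (expU μ) (expU ν)) (w : potentials)
    (f : twisted (expU μ) (expU ν)) :
    R.bordered k₀ r w (ftL μ ν f) =
      R.res (ftL μ ν (schr τ τ' w f + ft μ ν f k₀ • r)) := by
  ext k
  rw [bordered_apply, map_add, map_add, map_smul, map_smul]
  simp only [BoundedContinuousFunction.coe_add, BoundedContinuousFunction.coe_sub, Pi.add_apply,
    Pi.sub_apply, BoundedContinuousFunction.coe_smul, res_apply, mulOp_ftL, ftL_apply, ft_schr,
    smul_eq_mul]
  congr 1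
  have h := R.ne k
  rw [inv]
  field_simp
  ring

/-- Elliptic regularity. -/
theorem exists_ftL_eq (k₀ : ℤ × ℤ) (r : twisted (expU μ) (expU ν)) (w : potentials)
    {h : twisted (expU μ) (expU ν)} {x : Seq} (hx : R.bordered k₀ r w x = R.res (ftL μ ν h)) :
    ∃ f, ftL μ ν f = x ∧ schr τ τ' w f + ft μ ν f k₀ • r = h := by
  obtain ⟨g, hg⟩ : ∃ g, g = h - x k₀ • r := ⟨_, rfl⟩
  have hxk : ∀ k, x k = R.inv k * (mulOp w x k - R.val * x k + ft μ ν g k) := fun k => by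
    have h1 := DFunLike.congr_fun hx k
    have h2 : ft μ ν g k = ft μ ν h k - x k₀ * ft μ ν r k := by
      rw [← ftL_apply, hg, map_sub, map_smul]
      rfl
    simp only [bordered_apply, BoundedContinuousFunction.coe_add,
      BoundedContinuousFunction.coe_sub, Pi.add_apply, Pi.sub_apply,
      BoundedContinuousFunction.coe_smul, res_apply, ftL_apply, smul_eq_mul] at h1
    rw [h2]
    linear_combination h1
  -- Bootstrap: convolution with rapidly decreasing coefficients preserves the order of decay, while
  -- the resolvent gains one power of `wt`.
  have hrap : Rapid x := fun n => by
    induction n with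
    | zero => exact ⟨‖x‖, fun k => by simpa using x.norm_coe_le_norm k⟩
    | succ n ih =>
      obtain ⟨C, hC⟩ := ih
      obtain ⟨C1, hC1⟩ := conv_decay (rapid_ft (mem_twisted_of_mem_potentials w.2)) x n hC
      obtain ⟨C2, hC2⟩ := rapid_ft g.2 n
      obtain ⟨D, hD⟩ := R.exists_wt_mul_norm_inv_le
      refine ⟨D * (C1 + ‖R.val‖ * C + C2), fun k => ?_⟩
      have hw := wt_pos k
      have hw' : 0 ≤ wt k ^ n := by positivity
      rw [hxk k, norm_mul]
      have hb : wt k ^ n * ‖mulOp w x k - R.val * x k + ft μ ν g k‖ ≤ C1 + ‖R.val‖ * C + C2 := by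
        calc wt k ^ n * ‖mulOp w x k - R.val * x k + ft μ ν g k‖
            ≤ wt k ^ n * (‖mulOp w x k‖ + ‖R.val‖ * ‖x k‖ + ‖ft μ ν g k‖) := by
              gcongr
              refine (norm_add_le _ _).trans ?_
              gcongr
              refine (norm_sub_le _ _).trans ?_
              rw [norm_mul]
          _ = wt k ^ n * ‖mulOp w x k‖ + ‖R.val‖ * (wt k ^ n * ‖x k‖) +
              wt k ^ n * ‖ft μ ν g k‖ := by ring
          _ ≤ _ := by
              gcongr
              · exact hC1 k
              · exact hC k
              · exact hC2 k
      calc wt k ^ (n + 1) * (‖R.inv k‖ * ‖mulOp w x k - R.val * x k + ft μ ν g k‖)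
          = wt k * ‖R.inv k‖ * (wt k ^ n * ‖mulOp w x k - R.val * x k + ft μ ν g k‖) := by ring
        _ ≤ D * (C1 + ‖R.val‖ * C + C2) := by
            refine mul_le_mul (hD k) hb (by positivity) ?_
            exact le_trans (by positivity) (hD k)
  obtain ⟨f, hf, hfx, -⟩ := exists_ft_eq hrap μ ν
  have hF : ftL μ ν ⟨f, hf⟩ = x := by
    ext k; exact congrFun hfx k
  refine ⟨⟨f, hf⟩, hF, ftL_injective (R.res_injective ?_)⟩
  rw [← hx, ← hF, bordered_ftL]

/-- The Fredholm alternative. -/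
theorem isUnit_bordered (k₀ : ℤ × ℤ) (r : twisted (expU μ) (expU ν)) (w : potentials)
    (hinj : ∀ f, schr τ τ' w f + ft μ ν f k₀ • r = 0 → f = 0) :
    IsUnit (R.bordered k₀ r w) := by
  obtain ⟨T, hT⟩ : ∃ T : Seq →L[ℂ] Seq, T = R.res ∘L (mulOp w - R.val • 1) -
    (evalAt k₀).smulRight (R.res (ftL μ ν r)) := ⟨_, rfl⟩
  have hB : R.bordered k₀ r w = 1 - T := by rw [bordered, hT]; abel
  have hcomp : IsCompactOperator T := by
    rw [hT]
    exact ((isCompactOperator_diag _ R.tendsto_invSeq).comp_clm _).sub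
      (isCompactOperator_smulRight _ _)
  -- The operator is `1 - T` with `T` compact. If `1` were an eigenvalue of `T`, elliptic regularity
  -- would make the eigenvector a smooth solution of the bordered equation, excluded by `hinj`.
  rcases hcomp.hasEigenvalue_or_mem_resolventSet (one_ne_zero : (1 : ℂ) ≠ 0) with h | h
  · obtain ⟨x, hx⟩ := h.exists_hasEigenvector
    have hx1 : T x = x := by simpa using hx.apply_eq_smul
    have hx2 : R.bordered k₀ r w x = R.res (ftL μ ν 0) := by
      rw [hB, map_zero, map_zero]
      simp [hx1]
    obtain ⟨f, hf, hf0⟩ := R.exists_ftL_eq k₀ r w hx2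
    rw [hinj f hf0, map_zero] at hf
    exact absurd hf.symm hx.2
  · rw [hB]
    simpa [spectrum.mem_resolventSet_iff] using h

/-- Solvability of the bordered equation. -/
theorem surjective_of_injective (R : RegularValue τ τ' μ ν) (k₀ : ℤ × ℤ)
    (r : twisted (expU μ) (expU ν)) (w : potentials)
    (hinj : ∀ f, schr τ τ' w f + ft μ ν f k₀ • r = 0 → f = 0) (h : twisted (expU μ) (expU ν)) :
    ∃ f, schr τ τ' w f + ft μ ν f k₀ • r = h := by
  have hu := (ContinuousLinearMap.isUnit_iff_bijective.mp (R.isUnit_bordered k₀ r w hinj)).2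
  obtain ⟨x, hx⟩ := hu (R.res (ftL μ ν h))
  obtain ⟨f, -, hf⟩ := R.exists_ftL_eq k₀ r w hx
  exact ⟨f, hf⟩

end RegularValue

end

section

/-! ### Duality -/

variable {μ ν : ℂ} {τ τ' : ℂ} {α β α' β' : ℂˣ}

theorem mul_mem_potentials_of_dual (hα : α * α' = 1) (hβ : β * β' = 1) {f g : ℝ × ℝ → ℂ}
    (hf : f ∈ twisted α β) (hg : g ∈ twisted α' β') : f * g ∈ potentials := by
  have := mul_mem_twisted hf hg
  rwa [hα, hβ] at this

theorem hasSum_sqInt_mul {f g : ℝ × ℝ → ℂ} (hf : f ∈ twisted (expU μ) (expU ν))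
    (hg : Continuous g) :
    HasSum (fun l => ft μ ν f l * ft (-μ) (-ν) g (-l)) (sqInt (f * g)) := by
  have h := hasSum_ft_mul (μ' := -μ) (ν' := -ν) hf hg 0
  have e : ft (μ + -μ) (ν + -ν) (f * g) 0 = sqInt (f * g) := by
    simp [ft, freq]
    rfl
  rw [e] at h
  simpa using h

/-- The pairing couples frequency `l` of `f` with frequency `-l` of `g`, and the symbol, being
homogeneous quadratic, is even. -/
theorem sqInt_dZ_dZbar_mul (hα : α * α' = 1) (hβ : β * β' = 1) {f g : ℝ × ℝ → ℂ}
    (hf : f ∈ twisted α β) (hg : g ∈ twisted α' β') :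
    sqInt (dZ τ τ' (dZbar τ τ' f) * g) = sqInt (f * dZ τ τ' (dZbar τ τ' g)) := by
  obtain ⟨μ, rfl⟩ := exists_expU α
  obtain ⟨ν, rfl⟩ := exists_expU β
  obtain rfl : α' = expU (-μ) := by rw [expU_neg, eq_inv_of_mul_eq_one_right hα]
  obtain rfl : β' = expU (-ν) := by rw [expU_neg, eq_inv_of_mul_eq_one_right hβ]
  have h1 := hasSum_sqInt_mul (dZ_mem_twisted (τ := τ) (τ' := τ')
    (dZbar_mem_twisted (τ := τ) (τ' := τ') hf)) (continuous_of_mem_twisted hg)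
  have h2 := hasSum_sqInt_mul hf (continuous_of_mem_twisted
    (dZ_mem_twisted (τ := τ) (τ' := τ') (dZbar_mem_twisted (τ := τ) (τ' := τ') hg)))
  refine h1.unique (h2.congr_fun fun l => ?_)
  rw [ft_dZ_dZbar hf, ft_dZ_dZbar hg, Prod.fst_neg, Prod.snd_neg, freq_neg, freq_neg, sym, sym]
  ring

theorem sqInt_schr_mul (hα : α * α' = 1) (hβ : β * β' = 1) (w : potentials) (f : twisted α β)
    (g : twisted α' β') :
    sqInt ((schr τ τ' w f : ℝ × ℝ → ℂ) * g) = sqInt (f * (schr τ τ' w g : ℝ × ℝ → ℂ)) := by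
  have hf := continuous_of_mem_twisted f.2
  have hg := continuous_of_mem_twisted g.2
  have hw := continuous_of_mem_twisted w.2
  have hDf := continuous_of_mem_twisted
    (dZ_mem_twisted (τ := τ) (τ' := τ') (dZbar_mem_twisted (τ := τ) (τ' := τ') f.2))
  have hDg := continuous_of_mem_twisted
    (dZ_mem_twisted (τ := τ) (τ' := τ') (dZbar_mem_twisted (τ := τ) (τ' := τ') g.2))
  have h1 : (schr τ τ' w f : ℝ × ℝ → ℂ) * g =
      fun p => (dZ τ τ' (dZbar τ τ' f) * g.1) p - (w.1 * f.1 * g.1) p := by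
    funext p; simp only [Pi.mul_apply, schr_apply]; ring
  have h2 : f * (schr τ τ' w g : ℝ × ℝ → ℂ) =
      fun p => (f.1 * dZ τ τ' (dZbar τ τ' g)) p - (w.1 * f.1 * g.1) p := by
    funext p; simp only [Pi.mul_apply, schr_apply]; ring
  rw [h1, h2, sqInt_sub (hDf.mul hg) ((hw.mul hf).mul hg),
    sqInt_sub (hf.mul hDg) ((hw.mul hf).mul hg), sqInt_dZ_dZbar_mul hα hβ f.2 g.2]

theorem eq_zero_of_sqInt_mul_eq_zero (hα : α * α' = 1) (hβ : β * β' = 1) {g : ℝ × ℝ → ℂ}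
    (hg : g ∈ twisted α' β') (h : ∀ f ∈ twisted α β, sqInt (f * g) = 0) : g = 0 := by
  obtain ⟨μ, rfl⟩ := exists_expU α'
  obtain ⟨ν, rfl⟩ := exists_expU β'
  refine eq_zero_of_ft_eq_zero hg fun k => ?_
  rw [← h (ex (-freq μ k.1) (-freq ν k.2)), ft]
  · simp only [Pi.mul_def, mul_comm]
  · rw [eq_inv_of_mul_eq_one_left hα, eq_inv_of_mul_eq_one_left hβ, ← expU_neg_freq μ k.1,
      ← expU_neg_freq ν k.2]
    exact ex_mem_twisted _ _

theorem exists_sqInt_mul_eq_one (hα : α * α' = 1) (hβ : β * β' = 1) {g : ℝ × ℝ → ℂ}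
    (hg : g ∈ twisted α' β') (h0 : g ≠ 0) : ∃ f ∈ twisted α β, sqInt (f * g) = 1 := by
  by_contra! h
  refine h0 (eq_zero_of_sqInt_mul_eq_zero hα hβ hg fun f hf => ?_)
  by_contra hne
  refine h ((sqInt (f * g))⁻¹ • f) (Submodule.smul_mem _ _ hf) ?_
  rw [smul_mul_assoc]
  have : (sqInt (f * g))⁻¹ • (f * g) = fun p => (sqInt (f * g))⁻¹ * (f * g) p := rfl
  rw [this, sqInt_const_mul, inv_mul_cancel₀ hne]

/-- If the dual operator were injective it would be surjective, and `ψ`, being orthogonal to its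
range, would vanish. Hence a family only has to be kept on the Fermi curve at `(a_j, b_j)`; the
inverse multipliers follow. -/
theorem exists_bloch_dual_ne_zero (hτ : 0 < τ.im) (hτ' : τ'.im < 0) (hα : α * α' = 1)
    (hβ : β * β' = 1) {u : ℝ × ℝ → ℂ} (hu : u ∈ potentials)
    (h : ∃ ψ ∈ bloch τ τ' u α β, ψ ≠ 0) : ∃ φ ∈ bloch τ τ' u α' β', φ ≠ 0 := by
  obtain ⟨ψ, hψ, hψ0⟩ := h
  by_contra! hinj
  refine hψ0 (eq_zero_of_sqInt_mul_eq_zero ((mul_comm _ _).trans hα) ((mul_comm _ _).trans hβ)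
    hψ.1 fun h hh => ?_)
  obtain ⟨μ, rfl⟩ := exists_expU α'
  obtain ⟨ν, rfl⟩ := exists_expU β'
  obtain ⟨R⟩ := nonempty_regularValue hτ hτ' μ ν
  -- The border is switched off by taking `r = 0`; the index `k₀` is then irrelevant.
  obtain ⟨f, hf⟩ := R.surjective_of_injective 0 0 ⟨u, hu⟩ (fun f hf => by
    rw [smul_zero, add_zero] at hf
    exact Subtype.ext (hinj f ((schr_eq_zero_iff _ f).mp hf))) ⟨h, hh⟩
  rw [smul_zero, add_zero] at hf
  have h1 := sqInt_schr_mul (τ := τ) (τ' := τ') hα hβ ⟨u, hu⟩ ⟨ψ, hψ.1⟩ f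
  rw [(schr_eq_zero_iff ⟨u, hu⟩ ⟨ψ, hψ.1⟩).mpr hψ, hf] at h1
  rw [mul_comm]
  rw [← h1]
  simp [sqInt]

theorem sqInt_mul_smul (c : ℂ) (f g : ℝ × ℝ → ℂ) : sqInt (f * (c • g)) = c * sqInt (f * g) := by
  rw [← sqInt_const_mul]; congr 1; funext p; simp; ring

theorem sqInt_smul_mul (c : ℂ) (f g : ℝ × ℝ → ℂ) : sqInt ((c • f) * g) = c * sqInt (f * g) := by
  rw [← sqInt_const_mul]; congr 1; funext p; simp; ring

theorem sqInt_mul_bloch (hα : α * α' = 1) (hβ : β * β' = 1) {u : potentials} {g : ℝ × ℝ → ℂ}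
    (hg : g ∈ bloch τ τ' u α' β') (f : twisted α β) :
    sqInt ((schr τ τ' u f : ℝ × ℝ → ℂ) * g) = 0 := by
  have h := sqInt_schr_mul (τ := τ) (τ' := τ') hα hβ u f ⟨g, hg.1⟩
  rw [(schr_eq_zero_iff u ⟨g, hg.1⟩).mpr hg] at h
  rw [h]
  simp [sqInt]

/-- The range of `∂∂̄ - u` is orthogonal to `g`, so only the border survives: pairing with `g` reads
off the coefficient at `k₀`. -/
theorem sqInt_bordered_mul (hα : expU μ * α' = 1) (hβ : expU ν * β' = 1) {u : potentials}
    {g : ℝ × ℝ → ℂ} (hg : g ∈ bloch τ τ' u α' β') (k₀ : ℤ × ℤ) (r f : twisted (expU μ) (expU ν)) :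
    sqInt ((schr τ τ' u f + ft μ ν f k₀ • r : twisted (expU μ) (expU ν)).1 * g) =
      ft μ ν f k₀ * sqInt (r * g) := by
  have hgc := continuous_of_mem_twisted hg.1
  have hc := continuous_of_mem_twisted (schr τ τ' u f).2
  have hr := continuous_of_mem_twisted r.2
  have e : (schr τ τ' u f + ft μ ν f k₀ • r : twisted (expU μ) (expU ν)).1 * g =
      fun p => ((schr τ τ' u f).1 * g) p + ((ft μ ν f k₀ • r.1) * g) p := by
    funext p; simp [add_mul]
  rw [e, sqInt_add (hc.mul hgc) ((hr.const_smul _).mul hgc), sqInt_smul_mul,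
    sqInt_mul_bloch hα hβ hg, zero_add]

/-- At a simple point, the bordered operator is injective. -/
theorem bordered_injective (hα : expU μ * α' = 1) (hβ : expU ν * β' = 1) {u : potentials}
    {ψ g : ℝ × ℝ → ℂ} (hspan : ∀ f ∈ bloch τ τ' u (expU μ) (expU ν), ∃ c : ℂ, f = c • ψ)
    (hg : g ∈ bloch τ τ' u α' β') {k₀ : ℤ × ℤ} (hk₀ : ft μ ν ψ k₀ ≠ 0)
    {r : twisted (expU μ) (expU ν)} (hr : sqInt (r * g) ≠ 0) (f : twisted (expU μ) (expU ν))
    (hf : schr τ τ' u f + ft μ ν f k₀ • r = 0) : f = 0 := by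
  have h := sqInt_bordered_mul hα hβ hg k₀ r f
  rw [hf] at h
  have h0 : ft μ ν f k₀ = 0 := by
    have : ft μ ν f k₀ * sqInt (r * g) = 0 := by rw [← h]; simp [sqInt]
    exact (mul_eq_zero.mp this).resolve_right hr
  rw [h0, zero_smul, add_zero, schr_eq_zero_iff] at hf
  obtain ⟨c, hc⟩ := hspan f hf
  rw [hc, ft_smul] at h0
  ext p
  rw [hc, (mul_eq_zero.mp h0).resolve_right hk₀]
  simp

theorem exists_ft_ne_zero {f : ℝ × ℝ → ℂ} (hf : f ∈ twisted (expU μ) (expU ν)) (h0 : f ≠ 0) :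
    ∃ k, ft μ ν f k ≠ 0 := by
  by_contra! h
  exact h0 (eq_zero_of_ft_eq_zero hf h)

/-- The bordered equation is always solvable, and the coefficient of its border term equals `∫ h g =
0`. -/
theorem exists_schr_eq (hτ : 0 < τ.im) (hτ' : τ'.im < 0) (hα : α * α' = 1) (hβ : β * β' = 1)
    {u : potentials} {ψ g : ℝ × ℝ → ℂ} (hψ : ψ ∈ bloch τ τ' u α β) (hψ0 : ψ ≠ 0)
    (hspan : ∀ f ∈ bloch τ τ' u α β, ∃ c : ℂ, f = c • ψ) (hg : g ∈ bloch τ τ' u α' β')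
    (hg0 : g ≠ 0) (h : twisted α β) (hh : sqInt (h * g) = 0) : ∃ f, schr τ τ' u f = h := by
  obtain ⟨μ, rfl⟩ := exists_expU α
  obtain ⟨ν, rfl⟩ := exists_expU β
  obtain ⟨R⟩ := nonempty_regularValue hτ hτ' μ ν
  obtain ⟨k₀, hk₀⟩ := exists_ft_ne_zero hψ.1 hψ0
  obtain ⟨r, hr, hr1⟩ := exists_sqInt_mul_eq_one hα hβ hg.1 hg0
  obtain ⟨f, hf⟩ := R.surjective_of_injective k₀ ⟨r, hr⟩ u
    (bordered_injective hα hβ hspan hg hk₀ (by simp [hr1])) h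
  refine ⟨f, ?_⟩
  have h2 := sqInt_bordered_mul hα hβ hg k₀ ⟨r, hr⟩ f
  rw [hf, hh, hr1, mul_one] at h2
  rw [← hf, ← h2, zero_smul, add_zero]

/-- The range of `∂∂̄ - u` together with `r` spans all twisted functions. The combination `φ - (∫ r
φ) g` is orthogonal to both, hence zero. -/
theorem bloch_dual_span (hτ : 0 < τ.im) (hτ' : τ'.im < 0) (hα : α * α' = 1) (hβ : β * β' = 1)
    {u : potentials} {ψ g : ℝ × ℝ → ℂ} (hψ : ψ ∈ bloch τ τ' u α β) (hψ0 : ψ ≠ 0)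
    (hspan : ∀ f ∈ bloch τ τ' u α β, ∃ c : ℂ, f = c • ψ) (hg : g ∈ bloch τ τ' u α' β')
    (hg0 : g ≠ 0) : ∀ f ∈ bloch τ τ' u α' β', ∃ c : ℂ, f = c • g := by
  intro φ hφ
  obtain ⟨r, hr, hr1⟩ := exists_sqInt_mul_eq_one hα hβ hg.1 hg0
  refine ⟨sqInt (r * φ), sub_eq_zero.mp ?_⟩
  have hd : φ - sqInt (r * φ) • g ∈ bloch τ τ' u α' β' :=
    sub_mem hφ (Submodule.smul_mem _ _ hg)
  have hsub : ∀ f ∈ twisted α β, sqInt (f * (φ - sqInt (r * φ) • g)) =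
      sqInt (f * φ) - sqInt (r * φ) * sqInt (f * g) := fun f hf => by
    have hfc := continuous_of_mem_twisted hf
    have hφc := continuous_of_mem_twisted hφ.1
    have hgc := continuous_of_mem_twisted hg.1
    rw [← sqInt_mul_smul, ← sqInt_sub (hfc.mul hφc) (hfc.mul (hgc.const_smul _)), mul_sub]
    rfl
  refine eq_zero_of_sqInt_mul_eq_zero hα hβ hd.1 fun h hh => ?_
  have hc := continuous_of_mem_twisted hh
  have hrc := continuous_of_mem_twisted hr
  have hgc := continuous_of_mem_twisted hg.1
  have hdc := continuous_of_mem_twisted hd.1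
  have hh' : sqInt ((h - sqInt (h * g) • r) * g) = 0 := by
    have e : (h - sqInt (h * g) • r) * g =
        fun p => (h * g) p - ((sqInt (h * g) • r) * g) p := by
      funext p; simp [sub_mul]
    rw [e, sqInt_sub (hc.mul hgc) ((hrc.const_smul _).mul hgc), sqInt_smul_mul, hr1]
    ring
  obtain ⟨f, hf⟩ := exists_schr_eq hτ hτ' hα hβ hψ hψ0 hspan hg hg0
    ⟨h - sqInt (h * g) • r, sub_mem hh (Submodule.smul_mem _ _ hr)⟩ hh'
  have h3 := sqInt_mul_bloch hα hβ hd f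
  rw [hf] at h3
  have e : (h - sqInt (h * g) • r) * (φ - sqInt (r * φ) • g) =
        fun p => (h * (φ - sqInt (r * φ) • g)) p -
          ((sqInt (h * g) • r) * (φ - sqInt (r * φ) • g)) p := by
      funext p; simp [sub_mul]
  rw [e, sqInt_sub (hc.mul hdc) ((hrc.const_smul _).mul hdc), sqInt_smul_mul, hsub r hr, hr1] at h3
  simpa using h3

end

section

/-! ### Tangent vectors at simple points -/

variable {μ ν : ℂ} {τ τ' : ℂ} {α β α' β' : ℂˣ}

/-- By simplicity the unperturbed solution is a multiple of `ψ`, so the condition says that `v ψ`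
lies in the range of `∂∂̄ - u`, which is the orthogonal complement of `g`. -/
theorem staysOnFermiCurve_iff (hτ : 0 < τ.im) (hτ' : τ'.im < 0) (hα : α * α' = 1) (hβ : β * β' = 1)
    {u : ℝ × ℝ → ℂ} (hu : u ∈ potentials) {ψ g : ℝ × ℝ → ℂ} (hψ : ψ ∈ bloch τ τ' u α β)
    (hψ0 : ψ ≠ 0) (hspan : ∀ f ∈ bloch τ τ' u α β, ∃ c : ℂ, f = c • ψ)
    (hg : g ∈ bloch τ τ' u α' β') (hg0 : g ≠ 0) {v : ℝ × ℝ → ℂ} (hv : v ∈ potentials) :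
    StaysOnFermiCurve τ τ' u v α β ↔ sqInt (v * ψ * g) = 0 := by
  constructor
  · rintro ⟨f, hf, hf0, φ, hφ, h⟩
    obtain ⟨c, rfl⟩ := hspan f hf
    have hc : c ≠ 0 := by rintro rfl; simp at hf0
    have h1 := sqInt_mul_bloch (u := ⟨u, hu⟩) hα hβ hg ⟨φ, hφ⟩
    have h2 : (schr τ τ' ⟨u, hu⟩ ⟨φ, hφ⟩ : twisted α β).1 * g = c • (v * ψ) * g := by
      funext p
      simp only [Pi.mul_apply, schr_apply, h, Pi.smul_apply, smul_eq_mul]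
      ring
    rw [h2, sqInt_smul_mul] at h1
    exact (mul_eq_zero.mp h1).resolve_left hc
  · intro h
    obtain ⟨f, hf⟩ := exists_schr_eq (u := ⟨u, hu⟩) hτ hτ' hα hβ hψ hψ0 hspan hg hg0
      ⟨v * ψ, potential_mul_mem_twisted hv hψ.1⟩ h
    refine ⟨ψ, hψ, hψ0, f, f.2, fun p => ?_⟩
    have := congrFun (congrArg Subtype.val hf) p
    rw [schr_apply] at this
    simp only [Pi.mul_apply] at this
    linear_combination this

/-! ### Smooth families of functions -/

theorem contDiff_slice {γ : ℝ → ℝ × ℝ → ℂ} (hγ : ContDiff ℝ ∞ fun q : ℝ × (ℝ × ℝ) => γ q.1 q.2)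
    (t : ℝ) : ContDiff ℝ ∞ (γ t) :=
  hγ.comp (contDiff_const.prodMk contDiff_id)

theorem contDiff_fderiv_family {γ : ℝ → ℝ × ℝ → ℂ}
    (hγ : ContDiff ℝ ∞ fun q : ℝ × (ℝ × ℝ) => γ q.1 q.2) (w : ℝ × ℝ) :
    ContDiff ℝ ∞ fun q : ℝ × (ℝ × ℝ) => fderiv ℝ (γ q.1) q.2 w := by
  have h : ∀ q : ℝ × (ℝ × ℝ), fderiv ℝ (γ q.1) q.2 w =
      fderiv ℝ (fun q : ℝ × (ℝ × ℝ) => γ q.1 q.2) q (0, w) := fun q => by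
    have h1 : HasFDerivAt (γ q.1) _ q.2 :=
      ((hγ.differentiable (by simp)) (q.1, q.2)).hasFDerivAt.comp q.2
        (hasFDerivAt_prodMk_right q.1 q.2)
    rw [h1.fderiv]
    simp
  rw [funext h]
  exact (hγ.fderiv_right (m := ∞) (by norm_cast)).clm_apply contDiff_const

theorem contDiff_wtOp_family {γ : ℝ → ℝ × ℝ → ℂ}
    (hγ : ContDiff ℝ ∞ fun q : ℝ × (ℝ × ℝ) => γ q.1 q.2) :
    ContDiff ℝ ∞ fun q : ℝ × (ℝ × ℝ) => wtOp μ ν (γ q.1) q.2 := by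
  have hX : ∀ {δ : ℝ → ℝ × ℝ → ℂ}, (ContDiff ℝ ∞ fun q : ℝ × (ℝ × ℝ) => δ q.1 q.2) →
      ContDiff ℝ ∞ fun q : ℝ × (ℝ × ℝ) => (dX (δ q.1) - μ • δ q.1) q.2 := fun hδ =>
    (contDiff_fderiv_family hδ (1, 0)).sub (contDiff_const.smul hδ)
  have hY : ∀ {δ : ℝ → ℝ × ℝ → ℂ}, (ContDiff ℝ ∞ fun q : ℝ × (ℝ × ℝ) => δ q.1 q.2) →
      ContDiff ℝ ∞ fun q : ℝ × (ℝ × ℝ) => (dY (δ q.1) - ν • δ q.1) q.2 := fun hδ =>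
    (contDiff_fderiv_family hδ (0, 1)).sub (contDiff_const.smul hδ)
  exact (hγ.sub (hX (δ := fun t => dX (γ t) - μ • γ t) (hX hγ))).sub
    (hY (δ := fun t => dY (γ t) - ν • γ t) (hY hγ))

theorem exists_lipschitz_family {γ : ℝ → ℝ × ℝ → ℂ}
    (hγ : ContDiff ℝ ∞ fun q : ℝ × (ℝ × ℝ) => γ q.1 q.2) :
    ∃ C : ℝ, ∀ t ∈ Icc (-1 : ℝ) 1, ∀ p ∈ Icc ((0 : ℝ), (0 : ℝ)) (1, 1),
      ‖γ t p - γ 0 p‖ ≤ C * |t| := by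
  have hK : IsCompact (Icc (-1 : ℝ) 1 ×ˢ Icc ((0 : ℝ), (0 : ℝ)) (1, 1)) :=
    isCompact_Icc.prod isCompact_Icc
  obtain ⟨C, hC⟩ := hK.exists_bound_of_continuousOn
    (hγ.continuous_fderiv (by simp)).continuousOn
  refine ⟨C, fun t ht p hp => ?_⟩
  have h := ((convex_Icc (-1 : ℝ) 1).prod
    (convex_Icc ((0 : ℝ), (0 : ℝ)) (1, 1))).norm_image_sub_le_of_norm_fderiv_le
    (fun q _ => hγ.differentiable (by simp) q) hC (x := (0, p)) (y := (t, p))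
    ⟨by simp, hp⟩ ⟨ht, hp⟩
  simpa using h

theorem hasDerivAt_family {γ : ℝ → ℝ × ℝ → ℂ}
    (hγ : ContDiff ℝ ∞ fun q : ℝ × (ℝ × ℝ) => γ q.1 q.2) (t : ℝ) (p : ℝ × ℝ) :
    HasDerivAt (fun t => γ t p) (fderiv ℝ (fun q : ℝ × (ℝ × ℝ) => γ q.1 q.2) (t, p) (1, 0)) t :=
  HasFDerivAt.comp_hasDerivAt (f := fun t => (t, p)) t
    ((hγ.differentiable (by simp)) (t, p)).hasFDerivAt
    ((hasDerivAt_id' t).prodMk (hasDerivAt_const t p))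

theorem contDiff_velocity {γ : ℝ → ℝ × ℝ → ℂ}
    (hγ : ContDiff ℝ ∞ fun q : ℝ × (ℝ × ℝ) => γ q.1 q.2) :
    ContDiff ℝ ∞ fun p : ℝ × ℝ =>
      fderiv ℝ (fun q : ℝ × (ℝ × ℝ) => γ q.1 q.2) (0, p) (1, 0) :=
  ((hγ.fderiv_right (m := ∞) (by norm_cast)).comp (contDiff_const.prodMk contDiff_id)).clm_apply
    contDiff_const

/-- Differentiation under the integral sign. -/
theorem hasDerivAt_sqInt_family {γ : ℝ → ℝ × ℝ → ℂ}
    (hγ : ContDiff ℝ ∞ fun q : ℝ × (ℝ × ℝ) => γ q.1 q.2) {φ : ℝ × ℝ → ℂ} (hφ : Continuous φ)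
    {v : ℝ × ℝ → ℂ} (hv : ∀ p, HasDerivAt (fun t => γ t p) (v p) 0) :
    HasDerivAt (fun t => sqInt (γ t * φ)) (sqInt (v * φ)) 0 := by
  obtain rfl : v = fun p => fderiv ℝ (fun q : ℝ × (ℝ × ℝ) => γ q.1 q.2) (0, p) (1, 0) :=
    funext fun p => (hv p).unique (hasDerivAt_family hγ 0 p)
  have hc : ∀ t, Continuous (γ t * φ) := fun t => (contDiff_slice hγ t).continuous.mul hφ
  have hd : Continuous fun q : ℝ × (ℝ × ℝ) =>
      fderiv ℝ (fun q : ℝ × (ℝ × ℝ) => γ q.1 q.2) q (1, 0) * φ q.2 :=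
    ((hγ.continuous_fderiv (by simp)).clm_apply continuous_const).mul (hφ.comp continuous_snd)
  obtain ⟨C, hC⟩ := ((isCompact_Icc (a := (-1 : ℝ)) (b := 1)).prod
    (isCompact_Icc (a := ((0 : ℝ), (0 : ℝ))) (b := (1, 1)))).exists_bound_of_continuousOn
    hd.continuousOn
  rw [funext fun t => sqInt_eq_integral (hc t),
    sqInt_eq_integral (((contDiff_velocity hγ).continuous).mul hφ)]
  refine (hasDerivAt_integral_of_dominated_loc_of_deriv_le (F := fun t p => (γ t * φ) p)
    (F' := fun t p => fderiv ℝ (fun q : ℝ × (ℝ × ℝ) => γ q.1 q.2) (t, p) (1, 0) * φ p)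
    (bound := fun _ => C) (s := Metric.ball 0 1) (Metric.ball_mem_nhds 0 one_pos)
    (.of_forall fun t => (hc t).aestronglyMeasurable) (integrable_sqMeasure (hc 0))
    (((contDiff_velocity hγ).continuous).mul hφ).aestronglyMeasurable ?_ (integrable_const C)
    (.of_forall fun p t _ => (hasDerivAt_family hγ t p).mul_const (φ p))).2
  filter_upwards [ae_sqMeasure] with p hp t ht
  rw [Metric.mem_ball, dist_zero_right, Real.norm_eq_abs, abs_lt] at ht
  exact hC (t, p) ⟨⟨ht.1.le, ht.2.le⟩, hp⟩

theorem wtOp_sub {f g : ℝ × ℝ → ℂ} (hf : ContDiff ℝ ∞ f) (hg : ContDiff ℝ ∞ g) :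
    wtOp μ ν (f - g) = wtOp μ ν f - wtOp μ ν g := by
  have hX : ∀ {f g : ℝ × ℝ → ℂ}, ContDiff ℝ ∞ f → ContDiff ℝ ∞ g →
      dX (f - g) = dX f - dX g := fun hf hg => by
    funext p
    simp only [dX, Pi.sub_apply, fderiv_sub (hf.differentiable (by simp) p)
      (hg.differentiable (by simp) p)]
    rfl
  have hY : ∀ {f g : ℝ × ℝ → ℂ}, ContDiff ℝ ∞ f → ContDiff ℝ ∞ g →
      dY (f - g) = dY f - dY g := fun hf hg => by
    funext p
    simp only [dY, Pi.sub_apply, fderiv_sub (hf.differentiable (by simp) p)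
      (hg.differentiable (by simp) p)]
    rfl
  have sX : ∀ {f : ℝ × ℝ → ℂ}, ContDiff ℝ ∞ f → ContDiff ℝ ∞ (dX f) := fun h =>
    contDiff_fderiv_apply h _
  have sY : ∀ {f : ℝ × ℝ → ℂ}, ContDiff ℝ ∞ f → ContDiff ℝ ∞ (dY f) := fun h =>
    contDiff_fderiv_apply h _
  have sm : ∀ (c : ℂ) {f : ℝ × ℝ → ℂ}, ContDiff ℝ ∞ f → ContDiff ℝ ∞ (c • f) := fun c f h =>
    contDiff_const.smul h
  rw [wtOp, hX hf hg, hY hf hg,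
    show dX f - dX g - μ • (f - g) = (dX f - μ • f) - (dX g - μ • g) by rw [smul_sub]; abel,
    show dY f - dY g - ν • (f - g) = (dY f - ν • f) - (dY g - ν • g) by rw [smul_sub]; abel,
    hX (f := dX f - μ • f) (g := dX g - μ • g) ((sX hf).sub (sm μ hf)) ((sX hg).sub (sm μ hg)),
    hY (f := dY f - ν • f) (g := dY g - ν • g) ((sY hf).sub (sm ν hf)) ((sY hg).sub (sm ν hg)), wtOp, wtOp]
  simp only [smul_sub]
  abel

/-- The operator norm is at most the `ℓ¹` norm of the Fourier coefficients. Applying `wtOp` twice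
before the Lipschitz bound in `t` provides the summable factor `wt⁻²`. -/
theorem exists_norm_mulOp_family_le {γ : ℝ → ℝ × ℝ → ℂ}
    (hγ : ContDiff ℝ ∞ fun q : ℝ × (ℝ × ℝ) => γ q.1 q.2) (hpot : ∀ t, γ t ∈ potentials) :
    ∃ C : ℝ, ∀ t ∈ Icc (-1 : ℝ) 1, ‖mulOp (⟨γ t, hpot t⟩ - ⟨γ 0, hpot 0⟩)‖ ≤ C * |t| := by
  obtain ⟨K, hK0, hK⟩ := exists_norm_ft_le 0 0
  obtain ⟨C, hC⟩ := exists_lipschitz_family (γ := fun t => wtOp 0 0 (wtOp 0 0 (γ t)))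
    (contDiff_wtOp_family (γ := fun t => wtOp 0 0 (γ t)) (contDiff_wtOp_family hγ))
  refine ⟨C * K * ∑' k, (wt k ^ 2)⁻¹, fun t ht => (norm_mulOp_le _).trans ?_⟩
  have hs : (fun p => wtOp 0 0 (wtOp 0 0 (γ t)) p - wtOp 0 0 (wtOp 0 0 (γ 0)) p) =
      wtOp 0 0 (wtOp 0 0 (γ t - γ 0)) := by
    rw [wtOp_sub (hpot t).1 (hpot 0).1, wtOp_sub (wtOp_mem_twisted (hpot t)).1
      (wtOp_mem_twisted (hpot 0)).1]
    rfl
  have hmem := mem_twisted_of_mem_potentials (sub_mem (hpot t) (hpot 0))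
  have hk : ∀ k, ‖ft 0 0 (γ t - γ 0) k‖ ≤ C * K * |t| * (wt k ^ 2)⁻¹ := fun k => by
    have h := hK _ (C * |t|) (hC t ht) k
    rw [hs, ft_wtOp (wtOp_mem_twisted hmem), ft_wtOp hmem, norm_mul, norm_mul, Complex.norm_real,
      Real.norm_of_nonneg (wt_pos k).le] at h
    rw [← div_eq_mul_inv, le_div_iff₀ (pow_pos (wt_pos k) 2)]
    linarith
  have := ((rapid_ft hmem).summable_norm).tsum_le_tsum hk (summable_wt.mul_left _)
  rw [tsum_mul_left] at this
  refine this.trans (le_of_eq (by ring))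

end

section

/-! ### Velocities are tangent -/

variable {μ ν : ℂ} {τ τ' : ℂ} {α β α' β' : ℂˣ}

theorem norm_sqInt_mul_le (f : twisted (expU μ) (expU ν)) {g : ℝ × ℝ → ℂ}
    (hg : g ∈ twisted (expU (-μ)) (expU (-ν))) :
    ‖sqInt (f * g)‖ ≤ (∑' l, ‖ft (-μ) (-ν) g l‖) * ‖ftL μ ν f‖ := by
  have hs := (rapid_ft hg).summable_norm
  have h := hasSum_sqInt_mul hg (continuous_of_mem_twisted f.2)
  rw [neg_neg, neg_neg] at h
  have hb : ∀ l, ‖ft (-μ) (-ν) g l * ft μ ν f (-l)‖ ≤ ‖ft (-μ) (-ν) g l‖ * ‖ftL μ ν f‖ := fun l => by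
    rw [norm_mul]
    gcongr
    exact (ftL μ ν f).norm_coe_le_norm (-l)
  rw [mul_comm, ← h.tsum_eq, ← tsum_mul_right]
  have hsum : Summable fun l => ‖ft (-μ) (-ν) g l * ft μ ν f (-l)‖ :=
    .of_nonneg_of_le (fun _ => norm_nonneg _) hb (hs.mul_right _)
  exact (norm_tsum_le_tsum_norm hsum).trans (hsum.tsum_le_tsum hb (hs.mul_right _))

theorem mulOp_ftL_eq (w : potentials) (f : twisted (expU μ) (expU ν)) :
    mulOp w (ftL μ ν f) = ftL μ ν ⟨w * f, potential_mul_mem_twisted w.2 f.2⟩ := by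
  ext k; exact mulOp_ftL w f k

theorem exists_norm_le_of_isUnit {A : Seq →L[ℂ] Seq} (hA : IsUnit A) :
    ∃ B : ℝ, 0 ≤ B ∧ ∀ x, ‖x‖ ≤ B * ‖A x‖ := by
  obtain ⟨A, rfl⟩ := hA
  refine ⟨‖(↑A⁻¹ : Seq →L[ℂ] Seq)‖, norm_nonneg _, fun x => ?_⟩
  have : (↑A⁻¹ : Seq →L[ℂ] Seq) ((A : Seq →L[ℂ] Seq) x) = x := by
    rw [← mul_apply_eq_comp, A.inv_mul]; rfl
  calc ‖x‖ = ‖(↑A⁻¹ : Seq →L[ℂ] Seq) ((A : Seq →L[ℂ] Seq) x)‖ := by rw [this]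
    _ ≤ _ := ContinuousLinearMap.le_opNorm _ _

/-- The integral of a potential against `ψ g` is of second order in the distance to `u`, for
potentials with Bloch solutions near the simple Bloch solution `ψ`. -/
theorem exists_norm_sqInt_sub_le (hτ : 0 < τ.im) (hτ' : τ'.im < 0) (hα : α * α' = 1)
    (hβ : β * β' = 1) {u : potentials} {ψ g : ℝ × ℝ → ℂ} (hψ : ψ ∈ bloch τ τ' u α β)
    (hψ0 : ψ ≠ 0) (hspan : ∀ f ∈ bloch τ τ' u α β, ∃ c : ℂ, f = c • ψ)
    (hg : g ∈ bloch τ τ' u α' β') (hg0 : g ≠ 0) :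
    ∃ M D : ℝ, 0 ≤ M ∧ 0 ≤ D ∧ ∀ w : potentials, (∃ φ ∈ bloch τ τ' w α β, φ ≠ 0) →
      D * ‖mulOp (w - u)‖ ≤ 1 / 2 →
      ‖sqInt ((w - u : potentials).1 * ψ * g)‖ ≤ M * ‖mulOp (w - u)‖ ^ 2 := by
  obtain ⟨μ, rfl⟩ := exists_expU α
  obtain ⟨ν, rfl⟩ := exists_expU β
  obtain rfl : α' = expU (-μ) := by rw [expU_neg, eq_inv_of_mul_eq_one_right hα]
  obtain rfl : β' = expU (-ν) := by rw [expU_neg, eq_inv_of_mul_eq_one_right hβ]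
  obtain ⟨R⟩ := nonempty_regularValue hτ hτ' μ ν
  obtain ⟨k₀, hk₀⟩ := exists_ft_ne_zero hψ.1 hψ0
  obtain ⟨r, hr, hr1⟩ := exists_sqInt_mul_eq_one hα hβ hg.1 hg0
  have hunit := R.isUnit_bordered k₀ ⟨r, hr⟩ u
    (bordered_injective hα hβ hspan hg hk₀ (by simp [hr1]))
  obtain ⟨B, hB0, hB⟩ := exists_norm_le_of_isUnit hunit
  obtain ⟨x, hx⟩ : ∃ x, x = ftL μ ν ⟨ψ, hψ.1⟩ := ⟨_, rfl⟩
  obtain ⟨E, hE⟩ : ∃ E, E = ∑' l, ‖ft (-μ) (-ν) g l‖ := ⟨_, rfl⟩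
  obtain ⟨D, hD⟩ : ∃ D, D = B * ‖R.res‖ := ⟨_, rfl⟩
  have hE0 : 0 ≤ E := hE ▸ tsum_nonneg fun _ => norm_nonneg _
  have hD0 : 0 ≤ D := hD ▸ by positivity
  refine ⟨2 * E * D * ‖x‖, D, by positivity, hD0, ?_⟩
  rintro w ⟨φ, hφ, hφ0⟩ hw
  obtain ⟨δ, hδ⟩ : ∃ δ, δ = w - u := ⟨_, rfl⟩
  rw [← hδ] at hw ⊢
  obtain ⟨y, hy⟩ : ∃ y, y = ftL μ ν ⟨φ, hφ.1⟩ := ⟨_, rfl⟩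
  -- With this `c` the coefficient of `φ - c ψ` at `k₀` vanishes, so the border terms cancel and `φ
  -- - c ψ` is of first order in `δ`.
  obtain ⟨c, hc⟩ : ∃ c, c = ft μ ν φ k₀ / ft μ ν ψ k₀ := ⟨_, rfl⟩
  have hschr : schr τ τ' u ⟨φ, hφ.1⟩ = ⟨δ * φ, potential_mul_mem_twisted δ.2 hφ.1⟩ := by
    ext p
    rw [schr_apply, hφ.2, hδ]
    simp only [Pi.mul_apply, Submodule.coe_sub, Pi.sub_apply]
    ring
  have hAx : R.bordered k₀ ⟨r, hr⟩ u x = ft μ ν ψ k₀ • R.res (ftL μ ν ⟨r, hr⟩) := by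
    rw [hx, R.bordered_ftL, (schr_eq_zero_iff u ⟨ψ, hψ.1⟩).mpr hψ, zero_add, map_smul, map_smul]
  have hAy : R.bordered k₀ ⟨r, hr⟩ u y =
      R.res (mulOp δ y) + ft μ ν φ k₀ • R.res (ftL μ ν ⟨r, hr⟩) := by
    rw [hy, R.bordered_ftL, hschr, mulOp_ftL_eq, map_add, map_add, map_smul, map_smul]
  have hAd : R.bordered k₀ ⟨r, hr⟩ u (y - c • x) = R.res (mulOp δ y) := by
    rw [map_sub, map_smul, hAx, hAy, smul_smul, hc, div_mul_cancel₀ _ hk₀, add_sub_cancel_right]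
  have hd : ‖y - c • x‖ ≤ D * ‖mulOp δ‖ * ‖y‖ := by
    refine (hB _).trans ?_
    rw [hAd, hD, mul_assoc, mul_assoc]
    refine mul_le_mul_of_nonneg_left ?_ hB0
    refine (R.res.le_opNorm _).trans ?_
    gcongr
    exact (mulOp δ).le_opNorm y
  have hy0 : 0 < ‖y‖ := by
    refine norm_pos_iff.mpr fun h => hφ0 ?_
    have := ftL_injective (hy.symm.trans (h.trans (map_zero (ftL μ ν)).symm))
    exact congrArg Subtype.val this
  -- Smallness of `δ` absorbs the error into half of `‖y‖`; in particular `c ≠ 0`, so `φ` is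
  -- genuinely close to a multiple of `ψ`.
  have hyc : ‖y‖ ≤ 2 * (‖c‖ * ‖x‖) := by
    have h1 : ‖y‖ ≤ ‖c‖ * ‖x‖ + ‖y - c • x‖ := by
      rw [← norm_smul]
      simpa using norm_add_le (c • x) (y - c • x)
    have h2 : D * ‖mulOp δ‖ * ‖y‖ ≤ 1 / 2 * ‖y‖ := by gcongr
    linarith
  have hc0 : 0 < ‖c‖ := by
    rcases (norm_nonneg c).eq_or_lt with h | h
    · rw [← h] at hyc; linarith
    · exact h
  have hη : φ - c • ψ ∈ twisted (expU μ) (expU ν) :=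
    sub_mem hφ.1 (Submodule.smul_mem _ _ hψ.1)
  have hηx : ftL μ ν ⟨φ - c • ψ, hη⟩ = y - c • x := by
    rw [hy, hx, ← map_smul, ← map_sub]; rfl
  -- Exact orthogonality: `(∂∂̄ - u) φ = δ φ` lies in the range. Replacing `φ` by `c ψ` costs `δ`
  -- times a first order error, which is quadratic.
  have hz : sqInt (δ * φ * g) = 0 := by
    have := sqInt_mul_bloch hα hβ hg ⟨φ, hφ.1⟩
    rwa [hschr] at this
  have hsplit : sqInt (δ * φ * g) = c * sqInt (δ * ψ * g) +
      sqInt (δ * (φ - c • ψ) * g) := by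
    have h1 := continuous_of_mem_twisted δ.2
    have h2 := continuous_of_mem_twisted hψ.1
    have h3 := continuous_of_mem_twisted hη
    have h4 := continuous_of_mem_twisted hg.1
    rw [← sqInt_const_mul, ← sqInt_add (by fun_prop) (by fun_prop)]
    congr 1
    funext p
    simp only [Pi.mul_apply, Pi.sub_apply, Pi.smul_apply, smul_eq_mul]
    ring
  have hbound : ‖sqInt (δ * (φ - c • ψ) * g)‖ ≤ E * (‖mulOp δ‖ * (D * ‖mulOp δ‖ * ‖y‖)) := by
    have h1 := norm_sqInt_mul_le ⟨δ * (φ - c • ψ), potential_mul_mem_twisted δ.2 hη⟩ hg.1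
    rw [← mulOp_ftL_eq δ ⟨φ - c • ψ, hη⟩, hηx, ← hE] at h1
    refine h1.trans (mul_le_mul_of_nonneg_left ?_ hE0)
    refine ((mulOp δ).le_opNorm _).trans ?_
    gcongr
  rw [hz] at hsplit
  have h5 : ‖c‖ * ‖sqInt (δ * ψ * g)‖ ≤ ‖c‖ * (2 * E * D * ‖x‖ * ‖mulOp δ‖ ^ 2) := by
    rw [← norm_mul, eq_neg_of_add_eq_zero_left hsplit.symm, norm_neg]
    refine hbound.trans ?_
    calc E * (‖mulOp δ‖ * (D * ‖mulOp δ‖ * ‖y‖)) = E * D * ‖mulOp δ‖ ^ 2 * ‖y‖ := by ring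
      _ ≤ E * D * ‖mulOp δ‖ ^ 2 * (2 * (‖c‖ * ‖x‖)) := by gcongr
      _ = _ := by ring
  exact le_of_mul_le_mul_left h5 hc0

/-- The Bloch solutions of `γ t` may depend on `t` without any regularity; the quadratic bound and
the Lipschitz dependence of `γ t` give an increment of order `t²`. -/
theorem hasDerivAt_sqInt_family_eq_zero (hτ : 0 < τ.im) (hτ' : τ'.im < 0) (hα : α * α' = 1)
    (hβ : β * β' = 1) {γ : ℝ → ℝ × ℝ → ℂ} (hγ : ContDiff ℝ ∞ fun q : ℝ × (ℝ × ℝ) => γ q.1 q.2)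
    (hpot : ∀ t, γ t ∈ potentials) (hγb : ∀ t, ∃ φ ∈ bloch τ τ' (γ t) α β, φ ≠ 0)
    {ψ g : ℝ × ℝ → ℂ} (hψ : ψ ∈ bloch τ τ' (γ 0) α β)
    (hψ0 : ψ ≠ 0) (hspan : ∀ f ∈ bloch τ τ' (γ 0) α β, ∃ c : ℂ, f = c • ψ)
    (hg : g ∈ bloch τ τ' (γ 0) α' β') (hg0 : g ≠ 0) :
    HasDerivAt (fun t => sqInt (γ t * ψ * g)) 0 0 := by
  obtain ⟨M, D, hM, hD, h⟩ := exists_norm_sqInt_sub_le (u := ⟨γ 0, hpot 0⟩) hτ hτ' hα hβ hψ hψ0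
    hspan hg hg0
  obtain ⟨C, hC⟩ := exists_norm_mulOp_family_le hγ hpot
  have hC0 : 0 ≤ C := by
    have := (norm_nonneg _).trans (hC 1 (by simp))
    simpa using this
  have hsmall : ∀ᶠ t : ℝ in 𝓝 0, D * (C * |t|) ≤ 1 / 2 ∧ t ∈ Icc (-1 : ℝ) 1 := by
    refine Filter.Eventually.and ?_ (Icc_mem_nhds (by norm_num) (by norm_num))
    have hc : Continuous fun t : ℝ => D * (C * |t|) := by fun_prop
    have := hc.tendsto 0
    simp only [abs_zero, mul_zero] at this
    exact this.eventually_le_const (by norm_num)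
  have hψc := continuous_of_mem_twisted hψ.1
  have hgc := continuous_of_mem_twisted hg.1
  rw [hasDerivAt_iff_isLittleO_nhds_zero]
  refine Asymptotics.IsBigO.trans_isLittleO (g := fun t : ℝ => t ^ 2) ?_ ?_
  · refine Asymptotics.IsBigO.of_bound (M * C ^ 2) ?_
    filter_upwards [hsmall] with t ⟨ht, ht1⟩
    have hle := hC t ht1
    have hb := h ⟨γ t, hpot t⟩ (hγb t) ((mul_le_mul_of_nonneg_left hle hD).trans ht)
    have e : sqInt (γ (0 + t) * ψ * g) - sqInt (γ 0 * ψ * g) - t • (0 : ℂ) =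
        sqInt ((⟨γ t, hpot t⟩ - ⟨γ 0, hpot 0⟩ : potentials).1 * ψ * g) := by
      have h1 := continuous_of_mem_twisted (hpot t)
      have h2 := continuous_of_mem_twisted (hpot 0)
      rw [smul_zero, sub_zero, zero_add, ← sqInt_sub (by fun_prop) (by fun_prop)]
      congr 1
      funext p
      simp [sub_mul]
    rw [e]
    refine hb.trans ?_
    have : ‖t ^ 2‖ = |t| ^ 2 := by simp
    rw [this, mul_assoc, ← mul_pow]
    gcongr
  · exact Asymptotics.isLittleO_pow_id one_lt_two

end

section

/-! ### Families of potentials -/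

variable {τ τ' : ℂ} {α β α' β' : ℂˣ} {J : Type*} {a b : J → ℂˣ}

/-- A smooth function of one variable that is the identity near `0` and takes values in a given
interval. -/
theorem exists_smooth_cutoff {ε : ℝ} (hε : 0 < ε) :
    ∃ ρ : ℝ → ℝ, ContDiff ℝ ∞ ρ ∧ (∀ t, ρ t ∈ Ioo (-ε) ε) ∧ ∀ᶠ t in 𝓝 0, ρ t = t := by
  let f : ContDiffBump (0 : ℝ) := ⟨ε / 3, ε / 2, by positivity, by linarith⟩
  refine ⟨fun t => f t * t, f.contDiff.mul contDiff_id, fun t => ?_, ?_⟩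
  · rw [mem_Ioo, ← abs_lt, abs_mul, abs_of_nonneg f.nonneg]
    by_cases h : dist t 0 < ε / 2
    · rw [Real.dist_eq, sub_zero] at h
      calc f t * |t| ≤ 1 * |t| := by gcongr; exact f.le_one
        _ < ε := by linarith
    · rw [f.zero_of_le_dist (not_lt.mp h), zero_mul]
      exact hε
  · filter_upwards [f.eventuallyEq_one] with t ht
    rw [ht]; simp

/-- Reparametrizing by the cutoff keeps the germ at `0` and makes the family smooth for all `t`, so
the estimates need no domain conditions. -/
theorem IsFamilyThrough.exists_global {u : ℝ × ℝ → ℂ} {γ : ℝ → ℝ × ℝ → ℂ}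
    (h : IsFamilyThrough τ τ' a b u γ) :
    ∃ δ : ℝ → ℝ × ℝ → ℂ, (ContDiff ℝ ∞ fun q : ℝ × (ℝ × ℝ) => δ q.1 q.2) ∧
      (∀ t, δ t ∈ locus τ τ' a b) ∧ δ 0 = u ∧ ∀ᶠ t in 𝓝 0, γ t = δ t := by
  obtain ⟨h0, ε, hε, hγ, hloc⟩ := h
  obtain ⟨ρ, hρ, hρε, hρ0⟩ := exists_smooth_cutoff hε
  refine ⟨fun t => γ (ρ t), ?_, fun t => hloc _ (hρε t), ?_, ?_⟩
  · have hm : ContDiff ℝ ∞ fun q : ℝ × (ℝ × ℝ) => (ρ q.1, q.2) :=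
      (hρ.comp contDiff_fst).prodMk contDiff_snd
    exact hγ.comp_contDiff hm fun q => ⟨hρε q.1, mem_univ _⟩
  · exact (congrArg γ hρ0.self_of_nhds).trans h0
  · filter_upwards [hρ0] with t ht
    rw [ht]

theorem velocity_mem_potentials {γ : ℝ → ℝ × ℝ → ℂ}
    (hγ : ContDiff ℝ ∞ fun q : ℝ × (ℝ × ℝ) => γ q.1 q.2) (hpot : ∀ t, γ t ∈ potentials)
    {v : ℝ × ℝ → ℂ} (hv : ∀ p, HasDerivAt (fun t => γ t p) (v p) 0) : v ∈ potentials := by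
  refine ⟨?_, fun x y => ?_, fun x y => ?_⟩
  · rw [funext fun p => (hv p).unique (hasDerivAt_family hγ 0 p)]
    exact contDiff_velocity hγ
  · refine (hv _).unique ?_
    simpa only [(hpot _).2.1, Units.val_one, one_mul] using hv (x, y)
  · refine (hv _).unique ?_
    simpa only [(hpot _).2.2, Units.val_one, one_mul] using hv (x, y)

theorem IsFamilyThrough.velocity_mem_potentials {u : ℝ × ℝ → ℂ} {γ : ℝ → ℝ × ℝ → ℂ}
    (h : IsFamilyThrough τ τ' a b u γ) {v : ℝ × ℝ → ℂ}
    (hv : ∀ p, HasDerivAt (fun t => γ t p) (v p) 0) : v ∈ potentials := by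
  obtain ⟨δ, hδ, hloc, -, heq⟩ := h.exists_global
  refine TorusSigma.velocity_mem_potentials hδ (fun t => (hloc t).1) fun p =>
    (hv p).congr_of_eventuallyEq ?_
  filter_upwards [heq] with t ht
  rw [ht]

theorem IsFamilyThrough.exists_velocity {u : ℝ × ℝ → ℂ} {γ : ℝ → ℝ × ℝ → ℂ}
    (h : IsFamilyThrough τ τ' a b u γ) : ∃ v : ℝ × ℝ → ℂ, ∀ p, HasDerivAt (fun t => γ t p) (v p) 0 := by
  obtain ⟨δ, hδ, -, -, heq⟩ := h.exists_global
  refine ⟨_, fun p => (hasDerivAt_family hδ 0 p).congr_of_eventuallyEq ?_⟩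
  filter_upwards [heq] with t ht
  rw [ht]

theorem IsFamilyThrough.hasDerivAt_sqInt {u : ℝ × ℝ → ℂ} {γ : ℝ → ℝ × ℝ → ℂ}
    (h : IsFamilyThrough τ τ' a b u γ) {v : ℝ × ℝ → ℂ}
    (hv : ∀ p, HasDerivAt (fun t => γ t p) (v p) 0) :
    HasDerivAt (fun t => sqInt (γ t)) (sqInt v) 0 := by
  obtain ⟨δ, hδ, -, -, heq⟩ := h.exists_global
  have h1 := hasDerivAt_sqInt_family hδ (φ := 1) continuous_const (v := v) fun p =>
    (hv p).congr_of_eventuallyEq (by filter_upwards [heq] with t ht; rw [ht])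
  simp only [mul_one] at h1
  refine h1.congr_of_eventuallyEq ?_
  filter_upwards [heq] with t ht
  rw [ht]

theorem IsFamilyThrough.sqInt_velocity_mul (hτ : 0 < τ.im) (hτ' : τ'.im < 0) {u : ℝ × ℝ → ℂ}
    {γ : ℝ → ℝ × ℝ → ℂ} (h : IsFamilyThrough τ τ' a b u γ) {v : ℝ × ℝ → ℂ}
    (hv : ∀ p, HasDerivAt (fun t => γ t p) (v p) 0) (j : J) {ψ g : ℝ × ℝ → ℂ}
    (hψ : ψ ∈ bloch τ τ' u (a j) (b j)) (hψ0 : ψ ≠ 0)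
    (hspan : ∀ f ∈ bloch τ τ' u (a j) (b j), ∃ c : ℂ, f = c • ψ)
    (hg : g ∈ bloch τ τ' u (a j)⁻¹ (b j)⁻¹) (hg0 : g ≠ 0) : sqInt (v * ψ * g) = 0 := by
  obtain ⟨δ, hδ, hloc, rfl, heq⟩ := h.exists_global
  have h1 := hasDerivAt_sqInt_family_eq_zero hτ hτ' (mul_inv_cancel _) (mul_inv_cancel _) hδ
    (fun t => (hloc t).1) (fun t => ((hloc t).2 j).1) hψ hψ0 hspan hg hg0
  have h2 := hasDerivAt_sqInt_family hδ (φ := ψ * g) ((continuous_of_mem_twisted hψ.1).mul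
    (continuous_of_mem_twisted hg.1)) (v := v) fun p =>
      (hv p).congr_of_eventuallyEq (by filter_upwards [heq] with t ht; rw [ht])
  simp only [← mul_assoc] at h2
  exact h2.unique h1

end

section

/-! ### The local equation of the locus -/

variable {μ ν : ℂ} {τ τ' : ℂ} {α β α' β' : ℂˣ}

theorem RegularValue.bordered_add (R : RegularValue τ τ' μ ν) (k₀ : ℤ × ℤ)
    (r : twisted (expU μ) (expU ν)) (u w : potentials) :
    R.bordered k₀ r (u + w) = R.bordered k₀ r u - R.res ∘L mulOp w := by
  ext x k
  simp only [RegularValue.bordered_apply, map_add, add_apply, sub_apply,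
    ContinuousLinearMap.comp_apply, BoundedContinuousFunction.coe_add,
    BoundedContinuousFunction.coe_sub, Pi.add_apply, Pi.sub_apply, map_sub]
  ring

/-- Coefficients of solutions of linear equations depend analytically on parameters. -/
theorem exists_coefficient_function {X P : Type*} [NormedAddCommGroup X] [NormedSpace ℂ X]
    [CompleteSpace X] [NormedAddCommGroup P] [NormedSpace ℂ P] [FiniteDimensional ℂ P]
    (A₀ : (X →L[ℂ] X)ˣ) (l : P →ₗ[ℂ] X →L[ℂ] X) (e : X →L[ℂ] ℂ) (x₀ : X) :
    ∃ (F : P → ℂ) (L : P →L[ℂ] ℂ), ContDiffAt ℂ ω F 0 ∧ F 0 = 0 ∧ HasFDerivAt F L 0 ∧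
      (∀ x, L x = e ((↑A₀⁻¹ : X →L[ℂ] X) (l x x₀))) ∧
      ∀ᶠ x in 𝓝 0, ∃ z, ((A₀ : X →L[ℂ] X) - l x) z = (A₀ : X →L[ℂ] X) x₀ ∧ F x = e z - e x₀ := by
  let 𝓛 : P →L[ℂ] X →L[ℂ] X := LinearMap.toContinuousLinearMap l
  have h𝓛 : ∀ x, 𝓛 x = l x := fun x => rfl
  let A : P → X →L[ℂ] X := fun x => A₀ - 𝓛 x
  have hA0 : A 0 = A₀ := by simp [A]
  have hAd : ContDiff ℂ ω A := contDiff_const.sub 𝓛.contDiff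
  have hAf : HasFDerivAt A (-𝓛) 0 := (𝓛.hasFDerivAt (x := 0)).const_sub (A₀ : X →L[ℂ] X)
  have hinv : ∀ x : X, (↑A₀⁻¹ : X →L[ℂ] X) ((A₀ : X →L[ℂ] X) x) = x := fun x => by
    rw [← mul_apply_eq_comp, A₀.inv_mul]; rfl
  let E : (X →L[ℂ] X) →L[ℂ] ℂ :=
    e.comp (ContinuousLinearMap.apply ℂ X ((A₀ : X →L[ℂ] X) x₀))
  have hE : ∀ B, E B = e (B ((A₀ : X →L[ℂ] X) x₀)) := fun B => rfl
  have hRi : HasFDerivAt Ring.inverse (-ContinuousLinearMap.mulLeftRight ℂ (X →L[ℂ] X)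
      ↑A₀⁻¹ ↑A₀⁻¹) (A 0) := by
    rw [hA0]; exact hasFDerivAt_ringInverse A₀
  -- The function is the coefficient of the solution of `A x z = A₀ x₀`, compared with its value at
  -- `x = 0`. In its differential the sign from differentiating the inverse cancels the sign in `A =
  -- A₀ - l`.
  refine ⟨fun x => E (Ring.inverse (A x)) - e x₀, E.comp ((-ContinuousLinearMap.mulLeftRight ℂ
    (X →L[ℂ] X) ↑A₀⁻¹ ↑A₀⁻¹).comp (-𝓛)), ?_, ?_, ?_, fun x => ?_, ?_⟩
  · have h1 : ContDiffAt ℂ ω Ring.inverse (A 0) := by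
      rw [hA0]; exact contDiffAt_ringInverse ℂ A₀
    exact (E.contDiff.contDiffAt.comp 0 (h1.comp 0 hAd.contDiffAt)).sub contDiffAt_const
  · change E (Ring.inverse (A 0)) - e x₀ = 0
    rw [hA0, Ring.inverse_unit, hE, hinv, sub_self]
  · exact ((E.hasFDerivAt.comp 0 (hRi.comp 0 hAf)).sub_const _)
  · have e1 : E.comp ((-ContinuousLinearMap.mulLeftRight ℂ
        (X →L[ℂ] X) ↑A₀⁻¹ ↑A₀⁻¹).comp (-𝓛)) x =
        e ((↑A₀⁻¹ : X →L[ℂ] X) (𝓛 x ((↑A₀⁻¹ : X →L[ℂ] X) ((A₀ : X →L[ℂ] X) x₀)))) := by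
      simp [hE]
    rw [e1, hinv, h𝓛]
  · have hopen : ∀ᶠ x in 𝓝 (0 : P), IsUnit (A x) := by
      refine hAd.continuous.continuousAt.eventually (Units.isOpen.mem_nhds ?_)
      rw [hA0]; exact A₀.isUnit
    filter_upwards [hopen] with x hx
    obtain ⟨B, hB⟩ := hx
    refine ⟨(↑B⁻¹ : X →L[ℂ] X) ((A₀ : X →L[ℂ] X) x₀), ?_, ?_⟩
    · change A x _ = _
      rw [← hB, ← mul_apply_eq_comp, B.mul_inv]; rfl
    · rw [← hB, Ring.inverse_unit, hE]

/-- Near a potential with simple Bloch solution `ψ`, the potentials in a finite-dimensional linear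
family with nonzero Bloch solutions form the zero locus of an analytic function whose differential
is given by pairing with `ψ g`. -/
theorem exists_local_equation (hτ : 0 < τ.im) (hτ' : τ'.im < 0) (hα : α * α' = 1)
    (hβ : β * β' = 1) {u : potentials} {ψ g : ℝ × ℝ → ℂ} (hψ : ψ ∈ bloch τ τ' u α β)
    (hψ0 : ψ ≠ 0) (hspan : ∀ f ∈ bloch τ τ' u α β, ∃ c : ℂ, f = c • ψ)
    (hg : g ∈ bloch τ τ' u α' β') (hg0 : g ≠ 0) {P : Type*} [NormedAddCommGroup P]
    [NormedSpace ℂ P] [FiniteDimensional ℂ P] (lin : P →ₗ[ℂ] potentials) :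
    ∃ (F : P → ℂ) (L : P →L[ℂ] ℂ), ContDiffAt ℂ ω F 0 ∧ F 0 = 0 ∧ HasFDerivAt F L 0 ∧
      (∀ x, L x = sqInt ((lin x).1 * ψ * g)) ∧
      ∀ᶠ x in 𝓝 0, F x = 0 → ∃ φ ∈ bloch τ τ' (u + lin x : potentials).1 α β, φ ≠ 0 := by
  obtain ⟨μ, rfl⟩ := exists_expU α
  obtain ⟨ν, rfl⟩ := exists_expU β
  obtain ⟨R⟩ := nonempty_regularValue hτ hτ' μ ν
  obtain ⟨k₀, hk₀⟩ := exists_ft_ne_zero hψ.1 hψ0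
  obtain ⟨r, hr, hr1⟩ := exists_sqInt_mul_eq_one hα hβ hg.1 hg0
  have hinj := bordered_injective hα hβ hspan hg hk₀ (r := ⟨r, hr⟩) (by simp [hr1])
  obtain ⟨A₀, hA₀⟩ := R.isUnit_bordered k₀ ⟨r, hr⟩ u hinj
  let l : P →ₗ[ℂ] Seq →L[ℂ] Seq :=
    { toFun := fun x => R.res ∘L mulOp (lin x)
      map_add' := fun x y => by ext; simp
      map_smul' := fun c x => by ext; simp }
  have hA : ∀ x, (A₀ : Seq →L[ℂ] Seq) - l x = R.bordered k₀ ⟨r, hr⟩ (u + lin x) := fun x => by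
    rw [R.bordered_add, ← hA₀]; rfl
  obtain ⟨x₀, hx₀⟩ : ∃ x₀, x₀ = ftL μ ν ⟨ψ, hψ.1⟩ := ⟨_, rfl⟩
  obtain ⟨c, hc⟩ : ∃ c, c = ft μ ν ψ k₀ := ⟨_, rfl⟩
  have hA₀x : (A₀ : Seq →L[ℂ] Seq) x₀ = R.res (ftL μ ν (c • ⟨r, hr⟩)) := by
    rw [hA₀, hx₀, R.bordered_ftL, (schr_eq_zero_iff u ⟨ψ, hψ.1⟩).mpr hψ, zero_add, hc]
  have hinv : ∀ x : Seq, (↑A₀⁻¹ : Seq →L[ℂ] Seq) ((A₀ : Seq →L[ℂ] Seq) x) = x := fun x => by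
    rw [← mul_apply_eq_comp, A₀.inv_mul]; rfl
  obtain ⟨F, L, h1, h2, h3, h4, h5⟩ := exists_coefficient_function A₀ l (evalAt k₀) x₀
  refine ⟨F, L, h1, h2, h3, fun x => ?_, ?_⟩
  · have e1 : l x x₀ = R.res (mulOp (lin x) x₀) := rfl
    rw [h4, e1, hx₀, mulOp_ftL_eq]
    -- The differential is the `k₀` coefficient of the `f` solving the bordered equation with right
    -- side `(lin x) ψ`; pairing with `g` identifies it.
    obtain ⟨f, hf⟩ := R.surjective_of_injective k₀ ⟨r, hr⟩ u hinj
      ⟨(lin x).1 * ψ, potential_mul_mem_twisted (lin x).2 hψ.1⟩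
    have h2 := sqInt_bordered_mul hα hβ hg k₀ ⟨r, hr⟩ f
    rw [hf, hr1, mul_one] at h2
    rw [h2, ← hf, ← R.bordered_ftL, ← hA₀, hinv, evalAt_apply, ftL_apply]
  · filter_upwards [h5] with x ⟨z, hz, hFz⟩ hF
    rw [hA, hA₀x] at hz
    rw [hF, evalAt_apply, evalAt_apply, hx₀, ftL_apply, eq_comm, sub_eq_zero] at hFz
    -- If the `k₀` coefficient keeps its value `c`, the border term equals the right side `c r`, so
    -- `f` solves the Schrödinger equation; it is nonzero because `c ≠ 0`.
    obtain ⟨f, hfz, hf⟩ := R.exists_ftL_eq k₀ ⟨r, hr⟩ (u + lin x) hz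
    have hfc : ft μ ν f k₀ = c := by rw [← ftL_apply, hfz, hFz, hc]
    rw [hfc, add_eq_right, schr_eq_zero_iff] at hf
    refine ⟨f, hf, fun h0 => hk₀ ?_⟩
    rw [← hc, ← hfc, h0]
    simp [ft, sqInt]

/-! ### Linear algebra of pairings -/

/-- Pairing with a continuous function, as a linear functional on potentials. -/
def pairing (h : ℝ × ℝ → ℂ) (hh : Continuous h) : potentials →ₗ[ℂ] ℂ where
  toFun w := sqInt (w.1 * h)
  map_add' v w := by
    have hv := continuous_of_mem_twisted v.2
    have hw := continuous_of_mem_twisted w.2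
    rw [← sqInt_add (by fun_prop) (by fun_prop)]
    congr 1
    funext p
    simp [add_mul]
  map_smul' c w := sqInt_smul_mul c w.1 h

@[simp] theorem pairing_apply (h : ℝ × ℝ → ℂ) (hh : Continuous h) (w : potentials) :
    pairing h hh w = sqInt (w.1 * h) := rfl

theorem sqInt_mul_sum {J : Type*} [Fintype J] {f : ℝ × ℝ → ℂ} (hf : Continuous f)
    {h : J → ℝ × ℝ → ℂ} (hh : ∀ j, Continuous (h j)) (c : J → ℂ) :
    sqInt (f * ∑ j, c j • h j) = ∑ j, c j * sqInt (f * h j) := by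
  simp only [← sqInt_mul_smul]
  rw [← sqInt_sum _ fun j _ => hf.mul ((hh j).const_smul _)]
  congr 1
  funext p
  simp [Finset.mul_sum]

theorem eq_zero_of_forall_sqInt_mul {h : ℝ × ℝ → ℂ} (hh : h ∈ potentials)
    (h0 : ∀ w ∈ potentials, sqInt (w * h) = 0) : h = 0 :=
  eq_zero_of_sqInt_mul_eq_zero (one_mul 1) (one_mul 1) hh h0

/-- If the pairings did not map onto `J → ℂ`, a functional killing their range would, by
nondegeneracy, be a linear relation among the `h j`. -/
theorem exists_dual_potentials {J : Type*} [Fintype J] [DecidableEq J] {h : J → ℝ × ℝ → ℂ}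
    (hh : ∀ j, h j ∈ potentials) (hli : LinearIndependent ℂ h) :
    ∃ w : J → potentials, ∀ k j, sqInt ((w k).1 * h j) = (Pi.single k 1 : J → ℂ) j := by
  have hhc := fun j => continuous_of_mem_twisted (hh j)
  let Λ : potentials →ₗ[ℂ] J → ℂ := LinearMap.pi fun j => pairing (h j) (hhc j)
  have hsurj : LinearMap.range Λ = ⊤ := by
    by_contra hne
    obtain ⟨φ, hφ, hφ0⟩ := Submodule.exists_dual_map_eq_bot_of_lt_top (lt_top_iff_ne_top.mpr hne)
      inferInstance
    have hφΛ : ∀ w, φ (Λ w) = 0 := fun w => by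
      have : φ (Λ w) ∈ (LinearMap.range Λ).map φ := ⟨Λ w, ⟨w, rfl⟩, rfl⟩
      rw [hφ0] at this
      exact this
    have hφs : ∀ x : J → ℂ, φ x = ∑ j, x j * φ (Pi.single j 1) := fun x => by
      conv_lhs => rw [← Finset.univ_sum_single x]
      rw [map_sum]
      refine Finset.sum_congr rfl fun j _ => ?_
      rw [← smul_eq_mul, ← map_smul]
      congr 1
      rw [← Pi.single_smul, smul_eq_mul, mul_one]
    have hz : ∑ j, φ (Pi.single j 1) • h j = 0 := by
      refine eq_zero_of_forall_sqInt_mul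
        (Submodule.sum_mem _ fun j _ => Submodule.smul_mem _ _ (hh j)) fun w hw => ?_
      rw [sqInt_mul_sum (continuous_of_mem_twisted hw) hhc, ← hφΛ ⟨w, hw⟩, hφs]
      exact Finset.sum_congr rfl fun j _ => mul_comm _ _
    have h0 := Fintype.linearIndependent_iff.mp hli _ hz
    exact hφ (LinearMap.ext fun x => by rw [hφs]; simp [h0])
  have hex : ∀ k : J, ∃ w, Λ w = Pi.single k 1 := fun k => LinearMap.range_eq_top.mp hsurj _
  choose w hw using hex
  exact ⟨w, fun k j => congrFun (hw k) j⟩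

end

section

/-! ### Construction of families -/

variable {τ τ' : ℂ} {J : Type*} {a b : J → ℂˣ}

/-- The direction `v` is corrected by potentials `w k` dual to the products `ψ j * g j`. The map `Φ`
from `(s, x)` to `s` and the values of the local equations at `u + s v + ∑ x_k w_k` has identity
differential, so its local inverse along `(t, 0)` traces a curve in the locus with velocity `v`. -/
theorem isVelocity_of_orthogonal [Fintype J] (hτ : 0 < τ.im) (hτ' : τ'.im < 0)
    {u : ℝ × ℝ → ℂ} (hu : u ∈ potentials) {ψ g : J → ℝ × ℝ → ℂ}
    (hψ : ∀ j, ψ j ∈ bloch τ τ' u (a j) (b j)) (hψ0 : ∀ j, ψ j ≠ 0)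
    (hspan : ∀ j, ∀ f ∈ bloch τ τ' u (a j) (b j), ∃ c : ℂ, f = c • ψ j)
    (hg : ∀ j, g j ∈ bloch τ τ' u (a j)⁻¹ (b j)⁻¹) (hg0 : ∀ j, g j ≠ 0)
    (hli : LinearIndependent ℂ fun j => ψ j * g j) {v : ℝ × ℝ → ℂ} (hv : v ∈ potentials)
    (horth : ∀ j, sqInt (v * ψ j * g j) = 0) : IsVelocity τ τ' a b u v := by
  classical
  obtain ⟨w, hw⟩ := exists_dual_potentials
    (fun j => mul_inv_mem_potentials (hψ j).1 (hg j).1) hli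
  let lin : ℂ × (J → ℂ) →ₗ[ℂ] potentials :=
    (LinearMap.toSpanSingleton ℂ potentials ⟨v, hv⟩).coprod (Fintype.linearCombination ℂ w)
  have hlin : ∀ x p, (lin x).1 p = x.1 * v p + ∑ k, x.2 k * (w k).1 p := fun x p => by
    simp [lin, Fintype.linearCombination_apply, Finset.sum_apply]
  have hpair : ∀ x j, sqInt ((lin x).1 * ψ j * g j) = x.2 j := fun x j => by
    have hc : Continuous (ψ j * g j) :=
      (continuous_of_mem_twisted (hψ j).1).mul (continuous_of_mem_twisted (hg j).1)
    have hvj : sqInt (v * (ψ j * g j)) = 0 := by rw [← mul_assoc, horth j]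
    rw [mul_assoc, ← pairing_apply (ψ j * g j) hc]
    simp only [lin, LinearMap.coprod_apply, LinearMap.toSpanSingleton_apply, map_add, map_smul,
      Fintype.linearCombination_apply, map_sum, pairing_apply, hw, hvj]
    simp [Pi.single_apply]
  have heq := fun j => exists_local_equation (u := ⟨u, hu⟩) hτ hτ' (mul_inv_cancel (a j))
    (mul_inv_cancel (b j)) (hψ j) (hψ0 j) (hspan j) (hg j) (hg0 j) lin
  choose F L hF hF0 hFL hL hFb using heq
  let Φ : ℂ × (J → ℂ) → ℂ × (J → ℂ) := fun x => (x.1, fun j => F j x)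
  have hΦ : ContDiffAt ℂ ω Φ 0 := contDiffAt_fst.prodMk (contDiffAt_pi.mpr hF)
  have hΦ' : HasFDerivAt Φ
      ((ContinuousLinearEquiv.refl ℂ (ℂ × (J → ℂ)) : (ℂ × (J → ℂ)) ≃L[ℂ] (ℂ × (J → ℂ))) :
        ℂ × (J → ℂ) →L[ℂ] ℂ × (J → ℂ)) 0 := by
    refine (hasFDerivAt_fst.prodMk (hasFDerivAt_pi.mpr hFL)).congr_fderiv ?_
    refine ContinuousLinearMap.ext fun x => Prod.ext rfl (funext fun j => ?_)
    exact (hL j x).trans (hpair x j)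
  have hΦ0 : Φ 0 = 0 := Prod.ext rfl (funext hF0)
  have hn : (ω : WithTop ℕ∞) ≠ 0 := by simp
  let Ψ := hΦ.localInverse hΦ' hn
  have hΨ0 : Ψ 0 = 0 := by
    have := hΦ.localInverse_apply_image hΦ' hn
    rwa [hΦ0] at this
  have hΨ : ContDiffAt ℂ ω Ψ 0 := by
    have := hΦ.to_localInverse hΦ' hn
    rwa [hΦ0] at this
  have hstrict := hΦ.hasStrictFDerivAt' hΦ' hn
  have hΨ' : HasFDerivAt Ψ (ContinuousLinearMap.id ℂ (ℂ × (J → ℂ))) 0 := by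
    have := hstrict.to_localInverse.hasFDerivAt
    rw [hΦ0] at this
    exact this
  have hinv : ∀ᶠ y in 𝓝 0, Φ (Ψ y) = y := by
    have := hstrict.eventually_right_inverse
    rwa [hΦ0] at this
  let ι : ℝ →L[ℝ] ℂ × (J → ℂ) := Complex.ofRealCLM.prod 0
  let c : ℝ → ℂ × (J → ℂ) := fun t => Ψ (ι t)
  -- Analyticity at a point extends to a neighbourhood; `ContDiffAt` with `∞` at one point would not
  -- provide a common interval for all orders.
  have hc : ∀ᶠ t in 𝓝 (0 : ℝ), ContDiffAt ℝ ω c t := by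
    refine ContDiffAt.eventually ?_ (by simp)
    have h1 : ContDiffAt ℝ ω Ψ (ι 0) := by
      rw [map_zero]; exact hΨ.restrict_scalars ℝ
    exact h1.comp 0 ι.contDiff.contDiffAt
  have hc0 : c 0 = 0 := by
    change Ψ (ι 0) = 0
    rw [map_zero, hΨ0]
  have hc' : HasDerivAt c ((1 : ℂ), (0 : J → ℂ)) 0 := by
    have h1 : HasFDerivAt Ψ ((ContinuousLinearMap.id ℂ (ℂ × (J → ℂ))).restrictScalars ℝ) (ι 0) := by
      rw [map_zero]; exact hΨ'.restrictScalars ℝ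
    exact (h1.comp_hasDerivAt 0 ι.hasDerivAt).congr_deriv (by simp [ι])
  have hcinv : ∀ᶠ t in 𝓝 (0 : ℝ), Φ (c t) = ι t := by
    have h1 : Filter.Tendsto ι (𝓝 0) (𝓝 0) := by simpa using ι.continuous.tendsto 0
    exact h1.eventually hinv
  have hcb : ∀ᶠ t in 𝓝 (0 : ℝ), ∀ j, F j (c t) = 0 →
      ∃ φ ∈ bloch τ τ' (⟨u, hu⟩ + lin (c t) : potentials).1 (a j) (b j), φ ≠ 0 := by
    have h1 : Filter.Tendsto c (𝓝 0) (𝓝 0) := by simpa [hc0] using hc'.continuousAt.tendsto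
    exact Filter.eventually_all.mpr fun j => h1.eventually (hFb j)
  obtain ⟨ε, hε, hball⟩ := Metric.eventually_nhds_iff.mp (hc.and (hcinv.and hcb))
  have hI : ∀ t ∈ Ioo (-ε) ε, dist t 0 < ε := fun t ht => by
    rwa [Real.dist_eq, sub_zero, abs_lt]
  refine ⟨fun t => u + (lin (c t)).1, ⟨?_, ε, hε, ?_, fun t ht => ?_⟩, fun p => ?_⟩
  · simp [hc0]
  · change ContDiffOn ℝ ∞ (fun q : ℝ × (ℝ × ℝ) => u q.2 + (lin (c q.1)).1 q.2) _
    simp only [hlin]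
    have hcd : ContDiffOn ℝ ∞ c (Ioo (-ε) ε) := fun t ht =>
      ((hball (hI t ht)).1.of_le le_top).contDiffWithinAt
    have hm : MapsTo (Prod.fst : ℝ × (ℝ × ℝ) → ℝ) (Ioo (-ε) ε ×ˢ univ) (Ioo (-ε) ε) :=
      fun q hq => hq.1
    have h1 : ContDiffOn ℝ ∞ (fun q : ℝ × (ℝ × ℝ) => (c q.1).1) (Ioo (-ε) ε ×ˢ univ) :=
      hcd.fst.comp contDiffOn_fst hm
    have h2 : ∀ k, ContDiffOn ℝ ∞ (fun q : ℝ × (ℝ × ℝ) => (c q.1).2 k) (Ioo (-ε) ε ×ˢ univ) :=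
      fun k => (contDiffOn_pi.mp hcd.snd k).comp contDiffOn_fst hm
    have hs : ∀ {f : ℝ × ℝ → ℂ}, f ∈ potentials →
        ContDiffOn ℝ ∞ (fun q : ℝ × (ℝ × ℝ) => f q.2) (Ioo (-ε) ε ×ˢ univ) := fun hf =>
      (hf.1.comp contDiff_snd).contDiffOn
    exact (hs hu).add ((h1.mul (hs hv)).add (ContDiffOn.sum fun k _ => (h2 k).mul (hs (w k).2)))
  · obtain ⟨-, hi, hb⟩ := hball (hI t ht)
    have hpot : u + (lin (c t)).1 ∈ potentials := add_mem hu (lin (c t)).2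
    have hj : ∀ j, (a j, b j) ∈ fermiCurve τ τ' (u + (lin (c t)).1) := fun j => by
      refine hb j ?_
      have := congrFun (congrArg Prod.snd hi) j
      exact this
    exact ⟨hpot, fun j => ⟨hj j, exists_bloch_dual_ne_zero hτ hτ' (mul_inv_cancel _)
      (mul_inv_cancel _) hpot (hj j)⟩⟩
  · simp only [Pi.add_apply, hlin]
    have h1 : HasDerivAt (fun t => (c t).1) 1 0 := hc'.fst
    have h2 : ∀ k, HasDerivAt (fun t => (c t).2 k) 0 0 := fun k =>
      (hasDerivAt_pi.mp hc'.snd) k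
    have h3 := (h1.mul_const (v p)).add (HasDerivAt.fun_sum (u := Finset.univ) fun k _ =>
      (h2 k).mul_const ((w k).1 p))
    simpa using h3.const_add (u p)

end

section

/-! ### Sigma models -/

section SigmaModel

variable {τ τ' : ℂ} {α β α' β' : ℂˣ}

theorem dZ_dZbar_mul {f g : ℝ × ℝ → ℂ} (hf : f ∈ twisted α β) (hg : g ∈ twisted α' β')
    (p : ℝ × ℝ) : dZ τ τ' (dZbar τ τ' (f * g)) p =
      dZ τ τ' (dZbar τ τ' f) p * g p + dZbar τ τ' f p * dZ τ τ' g p +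
        (dZ τ τ' f p * dZbar τ τ' g p + f p * dZ τ τ' (dZbar τ τ' g) p) := by
  have df := differentiable_of_mem_twisted hf
  have dg := differentiable_of_mem_twisted hg
  have dbf : Differentiable ℝ (dZbar τ τ' f) := differentiable_dZbar hf.1
  have dbg : Differentiable ℝ (dZbar τ τ' g) := differentiable_dZbar hg.1
  have h : dZbar τ τ' (f * g) = dZbar τ τ' f * g + f * dZbar τ τ' g :=
    funext fun q => dZbar_mul df dg q
  rw [h, dZ_add (dbf.mul dg) (df.mul dbg), Pi.add_apply, dZ_mul dbf dg, dZ_mul df dbg]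

theorem one_mem_potentials : (1 : ℝ × ℝ → ℂ) ∈ potentials :=
  ⟨contDiff_const, fun _ _ => by simp, fun _ _ => by simp⟩

theorem dZ_dZbar_one (p : ℝ × ℝ) : dZ τ τ' (dZbar τ τ' 1) p = 0 := by
  have h : dZbar τ τ' (1 : ℝ × ℝ → ℂ) = 0 := by
    funext q; simp [dZbar, dX, dY, fderiv_one]
  rw [h]
  simp [dZ, dX, dY]

variable {m n : ℕ} {a b : Fin m ⊕ Fin n → ℂˣ} {u : ℝ × ℝ → ℂ}

/-- The Lagrange multiplier is determined by the equations of motion and the constraint. -/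
theorem multiplier_eq {f fσ : Fin m → ℝ × ℝ → ℂ} {χ : Fin n → ℝ × ℝ → ℂ}
    (hab : ∀ i : Fin n, a (.inr i) ^ 2 = 1 ∧ b (.inr i) ^ 2 = 1)
    (hf : ∀ j, f j ∈ bloch τ τ' u (a (.inl j)) (b (.inl j)))
    (hfσ : ∀ j, fσ j ∈ bloch τ τ' u (a (.inl j))⁻¹ (b (.inl j))⁻¹)
    (hχ : ∀ i, χ i ∈ bloch τ τ' u (a (.inr i)) (b (.inr i)))
    (hc : ∀ p, ∑ j, fσ j p * f j p + ∑ i, χ i p ^ 2 = 1) (p : ℝ × ℝ) :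
    u p = -(1 / 2) * ∑ j, (dZ τ τ' (fσ j) p * dZbar τ τ' (f j) p
      + dZbar τ τ' (fσ j) p * dZ τ τ' (f j) p) - ∑ i, dZ τ τ' (χ i) p * dZbar τ τ' (χ i) p := by
  have hP : ∀ j, fσ j * f j ∈ twisted 1 1 := fun j =>
    mul_mem_potentials_of_dual (inv_mul_cancel _) (inv_mul_cancel _) (hfσ j).1 (hf j).1
  have hQ : ∀ i, χ i * χ i ∈ twisted 1 1 := fun i =>
    mul_mem_potentials_of_dual ((sq _).symm.trans (hab i).1) ((sq _).symm.trans (hab i).2)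
      (hχ i).1 (hχ i).1
  have h1 : (1 : ℝ × ℝ → ℂ) ∈ twisted 1 1 := one_mem_potentials
  have hsum : ∑ j, (⟨_, hP j⟩ : twisted 1 1) + ∑ i, ⟨_, hQ i⟩ = ⟨1, h1⟩ := by
    ext q
    simpa [Finset.sum_apply, sq] using hc q
  have hD : ∀ {F : ℝ × ℝ → ℂ} (hF : F ∈ twisted 1 1),
      (schr τ τ' 0 (⟨F, hF⟩ : twisted 1 1)).1 p = dZ τ τ' (dZbar τ τ' F) p := fun hF => by
    rw [schr_apply]; simp
  -- With zero potential `schr` is `∂∂̄`. Applied to the constraint, it gives `0 = 2 u` times the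
  -- constraint sum plus the mixed first derivative terms.
  have h := congrFun (congrArg Subtype.val (congrArg (schr τ τ' 0) hsum)) p
  rw [hD h1, dZ_dZbar_one] at h
  simp only [map_add, map_sum, Submodule.coe_add, AddSubmonoidClass.coe_finsetSum, Pi.add_apply,
    Finset.sum_apply, hD, fun j => dZ_dZbar_mul (τ := τ) (τ' := τ') (hfσ j).1 (hf j).1 p,
    fun i => dZ_dZbar_mul (τ := τ) (τ' := τ') (hχ i).1 (hχ i).1 p, (hf _).2, (hfσ _).2,
    (hχ _).2] at h
  have e1 : ∑ j, (u p * fσ j p * f j p + dZbar τ τ' (fσ j) p * dZ τ τ' (f j) p +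
      (dZ τ τ' (fσ j) p * dZbar τ τ' (f j) p + fσ j p * (u p * f j p))) =
      2 * u p * ∑ j, fσ j p * f j p + ∑ j, (dZ τ τ' (fσ j) p * dZbar τ τ' (f j) p
      + dZbar τ τ' (fσ j) p * dZ τ τ' (f j) p) := by
    rw [Finset.mul_sum, ← Finset.sum_add_distrib]
    exact Finset.sum_congr rfl fun j _ => by ring
  have e2 : ∑ i, (u p * χ i p * χ i p + dZbar τ τ' (χ i) p * dZ τ τ' (χ i) p +
      (dZ τ τ' (χ i) p * dZbar τ τ' (χ i) p + χ i p * (u p * χ i p))) =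
      2 * u p * ∑ i, χ i p ^ 2 + 2 * ∑ i, dZ τ τ' (χ i) p * dZbar τ τ' (χ i) p := by
    rw [Finset.mul_sum, Finset.mul_sum, ← Finset.sum_add_distrib]
    exact Finset.sum_congr rfl fun i _ => by ring
  rw [e1, e2] at h
  linear_combination (1 / 2 : ℂ) * h - u p * hc p

/-- Sigma model solutions with simple twists correspond to linear relations between the products
of dual Bloch solutions and the constant function. -/
theorem exists_isSigmaModelSolution_iff
    (hab : ∀ i : Fin n, a (.inr i) ^ 2 = 1 ∧ b (.inr i) ^ 2 = 1)
    {ψ g : Fin m ⊕ Fin n → ℝ × ℝ → ℂ} (hψ : ∀ j, ψ j ∈ bloch τ τ' u (a j) (b j))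
    (hspan : ∀ j, ∀ f ∈ bloch τ τ' u (a j) (b j), ∃ c : ℂ, f = c • ψ j)
    (hg : ∀ j, g j ∈ bloch τ τ' u (a j)⁻¹ (b j)⁻¹) (hg0 : ∀ j, g j ≠ 0)
    (hspan' : ∀ j, ∀ f ∈ bloch τ τ' u (a j)⁻¹ (b j)⁻¹, ∃ c : ℂ, f = c • g j) :
    (∃ (f fσ : Fin m → ℝ × ℝ → ℂ) (χ : Fin n → ℝ × ℝ → ℂ),
      IsSigmaModelSolution τ τ' a b u f fσ χ) ↔ ∃ c : Fin m ⊕ Fin n → ℂ,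
        ∑ j, c j • (ψ j * g j) = 1 := by
  -- Twists of order two are their own inverses, so both solutions lie in the same line.
  have hs : ∀ i : Fin n, ∃ s : ℂ, g (.inr i) = s • ψ (.inr i) := fun i => by
    refine hspan _ _ ?_
    have := hg (.inr i)
    rwa [inv_eq_of_mul_eq_one_right ((sq _).symm.trans (hab i).1),
      inv_eq_of_mul_eq_one_right ((sq _).symm.trans (hab i).2)] at this
  choose s hs using hs
  have hs0 : ∀ i, s i ≠ 0 := fun i h => hg0 (.inr i) (by rw [hs, h, zero_smul])
  constructor
  · rintro ⟨f, fσ, χ, hS⟩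
    have hf : ∀ j, ∃ c : ℂ, f j = c • ψ (.inl j) := fun j =>
      hspan _ _ ⟨hS.twist_ψ j, hS.eq_ψ j⟩
    have hfσ : ∀ j, ∃ c : ℂ, fσ j = c • g (.inl j) := fun j =>
      hspan' _ _ ⟨hS.twist_ψσ j, hS.eq_ψσ j⟩
    have hχ : ∀ i, ∃ c : ℂ, χ i = c • ψ (.inr i) := fun i =>
      hspan _ _ ⟨hS.twist_χ i, hS.eq_χ i⟩
    choose c hc using hf
    choose d hd using hfσ
    choose e he using hχ
    refine ⟨Sum.elim (fun j => c j * d j) fun i => e i ^ 2 / s i, ?_⟩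
    funext p
    rw [Pi.one_apply, ← hS.constraint p]
    simp only [Fintype.sum_sum_type, Sum.elim_inl, Sum.elim_inr, Finset.sum_apply,
      Pi.smul_apply, Pi.mul_apply, smul_eq_mul, hc, hd, he, hs]
    congr 1
    · exact Finset.sum_congr rfl fun j _ => by ring
    · refine Finset.sum_congr rfl fun i _ => ?_
      have := hs0 i
      field_simp
  · rintro ⟨c, hc⟩
    -- The fields `χ` enter quadratically, so absorbing their coefficients takes a complex square
    -- root; for the other pairs the coefficient goes into one factor.
    have hr : ∀ i, ∃ r : ℂ, r ^ 2 = c (.inr i) * s i := fun i =>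
      IsAlgClosed.exists_pow_nat_eq _ two_pos
    choose r hr using hr
    have hf : ∀ j, c (.inl j) • ψ (.inl j) ∈ bloch τ τ' u (a (.inl j)) (b (.inl j)) := fun j =>
      Submodule.smul_mem _ _ (hψ _)
    have hχ : ∀ i, r i • ψ (.inr i) ∈ bloch τ τ' u (a (.inr i)) (b (.inr i)) := fun i =>
      Submodule.smul_mem _ _ (hψ _)
    have hcon : ∀ p, ∑ j, g (.inl j) p * (c (.inl j) • ψ (.inl j)) p +
        ∑ i, (r i • ψ (.inr i)) p ^ 2 = 1 := fun p => by
      have := congrFun hc p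
      simp only [Fintype.sum_sum_type, Finset.sum_apply,
        Pi.smul_apply, Pi.mul_apply, smul_eq_mul, hs, Pi.one_apply] at this
      rw [← this]
      congr 1
      · exact Finset.sum_congr rfl fun j _ => by simp only [Pi.smul_apply, smul_eq_mul]; ring
      · refine Finset.sum_congr rfl fun i _ => ?_
        rw [Pi.smul_apply, smul_eq_mul, mul_pow, hr]
        ring
    exact ⟨fun j => c (.inl j) • ψ (.inl j), fun j => g (.inl j), fun i => r i • ψ (.inr i),
      { twist_ψ := fun j => (hf j).1
        twist_ψσ := fun j => (hg _).1
        twist_χ := fun i => (hχ i).1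
        eq_ψ := fun j => (hf j).2
        eq_ψσ := fun j => (hg _).2
        eq_χ := fun i => (hχ i).2
        constraint := hcon
        multiplier := multiplier_eq hab hf (fun j => hg _) hχ hcon }⟩

end SigmaModel

/-! ### Critical points -/

/-- A finite family of functions spans the constants if and only if the integral vanishes on
the potentials orthogonal to the family. -/
theorem forall_sqInt_eq_zero_iff {J : Type*} [Fintype J] {h : J → ℝ × ℝ → ℂ}
    (hh : ∀ j, h j ∈ potentials) :
    (∀ v ∈ potentials, (∀ j, sqInt (v * h j) = 0) → sqInt v = 0) ↔
      ∃ c : J → ℂ, ∑ j, c j • h j = 1 := by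
  have hc := fun j => continuous_of_mem_twisted (hh j)
  have h1c : Continuous (1 : ℝ × ℝ → ℂ) := continuous_const
  constructor
  · intro H
    -- A functional vanishing on the common kernel of finitely many functionals is a combination of
    -- them; nondegeneracy turns this into an identity of functions.
    have hmem : pairing 1 h1c ∈ Submodule.span ℂ (range fun j => pairing (h j) (hc j)) := by
      refine mem_span_of_iInf_ker_le_ker fun v hv => ?_
      rw [Submodule.mem_iInf] at hv
      rw [LinearMap.mem_ker, pairing_apply, mul_one]
      exact H v v.2 hv
    obtain ⟨c, hc'⟩ := (Submodule.mem_span_range_iff_exists_fun ℂ).mp hmem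
    have hsum : ∑ j, c j • h j ∈ potentials :=
      Submodule.sum_mem _ fun j _ => Submodule.smul_mem _ _ (hh j)
    refine ⟨c, sub_eq_zero.mp (eq_zero_of_forall_sqInt_mul (sub_mem hsum one_mem_potentials)
      fun w hw => ?_)⟩
    have hwc := continuous_of_mem_twisted hw
    have hsc := continuous_of_mem_twisted hsum
    have e : w * (∑ j, c j • h j - 1) = fun p => (w * ∑ j, c j • h j) p - (w * 1) p := by
      funext p; simp [mul_sub]
    rw [e, sqInt_sub (hwc.mul hsc) (hwc.mul h1c), sqInt_mul_sum hwc hc, sub_eq_zero]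
    have := LinearMap.congr_fun hc' ⟨w, hw⟩
    simpa only [LinearMap.sum_apply, LinearMap.smul_apply, pairing_apply, smul_eq_mul] using this
  · rintro ⟨c, h1⟩ v hv h0
    rw [← mul_one v, ← h1, sqInt_mul_sum (continuous_of_mem_twisted hv) hc]
    simp [h0]

end

end TorusSigma

end

/-! ### Assembly of the main theorem -/

open TorusSigma in
theorem mainTheorem3 (τ τ' : ℂ) (hτ : 0 < τ.im) (hτ' : τ'.im < 0) (m n : ℕ)
    (a b : Fin m ⊕ Fin n → ℂˣ)
    (hab : ∀ i : Fin n, a (.inr i) ^ 2 = 1 ∧ b (.inr i) ^ 2 = 1)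
    (u : ℝ × ℝ → ℂ) (hu : u ∈ locus τ τ' a b)
    (hsimple : ∀ j, Module.finrank ℂ (bloch τ τ' u (a j) (b j)) = 1)
    (ψ ψσ : Fin m ⊕ Fin n → ℝ × ℝ → ℂ)
    (hψ : ∀ j, ψ j ∈ bloch τ τ' u (a j) (b j) ∧ ψ j ≠ 0)
    (hψσ : ∀ j, ψσ j ∈ bloch τ τ' u (a j)⁻¹ (b j)⁻¹ ∧ ψσ j ≠ 0) :
    -- the tangent space is cut out by the orthogonality relations
    (∀ v ∈ potentials, v ∈ tangent τ τ' a b u ↔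
      ∀ j, torusIntegral τ τ' (fun p => v p * ψ j p * ψσ j p) = 0) ∧
    -- velocities of families are tangent, and at regular points nothing else is
    (∀ v, IsVelocity τ τ' a b u v → v ∈ tangent τ τ' a b u) ∧
    (LinearIndependent ℂ (fun j => ψ j * ψσ j) →
      ∀ v ∈ potentials, IsVelocity τ τ' a b u v ↔
        ∀ j, torusIntegral τ τ' (fun p => v p * ψ j p * ψσ j p) = 0) ∧
    -- sigma-model solutions correspond to critical points of the average of the potential
    (IsCritical τ τ' a b u ↔
      ∃ (f fσ : Fin m → ℝ × ℝ → ℂ) (χ : Fin n → ℝ × ℝ → ℂ),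
        IsSigmaModelSolution τ τ' a b u f fσ χ) ∧
    ((∃ (f fσ : Fin m → ℝ × ℝ → ℂ) (χ : Fin n → ℝ × ℝ → ℂ),
        IsSigmaModelSolution τ τ' a b u f fσ χ) → IsStationary τ τ' a b u) ∧
    (LinearIndependent ℂ (fun j => ψ j * ψσ j) →
      (IsStationary τ τ' a b u ↔
        ∃ (f fσ : Fin m → ℝ × ℝ → ℂ) (χ : Fin n → ℝ × ℝ → ℂ),
          IsSigmaModelSolution τ τ' a b u f fσ χ)) := by
  have hne : τ' - τ ≠ 0 := fun h => by
    have := congrArg Complex.im h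
    rw [Complex.sub_im, Complex.zero_im] at this
    linarith
  have hI : ∀ f, torusIntegral τ τ' f = (τ' - τ) * sqInt f := fun _ => rfl
  have hI0 : ∀ f, torusIntegral τ τ' f = 0 ↔ sqInt f = 0 := fun f => by
    rw [hI, mul_eq_zero, or_iff_right hne]
  have hspan : ∀ j, ∀ f ∈ bloch τ τ' u (a j) (b j), ∃ c : ℂ, f = c • ψ j := fun j f hf => by
    have h0 : (⟨ψ j, (hψ j).1⟩ : bloch τ τ' u (a j) (b j)) ≠ 0 := fun h =>
      (hψ j).2 (congrArg Subtype.val h)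
    obtain ⟨c, hc⟩ := (finrank_eq_one_iff_of_nonzero' _ h0).mp (hsimple j) ⟨f, hf⟩
    exact ⟨c, (congrArg Subtype.val hc).symm⟩
  have hspan' : ∀ j, ∀ f ∈ bloch τ τ' u (a j)⁻¹ (b j)⁻¹, ∃ c : ℂ, f = c • ψσ j := fun j =>
    bloch_dual_span (u := ⟨u, hu.1⟩) hτ hτ' (mul_inv_cancel _) (mul_inv_cancel _) (hψ j).1
      (hψ j).2 (hspan j) (hψσ j).1 (hψσ j).2
  have htan : ∀ v ∈ potentials, v ∈ tangent τ τ' a b u ↔ ∀ j, sqInt (v * ψ j * ψσ j) = 0 := by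
    intro v hv
    have h1 : ∀ j, StaysOnFermiCurve τ τ' u v (a j) (b j) ↔ sqInt (v * ψ j * ψσ j) = 0 := fun j =>
      staysOnFermiCurve_iff hτ hτ' (mul_inv_cancel _) (mul_inv_cancel _) hu.1 (hψ j).1 (hψ j).2
        (hspan j) (hψσ j).1 (hψσ j).2 hv
    -- Exchanging the roles of `ψ j` and `ψσ j` gives the same integral, so the inverse multipliers
    -- impose no further condition.
    have h2 : ∀ j, StaysOnFermiCurve τ τ' u v (a j)⁻¹ (b j)⁻¹ ↔ sqInt (v * ψ j * ψσ j) = 0 :=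
      fun j => by
        rw [mul_right_comm]
        exact staysOnFermiCurve_iff hτ hτ' (inv_mul_cancel _) (inv_mul_cancel _) hu.1 (hψσ j).1
          (hψσ j).2 (hspan' j) (hψ j).1 (hψ j).2 hv
    exact ⟨fun h j => (h1 j).mp (h.2 j).1, fun h => ⟨hv, fun j => ⟨(h1 j).mpr (h j),
      (h2 j).mpr (h j)⟩⟩⟩
  have hvel : ∀ v, IsVelocity τ τ' a b u v → v ∈ tangent τ τ' a b u := by
    rintro v ⟨γ, hγ, hv⟩
    exact (htan v (hγ.velocity_mem_potentials hv)).mpr fun j =>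
      hγ.sqInt_velocity_mul hτ hτ' hv j (hψ j).1 (hψ j).2 (hspan j) (hψσ j).1 (hψσ j).2
  have hreg : LinearIndependent ℂ (fun j => ψ j * ψσ j) → ∀ v ∈ tangent τ τ' a b u,
      IsVelocity τ τ' a b u v := fun hli v hv =>
    isVelocity_of_orthogonal hτ hτ' hu.1 (fun j => (hψ j).1) (fun j => (hψ j).2) hspan
      (fun j => (hψσ j).1) (fun j => (hψσ j).2) hli hv.1 ((htan v hv.1).mp hv)
  have hcrit : IsCritical τ τ' a b u ↔
      ∃ (f fσ : Fin m → ℝ × ℝ → ℂ) (χ : Fin n → ℝ × ℝ → ℂ),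
        IsSigmaModelSolution τ τ' a b u f fσ χ := by
    rw [exists_isSigmaModelSolution_iff hab (fun j => (hψ j).1) hspan (fun j => (hψσ j).1)
      (fun j => (hψσ j).2) hspan', ← forall_sqInt_eq_zero_iff fun j =>
      mul_mem_potentials_of_dual (mul_inv_cancel _) (mul_inv_cancel _) (hψ j).1.1 (hψσ j).1.1]
    simp only [← mul_assoc]
    exact ⟨fun h v hv hj => (hI0 v).mp (h v ((htan v hv).mpr hj)),
      fun h v hv => (hI0 v).mpr (h v hv.1 ((htan v hv.1).mp hv))⟩
  have hstat : IsCritical τ τ' a b u → IsStationary τ τ' a b u := fun hc γ hγ => by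
    obtain ⟨v, hv⟩ := hγ.exists_velocity
    have := (hγ.hasDerivAt_sqInt hv).const_mul (τ' - τ)
    rwa [← hI, hc v (hvel v ⟨γ, hγ, hv⟩)] at this
  have hstat' : LinearIndependent ℂ (fun j => ψ j * ψσ j) → IsStationary τ τ' a b u →
      IsCritical τ τ' a b u := fun hli hs v hv => by
    obtain ⟨γ, hγ, hγv⟩ := hreg hli v hv
    exact ((hγ.hasDerivAt_sqInt hγv).const_mul (τ' - τ)).unique (hs γ hγ)
  exact ⟨fun v hv => (htan v hv).trans (forall_congr' fun _ => (hI0 _).symm), hvel,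
    fun hli v hv => ⟨fun h j => (hI0 _).mpr ((htan v hv).mp (hvel v h) j), fun h =>
      hreg hli v ((htan v hv).mpr fun j => (hI0 _).mp (h j))⟩,
    hcrit, fun h => hstat (hcrit.mpr h), fun hli =>
      ⟨fun h => hcrit.mp (hstat' hli h), fun h => hstat (hcrit.mpr h)⟩⟩
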